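/- **Definitions.** A *signature* is a finite directed multigraph together with a finite list of equations between parallel paths. Its *schema* $[\![S]\!]$ is the free category on the graph modulo the congruence generated by the equations. A *signature morphism* sends nodes to nodes and edges to paths and respects equivalence of paths; it induces a functor of schemas. Fix an effectively encoded set $\tau$ of (names of) base types. A *typed signature* over $\tau$ is a signature with a finite set of attributes, each attached to a node and given a base type; a *typed signature morphism* is a signature morphism together with a map of attributes that is compatible with the nodes and preserves base types. Given a set $\mathrm{dom}(t)$ for each $t\in\tau$, a *typed instance* on $S$ is a functor $I:[\![S]\!]\to\mathbf{Set}$ with a function $\delta_a : I(\text{node of }a)\to \mathrm{dom}(\text{type of }a)$ for every attribute $a$; a morphism of typed instances is a natural transformation that commutes with the functions $\delta_a$. The category of typed instances is $S\textbf{-Inst}$. An *FQL query* $Q:S\rightsquigarrow T$ is a triple of typed signature morphisms $S\xleftarrow{F}S'\xrightarrow{G}S''\xrightarrow{H}T$ such that the four schemas are finite categories, $G$ is bijective on attributes, $H$ is a discrete op-fibration on schemas, and the square formed by the attributes of $S''$ and $T$ and the schemas of $S''$ and $T$ is a fiber product: for every object $x$ of $[\![S'']\!]$ and every attribute $b$ of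 $T$ at $H(x)$ there is a unique attribute of $S''$ at $x$ that $H$ sends to $b$. It denotes the functor $[\![Q]\!]=\Sigma_H\Pi_G\Delta_F : S\textbf{-Inst}\to T\textbf{-Inst}$, in which, on the functor part of an instance, $\Delta_F$ is composition with $F$, $\Pi_G$ is the right adjoint of composition with $G$, and $\Sigma_H$ is the left adjoint of composition with $H$ (disjoint union over the objects above a given one), and these act on the attribute data in the canonical way: by restriction along the attribute map for $\Delta_F$, through the counit for $\Pi_G$, and summand by summand for $\Sigma_H$. The query is *$\Delta$-restricted* if $F$ is a discrete op-fibration on schemas. **Theorem (closure under composition).** (1) There is an algorithm that, given the finite descriptions of any two FQL queries $f:S\rightsquigarrow X$ and $g:X\rightsquigarrow T$, halts and returns the finite description of an FQL query $g\cdot f:S\rightsquigarrow T$ such that, for every choice of the sets $\mathrm{dom}(t)$, the functors $[\![g\cdot f]\!]$ and $[\![g]\!]\circ[\![f]\!]$ from $S\textbf{-Inst}$ to $T\textbf{-Inst}$ are naturally isomorphic. (2) There is also such an algorithm for $\Delta$-restricted queries: given $\Delta$-restricted $f$ and $g$, it returns a $\Delta$-restricted query $g\cdot f$ with the same property. (The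 untyped statements are the case in which there are no attributes.) -/

import Mathlib

open CategoryTheory

universe u w

set_option synthInstance.maxSize 1024
set_option synthInstance.maxHeartbeats 200000

/-! ### Signatures and schemas -/

/-- The graph of a signature: finitely many nodes and finitely many directed edges. -/
structure FinGraph where
  numNodes : ℕ
  numEdges : ℕ
  src : Fin numEdges → Fin numNodes
  tgt : Fin numEdges → Fin numNodes

namespace FinGraph

/-- The nodes of a finite graph. -/
def Node (G : FinGraph) : Type := Fin G.numNodes

instance (G : FinGraph) : Quiver G.Node where
  Hom x y := {e : Fin G.numEdges // G.src e = x ∧ G.tgt e = y}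

end FinGraph

/-- A pair of parallel paths in a graph, regarded as an equation `lhs = rhs`. -/
structure PathEquation (G : FinGraph) where
  source : G.Node
  target : G.Node
  lhs : Quiver.Path source target
  rhs : Quiver.Path source target

/-- A signature: a finite graph with finitely many path equations. -/
structure Signature where
  graph : FinGraph
  eqns : List (PathEquation graph)

namespace Signature

/-- The nodes of a signature. -/
abbrev Node (S : Signature) : Type := S.graph.Node

/-- The relation on paths given by the equations of the signature. -/
def rel (S : Signature) : HomRel (Paths S.Node) := fun x y p q =>
  ∃ E ∈ S.eqns, ∃ (hx : E.source = x) (hy : E.target = y),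
    E.lhs.cast hx hy = p ∧ E.rhs.cast hx hy = q

/-- The schema of `S`: the free category on its graph, modulo the congruence that
its equations generate. -/
abbrev Schema (S : Signature) : Type := CategoryTheory.Quotient S.rel

/-- A node, as an object of the schema. -/
abbrev ob (S : Signature) (x : S.Node) : S.Schema := ⟨x⟩

/-- A path, as a morphism of the schema. -/
def pathHom (S : Signature) {x y : S.Node} (p : Quiver.Path x y) : S.ob x ⟶ S.ob y :=
  (CategoryTheory.Quotient.functor S.rel).map (X := (x : Paths S.Node)) (Y := (y : Paths S.Node)) p

/-- The schema is a finite category (a signature has finitely many nodes anyway). -/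
def IsFinite (S : Signature) : Prop := ∀ x y : S.Schema, Finite (x ⟶ y)

end Signature

/-- A signature morphism sends nodes to nodes and edges to paths, and it sends
equivalent paths to equivalent paths (it is enough to say so for the equations). -/
structure SignatureMorphism (S T : Signature) where
  onNode : S.Node → T.Node
  onEdge : ∀ {x y : S.Node}, (x ⟶ y) → Quiver.Path (onNode x) (onNode y)
  respects : ∀ E ∈ S.eqns,
    (CategoryTheory.Quotient.functor T.rel).map
        ((Paths.lift (C := Paths T.Node) ⟨onNode, onEdge⟩).map
          (X := (E.source : Paths S.Node)) (Y := (E.target : Paths S.Node)) E.lhs) =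
      (CategoryTheory.Quotient.functor T.rel).map
        ((Paths.lift (C := Paths T.Node) ⟨onNode, onEdge⟩).map
          (X := (E.source : Paths S.Node)) (Y := (E.target : Paths S.Node)) E.rhs)

namespace SignatureMorphism

variable {S T : Signature}

/-- The action of a signature morphism on paths. -/
def onPath (F : SignatureMorphism S T) : Paths S.Node ⥤ Paths T.Node :=
  Paths.lift (C := Paths T.Node) ⟨F.onNode, F.onEdge⟩

/-- The schema morphism of a signature morphism. -/
def functor (F : SignatureMorphism S T) : S.Schema ⥤ T.Schema :=
  CategoryTheory.Quotient.lift S.rel (F.onPath ⋙ CategoryTheory.Quotient.functor T.rel) (by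
    rintro x y p q ⟨E, hE, rfl, rfl, rfl, rfl⟩
    exact F.respects E hE)

end SignatureMorphism

/-! ### Discrete op-fibrations and the left push-forward along them -/

section Opfibration

variable {C D : Type} [Category.{0} C] [Category.{0} D]

/-- `F` is a discrete op-fibration: every arrow `g : F c ⟶ d` is the image of a unique
arrow with source `c`. -/
def IsDiscreteOpfibration (F : C ⥤ D) : Prop :=
  ∀ (c : C) ⦃d : D⦄ (g : F.obj c ⟶ d),
    ∃! l : (c' : C) × (c ⟶ c'), ∃ h : F.obj l.1 = d, F.map l.2 ≫ eqToHom h = g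

namespace IsDiscreteOpfibration

variable {F : C ⥤ D} (hF : IsDiscreteOpfibration F)

/-- The unique lift of an arrow `g` out of `d`, starting at an object over `d`. -/
noncomputable def lift {d d' : D} (c : {c : C // F.obj c = d}) (g : d ⟶ d') :
    (c' : C) × (c.1 ⟶ c') :=
  (hF c.1 (eqToHom c.2 ≫ g)).choose

theorem obj_lift {d d' : D} (c : {c : C // F.obj c = d}) (g : d ⟶ d') :
    F.obj (hF.lift c g).1 = d' :=
  (hF c.1 (eqToHom c.2 ≫ g)).choose_spec.1.choose

theorem map_lift {d d' : D} (c : {c : C // F.obj c = d}) (g : d ⟶ d') :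
    F.map (hF.lift c g).2 ≫ eqToHom (hF.obj_lift c g) = eqToHom c.2 ≫ g :=
  (hF c.1 (eqToHom c.2 ≫ g)).choose_spec.1.choose_spec

theorem lift_unique {d d' : D} (c : {c : C // F.obj c = d}) (g : d ⟶ d')
    (l : (c' : C) × (c.1 ⟶ c')) (h : F.obj l.1 = d')
    (hl : F.map l.2 ≫ eqToHom h = eqToHom c.2 ≫ g) : hF.lift c g = l :=
  ((hF c.1 (eqToHom c.2 ≫ g)).choose_spec.2 l ⟨h, hl⟩).symm

/-- `(Σ_F I)(d)`: the disjoint union of the sets `I(c)` over the objects `c` above `d`. -/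
abbrev SigmaObj (F : C ⥤ D) (I : C ⥤ Type w) (d : D) : Type w :=
  (c : {c : C // F.obj c = d}) × I.obj c.1

/-- The action of `Σ_F I` on an arrow `g`, through the lifts of `g`. -/
noncomputable def sigmaMap (I : C ⥤ Type w) {d d' : D} (g : d ⟶ d')
    (z : SigmaObj F I d) : SigmaObj F I d' :=
  ⟨⟨(hF.lift z.1 g).1, hF.obj_lift z.1 g⟩, I.map (hF.lift z.1 g).2 z.2⟩

theorem sigmaMap_eq (I : C ⥤ Type w) {d d' : D} (g : d ⟶ d') (c : {c : C // F.obj c = d})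
    (x : I.obj c.1) (c' : {c : C // F.obj c = d'}) (m : c.1 ⟶ c'.1)
    (hm : F.map m ≫ eqToHom c'.2 = eqToHom c.2 ≫ g) :
    hF.sigmaMap I g ⟨c, x⟩ = ⟨c', I.map m x⟩ := by
  have key : ∀ (l : (c' : C) × (c.1 ⟶ c')) (h : F.obj l.1 = d')
      (_ : l = ⟨c'.1, m⟩),
      (⟨⟨l.1, h⟩, I.map l.2 x⟩ : SigmaObj F I d') = ⟨c', I.map m x⟩ := by
    rintro l h rfl
    rfl
  exact key _ _ (hF.lift_unique c g ⟨c'.1, m⟩ c'.2 hm)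

/-- The left push-forward `Σ_F` along a discrete op-fibration. -/
noncomputable def sigma : (C ⥤ Type w) ⥤ (D ⥤ Type w) where
  obj I :=
    { obj := SigmaObj F I
      map := fun g => TypeCat.ofHom (hF.sigmaMap I g)
      map_id := by
        intro d
        apply ConcreteCategory.hom_ext
        rintro ⟨c, x⟩
        have := hF.sigmaMap_eq I (𝟙 d) c x c (𝟙 c.1) (by simp)
        rw [I.map_id] at this
        exact this
      map_comp := by
        intro d d' d'' g g'
        apply ConcreteCategory.hom_ext
        rintro ⟨c, x⟩
        have := hF.sigmaMap_eq I (g ≫ g') c x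
          ⟨(hF.lift ⟨(hF.lift c g).1, hF.obj_lift c g⟩ g').1, hF.obj_lift _ _⟩
          ((hF.lift c g).2 ≫ (hF.lift ⟨(hF.lift c g).1, hF.obj_lift c g⟩ g').2)
          (by
            rw [F.map_comp, Category.assoc, hF.map_lift, ← Category.assoc, hF.map_lift,
              Category.assoc])
        rw [I.map_comp] at this
        exact this }
  map {I J} α :=
    { app := fun d => TypeCat.ofHom fun z => ⟨z.1, α.app z.1.1 z.2⟩
      naturality := by
        intro d d' g
        apply ConcreteCategory.hom_ext
        rintro ⟨c, x⟩
        have := NatTrans.naturality_apply α (hF.lift c g).2 x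
        exact congrArg (fun y => (⟨⟨(hF.lift c g).1, hF.obj_lift c g⟩, y⟩ : SigmaObj F J d'))
          this }

/-- `Σ_F` is left adjoint to the pullback functor `Δ_F`. -/
noncomputable def sigmaAdjunction :
    hF.sigma ⊣ (Functor.whiskeringLeft C D (Type w)).obj F :=
  Adjunction.mkOfHomEquiv
    { homEquiv := fun I J =>
        { toFun := fun α =>
            { app := fun c => TypeCat.ofHom fun x => α.app (F.obj c) ⟨⟨c, rfl⟩, x⟩
              naturality := by
                intro c c' m
                apply ConcreteCategory.hom_ext
                intro x
                have h := NatTrans.naturality_apply α (F.map m) ⟨⟨c, rfl⟩, x⟩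
                have e := hF.sigmaMap_eq I (F.map m) ⟨c, rfl⟩ x ⟨c', rfl⟩ m (by simp)
                exact (congrArg (α.app (F.obj c')) e).symm.trans h }
          invFun := fun β =>
            { app := fun d => TypeCat.ofHom fun z => J.map (eqToHom z.1.2) (β.app z.1.1 z.2)
              naturality := by
                intro d d' g
                apply ConcreteCategory.hom_ext
                rintro ⟨c, x⟩
                have h := NatTrans.naturality_apply β (hF.lift c g).2 x
                have e := congrArg (fun t => J.map t (β.app c.1 x)) (hF.map_lift c g)
                simp only [Functor.map_comp, ConcreteCategory.comp_apply] at e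
                exact (congrArg (J.map (eqToHom (hF.obj_lift c g))) h).trans e }
          left_inv := by
            intro α
            apply NatTrans.ext
            funext d
            apply ConcreteCategory.hom_ext
            rintro ⟨⟨c, rfl⟩, x⟩
            simp
          right_inv := by
            intro β
            apply NatTrans.ext
            funext c
            apply ConcreteCategory.hom_ext
            intro x
            simp }
      homEquiv_naturality_left_symm := by
        intro I I' J f g
        rfl
      homEquiv_naturality_right := by
        intro I J J' f g
        rfl }

end IsDiscreteOpfibration

end Opfibration

/-! ### Typed signatures and typed instances -/

/-- A typed signature over a set `τ` of base types: a signature with a finite set of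
attributes, each of which belongs to a node and has a base type. -/
structure TypedSignature (τ : Type u) extends Signature where
  numAttrs : ℕ
  attrNode : Fin numAttrs → toSignature.Node
  attrType : Fin numAttrs → τ

namespace TypedSignature

variable {τ : Type u}

/-- The object of the schema to which an attribute belongs. -/
abbrev attrOb (S : TypedSignature τ) (a : Fin S.numAttrs) : S.Schema := S.ob (S.attrNode a)

end TypedSignature

/-- A typed signature morphism: a signature morphism with a map of attributes that
is compatible with their nodes and preserves their base types. -/
structure TypedMorphism {τ : Type u} (S T : TypedSignature τ) extends
    SignatureMorphism S.toSignature T.toSignature where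
  onAttr : Fin S.numAttrs → Fin T.numAttrs
  attrNode_comm : ∀ a, onNode (S.attrNode a) = T.attrNode (onAttr a)
  attrType_comm : ∀ a, T.attrType (onAttr a) = S.attrType a

namespace TypedMorphism

variable {τ : Type u} {S T : TypedSignature τ}

theorem attrOb_comm (F : TypedMorphism S T) (a : Fin S.numAttrs) :
    F.functor.obj (S.attrOb a) = T.attrOb (F.onAttr a) :=
  show T.ob (F.onNode (S.attrNode a)) = _ from congrArg T.ob (F.attrNode_comm a)

/-- The attribute map is bijective, that is, the identity up to renaming of attributes. -/
def IsPiReady (F : TypedMorphism S T) : Prop := Function.Bijective F.onAttr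

/-- The structure part is a discrete op-fibration and the attributes of `S` are
the fiber product of those of `T` with the objects of the schema of `S`. -/
structure IsSigmaReady (F : TypedMorphism S T) : Prop where
  opfibration : IsDiscreteOpfibration F.functor
  attr_pullback : ∀ (x : S.Schema) (b : Fin T.numAttrs), F.functor.obj x = T.attrOb b →
    ∃! a : Fin S.numAttrs, S.attrOb a = x ∧ F.onAttr a = b

end TypedMorphism

/-- A typed instance: a set-valued functor on the schema, and for each attribute `a`
of base type `t` a function to the domain of `t`. -/
structure TypedInstance {τ : Type u} (dom : τ → Type w) (S : TypedSignature τ) where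
  str : S.Schema ⥤ Type w
  data : ∀ a : Fin S.numAttrs, str.obj (S.attrOb a) → dom (S.attrType a)

namespace TypedInstance

variable {τ : Type u} {dom : τ → Type w} {S T : TypedSignature τ}

/-- A morphism of typed instances: a natural transformation that preserves the data. -/
@[ext]
structure Hom (I J : TypedInstance dom S) where
  nat : I.str ⟶ J.str
  data_comm : ∀ (a : Fin S.numAttrs) (x : I.str.obj (S.attrOb a)),
    J.data a (nat.app (S.attrOb a) x) = I.data a x

instance : Category (TypedInstance dom S) where
  Hom := Hom
  id I := ⟨𝟙 I.str, by intro a x; simp⟩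
  comp f g := ⟨f.nat ≫ g.nat, by intro a x; simp [g.data_comm, f.data_comm]⟩
  id_comp f := by apply Hom.ext; exact Category.id_comp f.nat
  comp_id f := by apply Hom.ext; exact Category.comp_id f.nat
  assoc f g h := by apply Hom.ext; exact Category.assoc f.nat g.nat h.nat

@[simp] theorem id_nat (I : TypedInstance dom S) : Hom.nat (𝟙 I) = 𝟙 I.str := rfl

@[simp] theorem comp_nat {I J K : TypedInstance dom S} (f : I ⟶ J) (g : J ⟶ K) :
    Hom.nat (f ≫ g) = Hom.nat f ≫ Hom.nat g := rfl

@[ext] theorem hom_ext {I J : TypedInstance dom S} {f g : I ⟶ J}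
    (h : Hom.nat f = Hom.nat g) : f = g := Hom.ext h

end TypedInstance

/-! ### Typed data migration functors -/

namespace TypedMorphism

open TypedInstance

variable {τ : Type u} {S T : TypedSignature τ} (dom : τ → Type w)

/-- `Δ_F`: the structure part is composition with the schema morphism, and an attribute
of `S` takes its values from the attribute of `T` to which it is sent. -/
def delta (F : TypedMorphism S T) : TypedInstance dom T ⥤ TypedInstance dom S where
  obj J :=
    { str := F.functor ⋙ J.str
      data := fun a x => cast (congrArg dom (F.attrType_comm a))
        (J.data (F.onAttr a) (J.str.map (eqToHom (F.attrOb_comm a)) x)) }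
  map {J J'} f :=
    { nat := Functor.whiskerLeft F.functor (Hom.nat f)
      data_comm := by
        intro a x
        have h := NatTrans.naturality_apply (Hom.nat f) (eqToHom (F.attrOb_comm a)) x
        have h' := Hom.data_comm f (F.onAttr a) (J.str.map (eqToHom (F.attrOb_comm a)) x)
        rw [h] at h'
        exact congrArg (fun y => cast _ y) h' }

/-- The attribute of `S` over a given attribute of `T`. -/
noncomputable def piAttr {F : TypedMorphism S T} (hF : F.IsPiReady) (b : Fin T.numAttrs) :
    Fin S.numAttrs :=
  (Equiv.ofBijective F.onAttr hF).symm b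

theorem onAttr_piAttr {F : TypedMorphism S T} (hF : F.IsPiReady) (b : Fin T.numAttrs) :
    F.onAttr (piAttr hF b) = b :=
  (Equiv.ofBijective F.onAttr hF).apply_symm_apply b

/-- `Π_F`: the structure part is the right Kan extension, that is, the right adjoint of
composition with the schema morphism, and the data part is the counit followed by the
data part of the given instance. -/
noncomputable def pi (F : TypedMorphism S T) (hF : F.IsPiReady) :
    TypedInstance dom S ⥤ TypedInstance dom T where
  obj I :=
    { str := F.functor.ran.obj I.str
      data := fun b x => cast
        (congrArg dom ((F.attrType_comm (piAttr hF b)).symm.trans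
          (congrArg T.attrType (onAttr_piAttr hF b))))
        (I.data (piAttr hF b)
          (((F.functor.ranCounit (H := Type w)).app I.str).app (S.attrOb (piAttr hF b))
            ((F.functor.ran.obj I.str).map
              (eqToHom (((F.attrOb_comm (piAttr hF b)).trans
                (congrArg T.attrOb (onAttr_piAttr hF b))).symm)) x))) }
  map {I I'} f :=
    { nat := F.functor.ran.map (Hom.nat f)
      data_comm := by
        intro b x
        set e := eqToHom (((F.attrOb_comm (piAttr hF b)).trans
          (congrArg T.attrOb (onAttr_piAttr hF b))).symm)
        have h := NatTrans.naturality_apply (F.functor.ran.map (Hom.nat f)) e x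
        have h1 := congr_app ((F.functor.ranCounit (H := Type w)).naturality (Hom.nat f))
          (S.attrOb (piAttr hF b))
        have h2 := congrArg (fun t => t ((F.functor.ran.obj I.str).map e x)) h1
        have h3 := Hom.data_comm f (piAttr hF b)
          (((F.functor.ranCounit (H := Type w)).app I.str).app (S.attrOb (piAttr hF b))
            ((F.functor.ran.obj I.str).map e x))
        have h4 := (congrArg (I'.data (piAttr hF b)) h2).trans h3
        refine congrArg (fun y => cast _ y) (Eq.trans ?_ h4)
        exact congrArg (fun y => I'.data (piAttr hF b)
          (((F.functor.ranCounit (H := Type w)).app I'.str).app (S.attrOb (piAttr hF b)) y))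
          h.symm }
  map_id I := by
    apply hom_ext
    exact F.functor.ran.map_id I.str
  map_comp f g := by
    apply hom_ext
    exact F.functor.ran.map_comp (Hom.nat f) (Hom.nat g)

namespace IsSigmaReady

variable {F : TypedMorphism S T} (hF : F.IsSigmaReady)

/-- The attribute of `S` at the object `x` over a given attribute of `T`. -/
noncomputable def attr (b : Fin T.numAttrs) (x : {x : S.Schema // F.functor.obj x = T.attrOb b}) :
    Fin S.numAttrs :=
  (hF.attr_pullback x.1 b x.2).choose

theorem attrOb_attr (b : Fin T.numAttrs) (x : {x : S.Schema // F.functor.obj x = T.attrOb b}) :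
    S.attrOb (hF.attr b x) = x.1 :=
  (hF.attr_pullback x.1 b x.2).choose_spec.1.1

theorem onAttr_attr (b : Fin T.numAttrs) (x : {x : S.Schema // F.functor.obj x = T.attrOb b}) :
    F.onAttr (hF.attr b x) = b :=
  (hF.attr_pullback x.1 b x.2).choose_spec.1.2

end IsSigmaReady

/-- `Σ_F`: the structure part is the left push-forward, and the attribute data are united in
the same way as the elements. -/
noncomputable def sigma (F : TypedMorphism S T) (hF : F.IsSigmaReady) :
    TypedInstance dom S ⥤ TypedInstance dom T where
  obj I :=
    { str := hF.opfibration.sigma.obj I.str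
      data := fun b z => cast
        (congrArg dom ((F.attrType_comm (hF.attr b z.1)).symm.trans
          (congrArg T.attrType (hF.onAttr_attr b z.1))))
        (I.data (hF.attr b z.1)
          (I.str.map (eqToHom (hF.attrOb_attr b z.1).symm) z.2)) }
  map {I I'} f :=
    { nat := hF.opfibration.sigma.map (Hom.nat f)
      data_comm := by
        rintro b ⟨x, y⟩
        have h := NatTrans.naturality_apply (Hom.nat f)
          (eqToHom (hF.attrOb_attr b x).symm) y
        have h' := Hom.data_comm f (hF.attr b x)
          (I.str.map (eqToHom (hF.attrOb_attr b x).symm) y)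
        rw [h] at h'
        exact congrArg (fun y => cast _ y) h' }
  map_id I := by
    apply hom_ext
    exact hF.opfibration.sigma.map_id I.str
  map_comp f g := by
    apply hom_ext
    exact hF.opfibration.sigma.map_comp (Hom.nat f) (Hom.nat g)

end TypedMorphism

/-! ### FQL queries -/

/-- An FQL query from `S` to `T`: typed signature morphisms `S ⟵ S' ⟶ S'' ⟶ T` between
typed signatures with finite schemas. -/
structure FQLQuery {τ : Type u} (S T : TypedSignature τ) where
  mid₁ : TypedSignature τ
  mid₂ : TypedSignature τ
  F : TypedMorphism mid₁ S
  G : TypedMorphism mid₁ mid₂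
  H : TypedMorphism mid₂ T
  finite_source : S.IsFinite
  finite_mid₁ : mid₁.IsFinite
  finite_mid₂ : mid₂.IsFinite
  finite_target : T.IsFinite
  piReady : G.IsPiReady
  sigmaReady : H.IsSigmaReady

namespace FQLQuery

variable {τ : Type u} {S T : TypedSignature τ}

/-- The data migration functor `Σ_H Π_G Δ_F` that a query denotes. -/
noncomputable def denote (Q : FQLQuery S T) (dom : τ → Type w) :
    TypedInstance dom S ⥤ TypedInstance dom T :=
  Q.F.delta dom ⋙ Q.G.pi dom Q.piReady ⋙ Q.H.sigma dom Q.sigmaReady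

/-- The query is also `Δ`-restricted: `F` is a discrete op-fibration. -/
def IsDeltaRestricted (Q : FQLQuery S T) : Prop := IsDiscreteOpfibration Q.F.functor

end FQLQuery

/-! ### Queries as finite data

An algorithm reads and writes the lists of numbers and names of base types that
describe a query. -/

/-- The sequence of edges of a path. -/
def pathCode {G : FinGraph} {x : G.Node} : ∀ {y : G.Node}, Quiver.Path x y → List ℕ
  | _, .nil => []
  | _, .cons p e => pathCode p ++ [e.1.val]

/-- Number of nodes; source and target of each edge; start node and the two edge sequences
of each path equation; node and base type of each attribute. -/
abbrev SignatureCode (τ : Type u) : Type u :=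
  ℕ × List (ℕ × ℕ) × List (ℕ × List ℕ × List ℕ) × List (ℕ × τ)

/-- Image of each node, edge sequence of the image of each edge, image of each attribute. -/
abbrev MorphismCode : Type := List ℕ × List (List ℕ) × List ℕ

/-- The four typed signatures `S, S', S'', T` and the three morphisms of a query. -/
abbrev QueryCode (τ : Type u) : Type u :=
  (SignatureCode τ × SignatureCode τ × SignatureCode τ × SignatureCode τ) ×
    (MorphismCode × MorphismCode × MorphismCode)

/-- The finite data of a typed signature. -/
def TypedSignature.code {τ : Type u} (S : TypedSignature τ) : SignatureCode τ :=
  (S.graph.numNodes,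
   List.ofFn fun e => ((S.graph.src e).val, (S.graph.tgt e).val),
   S.eqns.map fun E => (Fin.val (n := S.graph.numNodes) E.source, pathCode E.lhs, pathCode E.rhs),
   List.ofFn fun a => (Fin.val (n := S.graph.numNodes) (S.attrNode a), S.attrType a))

/-- The finite data of a typed signature morphism. -/
def TypedMorphism.code {τ : Type u} {S T : TypedSignature τ} (F : TypedMorphism S T) :
    MorphismCode :=
  (List.ofFn fun x : Fin S.graph.numNodes => Fin.val (n := T.graph.numNodes) (F.onNode x),
   List.ofFn fun e : Fin S.graph.numEdges =>
     pathCode (F.onEdge (x := S.graph.src e) (y := S.graph.tgt e) ⟨e, rfl, rfl⟩),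
   List.ofFn fun a => (F.onAttr a).val)

/-- The finite data of a query. -/
def FQLQuery.code {τ : Type u} {S T : TypedSignature τ} (Q : FQLQuery S T) : QueryCode τ :=
  ((S.code, Q.mid₁.code, Q.mid₂.code, T.code), (Q.F.code, Q.G.code, Q.H.code))

/-!
Let `f = Σ_{H₁} Π_{G₁} Δ_{F₁}` and `g = Σ_{H₂} Π_{G₂} Δ_{F₂}` be two queries, through the schemas
`A₁`, `B₁` and `A₂`, `B₂`, with `X` in the middle. The composite is brought into the same form by
moving `Δ_{F₂}` and `Π_{G₂}` to the right of `Σ_{H₁}` and of `Π_{G₁}`, as for polynomial functors.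

*Distributivity.* Since `H₁` is a discrete op-fibration, it is the category of elements of its
functor of fibres, and an element of `Π_{G₂} Δ_{F₂} Σ_{H₁} J` at `b` is a compatible choice, for
each arrow `u : b ⟶ G₂ a`, of an object of `B₁` over `F₂ a` together with an element of `J` there.
The choices of objects alone are the sections `sections F₂ G₂ hH` over `b`. Hence the functor is
`Σ`, along the category of elements of the sections, of `Π` along the base change `elBaseChange`
of `G₂`, of `Δ` along the evaluation of sections, `evalFunctor` (`IsPi.distribCounit`).

*Base change.* The remaining `Δ_{evalFunctor} Π_{G₁}` is `Π Δ` along the two projections of the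
comma category of `evalFunctor` and `G₁`, since its square is exact (`IsPi.exactCounit`). If `F₂`
is a discrete op-fibration, then so is `evalFunctor`, and the pullback is already exact; its
projection to `A₁` is again a discrete op-fibration. Both cases are treated as a comma category on
a class of arrows, `CommaOn`: all arrows, or the identities. The two `Π` are then composed by
`IsPi.of_comp`, and the two `Σ` by `TypedMorphism.nonempty_sigma_comp_iso`.

`Π` is handled throughout by the pointwise universal property `IsPi` of its counit, since the
attribute data of `Π` are defined by means of the counit. The attributes of the composite are the
pairs of an attribute of `B₂` and a section over its node; such a pair determines an attribute of
`A₁`, because those of `B₁` form a fiber product. An explicit formula for the counit of the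
composite (`CompositionData.counit_spec`) shows that the data agree, which gives
`nonempty_denote_iso`.

*The algorithm.* The middle schemas of the composite are finite categories whose tables are
computed from tables of the schemas and functors of `f` and `g`, by listing all sections and all
objects of the comma category (`CompInput.Describes.sectionPres`, `CompInput.Describes.commaPres`).
A table is turned into a signature with all arrows as edges and the composition table as equations
(`Pres.sig`, `Pres.ofSchema`). What remains is to compute the table of the schema of a signature,
if it is finite. It has a certificate `SchemaCert`: a normal form for each arrow, the action of the
edges on the arrows, and derivations of the normal forms from the equations. The validity of a
certificate is decidable, a valid one yields the table (`SchemaCert.Valid.pres`), and a finite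
schema has one (`SchemaCert.exists_valid`). So the algorithm `composeQueries` searches for
certificates and outputs the composite that they determine. All its steps are primitive recursive,
and the search halts on all pairs of queries, as their schemas are finite.
-/

/-! ### Pointwise right Kan extensions of set-valued functors -/

section Pi

variable {C D : Type} [Category.{0} C] [Category.{0} D]

/-- A compatible family: for every arrow `u : d ⟶ G c` an element of `I c`, naturally in `c`. -/
def CompatFamily (G : C ⥤ D) (I : C ⥤ Type w) (d : D) (s : ∀ c, (d ⟶ G.obj c) → I.obj c) : Prop :=
  ∀ ⦃c c' : C⦄ (k : c ⟶ c') (u : d ⟶ G.obj c), I.map k (s c u) = s c' (u ≫ G.map k)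

/-- `ε` exhibits `R` as `Π_G I`: the elements of `R d` are the compatible families on the
arrows out of `d`. This is the pointwise form of being a right Kan extension. -/
def IsPi (G : C ⥤ D) {I : C ⥤ Type w} {R : D ⥤ Type w} (ε : G ⋙ R ⟶ I) : Prop :=
  ∀ (d : D) (s : ∀ c, (d ⟶ G.obj c) → I.obj c), CompatFamily G I d s →
    ∃! x : R.obj d, ∀ c u, ε.app c (R.map u x) = s c u

/-- An element of `R d` has a compatible family of values under `ε`. -/
theorem CompatFamily.of_element (G : C ⥤ D) {I : C ⥤ Type w} {R : D ⥤ Type w} (ε : G ⋙ R ⟶ I)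
    {d : D} (x : R.obj d) : CompatFamily G I d fun c u => ε.app c (R.map u x) := by
  intro c c' k u
  have h := NatTrans.naturality_apply ε k (R.map u x)
  exact h.symm.trans (congrArg (ε.app c') (R.map_comp_apply u (G.map k) x).symm)

theorem IsPi.ext {G : C ⥤ D} {I : C ⥤ Type w} {R : D ⥤ Type w} {ε : G ⋙ R ⟶ I} (h : IsPi G ε)
    {d : D} {x y : R.obj d} (hxy : ∀ c u, ε.app c (R.map u x) = ε.app c (R.map u y)) : x = y :=
  (h d _ (CompatFamily.of_element G ε y)).unique hxy fun _ _ => rfl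

/-- The chosen right Kan extension has the pointwise universal property, as the limits that
compute it exist in `Type w`: the schemas are small. -/
theorem isPi_ranCounit (G : C ⥤ D) (I : C ⥤ Type w) : IsPi G (G.ranCounit.app I) := by
  intro d s hs
  have h := Functor.isPointwiseRightKanExtensionOfIsRightKanExtension (F := I) _
    (G.ranCounit.app I) d
  have h' := (Limits.Types.isLimit_iff _).1 ⟨h⟩ (fun j => s j.right j.hom) (by
    intro j j' f
    have := hs f.right j.hom
    rw [StructuredArrow.w f] at this
    exact this)
  obtain ⟨x, hx, hu⟩ := h'
  refine ⟨x, fun c u => hx (StructuredArrow.mk u), fun y hy => hu y fun j => hy j.right j.hom⟩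

/-- The map `Z ⟶ R` into a `Π_G I` that corresponds to `θ : G ⋙ Z ⟶ I`. -/
noncomputable def IsPi.lift {G : C ⥤ D} {I : C ⥤ Type w} {R : D ⥤ Type w} {ε : G ⋙ R ⟶ I}
    (h : IsPi G ε) {Z : D ⥤ Type w} (θ : G ⋙ Z ⟶ I) : Z ⟶ R where
  app d := TypeCat.ofHom fun z => (h d _ (CompatFamily.of_element G θ z)).choose
  naturality d d' k := by
    apply ConcreteCategory.hom_ext
    intro z
    apply h.ext
    intro c u
    have h1 := (h d' _ (CompatFamily.of_element G θ (Z.map k z))).choose_spec.1 c u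
    have h2 := (h d _ (CompatFamily.of_element G θ z)).choose_spec.1 c (k ≫ u)
    simp only [Functor.map_comp_apply] at h2
    exact h1.trans h2.symm

theorem IsPi.lift_fac {G : C ⥤ D} {I : C ⥤ Type w} {R : D ⥤ Type w} {ε : G ⋙ R ⟶ I}
    (h : IsPi G ε) {Z : D ⥤ Type w} (θ : G ⋙ Z ⟶ I) (c : C) (z : Z.obj (G.obj c)) :
    ε.app c ((h.lift θ).app (G.obj c) z) = θ.app c z := by
  have h1 := (h _ _ (CompatFamily.of_element G θ z)).choose_spec.1 c (𝟙 _)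
  simp only [Functor.map_id_apply] at h1
  exact h1

theorem IsPi.hom_ext {G : C ⥤ D} {I : C ⥤ Type w} {R : D ⥤ Type w} {ε : G ⋙ R ⟶ I}
    (h : IsPi G ε) {Z : D ⥤ Type w} {φ ψ : Z ⟶ R}
    (hφ : ∀ c (z : Z.obj (G.obj c)), ε.app c (φ.app (G.obj c) z) = ε.app c (ψ.app (G.obj c) z)) :
    φ = ψ := by
  apply NatTrans.ext
  funext d
  apply ConcreteCategory.hom_ext
  intro z
  apply h.ext
  intro c u
  have h1 := NatTrans.naturality_apply φ u z
  have h2 := NatTrans.naturality_apply ψ u z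
  rw [← h1, ← h2]
  exact hφ _ _

/-- `Π` along a composite: if `N` is `Π_p I` and `R` is `Π_{g p} I`, then `R` is `Π_g N`. -/
theorem IsPi.of_comp {C₁ : Type} [Category.{0} C₁] {p : C ⥤ C₁} {g : C₁ ⥤ D} {I : C ⥤ Type w}
    {N : C₁ ⥤ Type w} {R : D ⥤ Type w} {ν : p ⋙ N ⟶ I} (hν : IsPi p ν)
    {ε : (p ⋙ g) ⋙ R ⟶ I} (hε : IsPi (p ⋙ g) ε) :
    IsPi g (hν.lift (Z := g ⋙ R) ε) := by
  intro d τ hτ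
  obtain ⟨r, hr, hu⟩ := hε d (fun c u => ν.app c (τ (p.obj c) u)) (by
    intro c c' k u
    have h1 := hτ (p.map k) u
    have h2 := NatTrans.naturality_apply ν k (τ (p.obj c) u)
    exact h2.symm.trans (congrArg (ν.app c') h1))
  refine ⟨r, ?_, ?_⟩
  · intro c₁ u
    apply hν.ext
    intro c w
    have h1 := NatTrans.naturality_apply (hν.lift (Z := g ⋙ R) ε) w (R.map u r)
    rw [← h1]
    refine (hν.lift_fac (Z := g ⋙ R) ε c _).trans ?_
    have h2 := hr c (u ≫ g.map w)
    rw [Functor.map_comp_apply] at h2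
    rw [hτ w u]
    exact h2
  · intro y hy
    apply hu
    intro c u
    have := hy (p.obj c) u
    rw [← this]
    exact (hν.lift_fac (Z := g ⋙ R) ε c _).symm

/-- If `R` is `Π` along `G` followed by a fully faithful functor `N`, then its restriction along
`N` is `Π_G`. -/
theorem IsPi.of_fullyFaithful {D' : Type} [Category.{0} D'] {G : C ⥤ D} (N : D ⥤ D') [N.Full]
    [N.Faithful] {I : C ⥤ Type w} {R : D' ⥤ Type w} {ε : (G ⋙ N) ⋙ R ⟶ I}
    (h : IsPi (G ⋙ N) ε) : IsPi G (R := N ⋙ R) ε := by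
  intro d s hs
  obtain ⟨x, hx, hu⟩ := h (N.obj d) (fun c u => s c (N.preimage u)) (by
    intro c c' k u
    have h1 := hs k (N.preimage u)
    rw [h1]
    congr 1
    apply N.map_injective
    simp)
  refine ⟨x, fun c u => ?_, fun y hy => hu y fun c u => ?_⟩
  · have := hx c (N.map u)
    rw [N.preimage_map] at this
    exact this
  · have := hy c (N.preimage u)
    simp only [Functor.comp_map, N.map_preimage] at this
    exact this

/-- Being `Π_G I` does not change when `G` is replaced by an isomorphic functor. -/
theorem IsPi.of_iso {G G' : C ⥤ D} (α : G' ≅ G) {I : C ⥤ Type w} {R : D ⥤ Type w}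
    {ε : G ⋙ R ⟶ I} (h : IsPi G ε) : IsPi G' (Functor.whiskerRight α.hom R ≫ ε) := by
  intro d s hs
  obtain ⟨x, hx, hu⟩ := h d (fun c u => s c (u ≫ α.inv.app c)) (by
    intro c c' k u
    rw [hs k]
    simp)
  refine ⟨x, fun c u => ?_, fun y hy => hu y fun c u => ?_⟩
  · have := hx c (u ≫ α.hom.app c)
    rw [Functor.map_comp_apply] at this
    simp only [Category.assoc, Iso.hom_inv_id_app, Category.comp_id] at this
    exact this
  · have := hy c (u ≫ α.inv.app c)
    rw [← this]
    simp only [NatTrans.comp_app, Functor.whiskerRight_app, ConcreteCategory.comp_apply,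
      ← Functor.map_comp_apply, Category.assoc, Iso.inv_hom_id_app, Category.comp_id]

/-- Being `Π_G I` does not change when the extension is replaced by an isomorphic one. -/
theorem IsPi.of_iso_left {G : C ⥤ D} {I : C ⥤ Type w} {R R' : D ⥤ Type w}
    {ε : G ⋙ R ⟶ I} (h : IsPi G ε) (θ : R' ≅ R) : IsPi G (Functor.whiskerLeft G θ.hom ≫ ε) := by
  intro d s hs
  obtain ⟨x, hx, hu⟩ := h d s hs
  have key : ∀ y c (u : d ⟶ G.obj c), (Functor.whiskerLeft G θ.hom ≫ ε).app c (R'.map u y) =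
      ε.app c (R.map u (θ.hom.app d y)) := by
    intro y c u
    exact congrArg (ε.app c) (NatTrans.naturality_apply θ.hom u y)
  refine ⟨θ.inv.app d x, fun c u => ?_, fun y hy => ?_⟩
  · rw [key]
    simp only [Iso.inv_hom_id_app_apply]
    exact hx c u
  · have : θ.hom.app d y = x := hu _ fun c u => by rw [← key]; exact hy c u
    rw [← this]
    simp

/-- A functor on the target of an equivalence `E` is the `Π_E` of its restriction. -/
theorem isPi_of_equivalence (E : C ⥤ D) [E.IsEquivalence] (I : D ⥤ Type w) :
    IsPi E (𝟙 (E ⋙ I)) := by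
  intro d s hs
  let e := E.objObjPreimageIso d
  refine ⟨I.map e.hom (s _ e.inv), fun c u => ?_, fun y hy => ?_⟩
  · have h := hs (E.preimage (e.hom ≫ u)) e.inv
    simp only [Functor.comp_map, Functor.map_preimage, Iso.inv_hom_id_assoc] at h
    rw [← h, Functor.map_comp_apply]
    rfl
  · rw [← hy _ e.inv]
    have h := (Functor.map_comp_apply I e.inv e.hom y)
    rw [e.inv_hom_id, Functor.map_id_apply] at h
    exact h

end Pi

/-! ### Categories of elements -/

section El

variable {D : Type} [Category.{0} D]

/-- The objects of the category of elements of a set-valued functor. -/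
structure El (S : D ⥤ Type) : Type where
  base : D
  elt : S.obj base

namespace El

variable {S : D ⥤ Type}

/-- An arrow of the base that carries one element to the other. -/
@[ext]
structure Hom (x y : El S) : Type where
  hom : x.base ⟶ y.base
  map_elt : S.map hom x.elt = y.elt

instance : Category (El S) where
  Hom := Hom
  id x := ⟨𝟙 _, S.map_id_apply _ _⟩
  comp f g := ⟨f.hom ≫ g.hom, by rw [S.map_comp_apply, f.map_elt, g.map_elt]⟩
  id_comp f := Hom.ext (Category.id_comp f.hom)
  comp_id f := Hom.ext (Category.comp_id f.hom)
  assoc f g h := Hom.ext (Category.assoc f.hom g.hom h.hom)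

@[ext]
theorem hom_ext {x y : El S} {f g : x ⟶ y} (h : Hom.hom f = Hom.hom g) : f = g := Hom.ext h

@[simp] theorem id_hom (x : El S) : Hom.hom (𝟙 x) = 𝟙 x.base := rfl

theorem eqToHom_hom {x y : El S} (h : x = y) :
    Hom.hom (eqToHom h) = eqToHom (congrArg El.base h) := by
  subst h
  rfl

variable (S)

/-- The projection of the category of elements to the base. -/
def proj : El S ⥤ D where
  obj x := x.base
  map f := Hom.hom f

theorem isDiscreteOpfibration_proj : IsDiscreteOpfibration (proj S) := by
  rintro ⟨d, s⟩ d' (g : d ⟶ d')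
  refine ⟨⟨⟨d', S.map g s⟩, ⟨g, rfl⟩⟩, ⟨rfl, Category.comp_id g⟩, ?_⟩
  rintro ⟨⟨d'', s'⟩, ⟨g', h'⟩⟩ ⟨h, h''⟩
  replace h : d'' = d' := h
  subst h
  obtain rfl : g = g' := h''.symm.trans (Category.comp_id g')
  obtain rfl : S.map g s = s' := h'
  rfl

end El

end El

/-! ### Fibres of discrete op-fibrations -/

namespace IsDiscreteOpfibration

variable {C D : Type} [Category.{0} C] [Category.{0} D] {F : C ⥤ D} (hF : IsDiscreteOpfibration F)

/-- The functor of fibres of a discrete op-fibration. -/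
noncomputable def fibre : D ⥤ Type where
  obj d := {c : C // F.obj c = d}
  map g := TypeCat.ofHom fun c => ⟨(hF.lift c g).1, hF.obj_lift c g⟩
  map_id d := by
    apply ConcreteCategory.hom_ext
    intro c
    have := hF.lift_unique c (𝟙 d) ⟨c.1, 𝟙 c.1⟩ c.2 (by simp)
    exact Subtype.ext (congrArg Sigma.fst this)
  map_comp {d d' d''} g g' := by
    apply ConcreteCategory.hom_ext
    intro c
    have := hF.lift_unique c (g ≫ g')
      ⟨_, (hF.lift c g).2 ≫ (hF.lift ⟨(hF.lift c g).1, hF.obj_lift c g⟩ g').2⟩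
      (hF.obj_lift _ _) (by
        rw [F.map_comp, Category.assoc, hF.map_lift, ← Category.assoc, hF.map_lift,
          Category.assoc])
    exact Subtype.ext (congrArg Sigma.fst this)

/-- The arrow `m` between objects of two fibres lies over `g`. -/
def Over {d d' : D} (c : {c : C // F.obj c = d}) (c' : {c : C // F.obj c = d'}) (g : d ⟶ d')
    (m : c.1 ⟶ c'.1) : Prop :=
  F.map m ≫ eqToHom c'.2 = eqToHom c.2 ≫ g

theorem fibre_map_eq {d d' : D} {c : {c : C // F.obj c = d}} {c' : {c : C // F.obj c = d'}}
    {g : d ⟶ d'} (m : c.1 ⟶ c'.1) (hm : Over c c' g m) : hF.fibre.map g c = c' :=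
  Subtype.ext (congrArg Sigma.fst (hF.lift_unique c g ⟨c'.1, m⟩ c'.2 hm))

theorem exists_over {d d' : D} {c : {c : C // F.obj c = d}} {c' : {c : C // F.obj c = d'}}
    {g : d ⟶ d'} (h : hF.fibre.map g c = c') : ∃ m : c.1 ⟶ c'.1, Over c c' g m := by
  subst h
  exact ⟨(hF.lift c g).2, hF.map_lift c g⟩

/-- Lifts are unique, also as arrows between given objects of the fibres. -/
theorem over_unique (hF : IsDiscreteOpfibration F) {d d' : D} {c : {c : C // F.obj c = d}}
    {c' : {c : C // F.obj c = d'}} {g : d ⟶ d'} {m m' : c.1 ⟶ c'.1} (hm : Over c c' g m)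
    (hm' : Over c c' g m') : m = m' := by
  have h := (hF.lift_unique c g ⟨c'.1, m⟩ c'.2 hm).symm.trans
    (hF.lift_unique c g ⟨c'.1, m'⟩ c'.2 hm')
  exact eq_of_heq (Sigma.mk.inj h).2

/-- The functor to `C` from the category of elements of the fibres of `F : C ⥤ D`. It sends an
arrow to the unique one over it. -/
noncomputable def total : El hF.fibre ⥤ C where
  obj z := z.elt.1
  map {z z'} φ := (hF.exists_over φ.map_elt).choose
  map_id z := hF.over_unique (c := z.elt) (c' := z.elt)
    (hF.exists_over (El.Hom.map_elt (𝟙 z))).choose_spec (by simp [Over])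
  map_comp {z z' z''} φ ψ := by
    have h1 := (hF.exists_over φ.map_elt).choose_spec
    have h2 := (hF.exists_over ψ.map_elt).choose_spec
    refine hF.over_unique (c := z.elt) (c' := z''.elt)
      (hF.exists_over (El.Hom.map_elt (φ ≫ ψ))).choose_spec ?_
    unfold Over at *
    rw [F.map_comp, Category.assoc, h2, ← Category.assoc, h1, Category.assoc]
    rfl

theorem over_total {z z' : El hF.fibre} (φ : z ⟶ z') :
    Over z.elt z'.elt (El.Hom.hom φ) (hF.total.map φ) :=
  (hF.exists_over (El.Hom.map_elt φ)).choose_spec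

theorem comp (hF : IsDiscreteOpfibration F) {E : Type} [Category.{0} E] {G : D ⥤ E}
    (hG : IsDiscreteOpfibration G) :
    IsDiscreteOpfibration (F ⋙ G) := by
  intro c e g
  obtain ⟨⟨d, n⟩, ⟨hd, hn⟩, hu⟩ := hG (F.obj c) g
  obtain ⟨⟨c', m⟩, ⟨hc, hm⟩, hu'⟩ := hF c n
  dsimp only at hd hn hc hm
  subst hc
  subst hd
  simp only [eqToHom_refl, Category.comp_id] at hm hn
  subst hm
  refine ⟨⟨c', m⟩, ⟨rfl, by simpa using hn⟩, ?_⟩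
  rintro ⟨c'', m'⟩ ⟨h, h'⟩
  have h1 := hu ⟨F.obj c'', F.map m'⟩ ⟨h, h'⟩
  refine hu' ⟨c'', m'⟩ ⟨congrArg Sigma.fst h1, ?_⟩
  dsimp only
  have key : ∀ (l : (d : D) × (F.obj c ⟶ d)) (e : l = ⟨F.obj c', F.map m⟩),
      l.2 ≫ eqToHom (congrArg Sigma.fst e) = F.map m := by
    rintro _ rfl
    simp
  exact key _ h1

end IsDiscreteOpfibration

/-! ### Base change of a right Kan extension along an exact square -/

section Exact

variable {M C A B : Type} [Category.{0} M] [Category.{0} C] [Category.{0} A] [Category.{0} B]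

/-- A square `v : p ⋙ e ⟶ q ⋙ G` is exact if every arrow `e c ⟶ G a` factors through the
square, and all factorizations are connected to one of them by a span. -/
def IsExactSquare (p : M ⥤ C) (q : M ⥤ A) (e : C ⥤ B) (G : A ⥤ B) (v : p ⋙ e ⟶ q ⋙ G) : Prop :=
  ∀ (c : C) (a : A) (f : e.obj c ⟶ G.obj a),
    ∃ (m₀ : M) (k₀ : c ⟶ p.obj m₀) (i₀ : q.obj m₀ ⟶ a),
      e.map k₀ ≫ v.app m₀ ≫ G.map i₀ = f ∧
      ∀ (m : M) (k : c ⟶ p.obj m) (i : q.obj m ⟶ a), e.map k ≫ v.app m ≫ G.map i = f →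
        ∃ (m₁ : M) (k₁ : c ⟶ p.obj m₁) (μ : m₁ ⟶ m) (μ₀ : m₁ ⟶ m₀),
          k₁ ≫ p.map μ = k ∧ k₁ ≫ p.map μ₀ = k₀ ∧ q.map μ ≫ i = q.map μ₀ ≫ i₀

/-- The candidate for the counit that exhibits the restriction of `J` along `e` as `Π_p` of the
restriction of `L` along `q`, if `J` is `Π_G L`. -/
def exactCounit {p : M ⥤ C} {q : M ⥤ A} {e : C ⥤ B} {G : A ⥤ B} (v : p ⋙ e ⟶ q ⋙ G)
    {J : B ⥤ Type w} {L : A ⥤ Type w} (ε : G ⋙ J ⟶ L) : p ⋙ e ⋙ J ⟶ q ⋙ L :=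
  Functor.whiskerRight v J ≫ Functor.whiskerLeft q ε

/-- Base change: `Δ_e Π_G = Π_p Δ_q` for an exact square. -/
theorem IsPi.exactCounit {p : M ⥤ C} {q : M ⥤ A} {e : C ⥤ B} {G : A ⥤ B} {v : p ⋙ e ⟶ q ⋙ G}
    (hv : IsExactSquare p q e G v) {J : B ⥤ Type w} {L : A ⥤ Type w} {ε : G ⋙ J ⟶ L}
    (hε : IsPi G ε) : IsPi p (exactCounit v ε) := by
  intro c ρ hρ
  choose m₀ k₀ i₀ h₀ hu using hv c
  -- The family that `ρ` induces on the arrows out of `e c` does not depend on the factorization.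
  have key : ∀ (a : A) (f : e.obj c ⟶ G.obj a) (m : M) (k : c ⟶ p.obj m) (i : q.obj m ⟶ a),
      e.map k ≫ v.app m ≫ G.map i = f →
      L.map i (ρ m k) = L.map (i₀ a f) (ρ (m₀ a f) (k₀ a f)) := by
    intro a f m k i hf
    obtain ⟨m₁, k₁, μ, μ₀, h1, h2, h3⟩ := hu a f m k i hf
    have e1 := hρ μ k₁
    have e2 := hρ μ₀ k₁
    rw [h1] at e1
    rw [h2] at e2
    rw [← e1, ← e2]
    exact (L.map_comp_apply _ _ _).symm.trans
      ((congrArg (fun t => L.map t (ρ m₁ k₁)) h3).trans (L.map_comp_apply _ _ _))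
  obtain ⟨x, hx, hxu⟩ := hε (e.obj c)
    (fun a f => L.map (i₀ a f) (ρ (m₀ a f) (k₀ a f))) (by
      intro a a' l f
      have := key a' (f ≫ G.map l) (m₀ a f) (k₀ a f) (i₀ a f ≫ l) (by
        conv_rhs => rw [← h₀ a f]
        simp)
      rw [L.map_comp_apply] at this
      exact this)
  have val : ∀ (y : J.obj (e.obj c)) (m : M) (k : c ⟶ p.obj m),
      (_root_.exactCounit v ε).app m ((e ⋙ J).map k y) =
        ε.app (q.obj m) (J.map (e.map k ≫ v.app m) y) := by
    intro y m k
    exact congrArg (ε.app (q.obj m)) (J.map_comp_apply _ _ _).symm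
  refine ⟨x, fun m k => ?_, fun y hy => hxu y fun a f => ?_⟩
  · rw [val, hx]
    have := key _ (e.map k ≫ v.app m) m k (𝟙 _) (by simp)
    rw [L.map_id_apply] at this
    exact this.symm
  · rw [← hy, val]
    have h1 := NatTrans.naturality_apply ε (i₀ a f) (J.map (e.map (k₀ a f) ≫ v.app (m₀ a f)) y)
    refine Eq.trans ?_ h1
    apply congrArg (ε.app a)
    refine Eq.trans ?_ (J.map_comp_apply _ _ _)
    have := h₀ a f
    rw [← Category.assoc] at this
    exact congrArg (fun t => J.map t y) this.symm

end Exact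

/-! ### Comma categories on a class of arrows -/

section Comma

variable {C A B : Type} [Category.{0} C] [Category.{0} A] [Category.{0} B]

/-- The objects of the full subcategory of the comma category `(e ↓ G)` on the arrows that
satisfy `Q`. -/
structure CommaOn (e : C ⥤ B) (G : A ⥤ B) (Q : ∀ c a, (e.obj c ⟶ G.obj a) → Prop) : Type where
  left : C
  right : A
  hom : e.obj left ⟶ G.obj right
  prop : Q left right hom

namespace CommaOn

variable {e : C ⥤ B} {G : A ⥤ B} {Q : ∀ c a, (e.obj c ⟶ G.obj a) → Prop}

/-- A commutative square between two arrows `e c ⟶ G a`. -/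
@[ext]
structure Hom (x y : CommaOn e G Q) : Type where
  left : x.left ⟶ y.left
  right : x.right ⟶ y.right
  w : e.map left ≫ y.hom = x.hom ≫ G.map right

instance : Category (CommaOn e G Q) where
  Hom := Hom
  id x := ⟨𝟙 _, 𝟙 _, by simp⟩
  comp f g := ⟨f.left ≫ g.left, f.right ≫ g.right, by
    rw [e.map_comp, Category.assoc, g.w, ← Category.assoc, f.w, G.map_comp, Category.assoc]⟩
  id_comp f := by apply Hom.ext <;> simp
  comp_id f := by apply Hom.ext <;> simp
  assoc f g h := by apply Hom.ext <;> simp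

@[ext]
theorem hom_ext {x y : CommaOn e G Q} {f g : x ⟶ y} (h : Hom.left f = Hom.left g)
    (h' : Hom.right f = Hom.right g) : f = g := Hom.ext h h'

variable (e G Q)

/-- The projection to the source of `e`. -/
def fst : CommaOn e G Q ⥤ C where
  obj x := x.left
  map f := Hom.left f

/-- The projection to the source of `G`. -/
def snd : CommaOn e G Q ⥤ A where
  obj x := x.right
  map f := Hom.right f

/-- The universal arrow between the two projections. -/
def square : fst e G Q ⋙ e ⟶ snd e G Q ⋙ G where
  app x := x.hom
  naturality _ _ f := Hom.w f

/-- The square of a comma category is exact: an arrow `f : e c ⟶ G a` is itself an object, and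
any factorization of `f` is connected to it by a span. -/
theorem isExactSquare_of_forall (hQ : ∀ c a v, Q c a v) :
    IsExactSquare (fst e G Q) (snd e G Q) e G (square e G Q) := by
  intro c a f
  refine ⟨⟨c, a, f, hQ _ _ _⟩, 𝟙 c, 𝟙 a, ?_, ?_⟩
  · change e.map (𝟙 c) ≫ f ≫ G.map (𝟙 a) = f
    simp
  rintro ⟨c', a', v, hv⟩ (k : c ⟶ c') (i : a' ⟶ a) (h : e.map k ≫ v ≫ G.map i = f)
  refine ⟨⟨c, a', e.map k ≫ v, hQ _ _ _⟩, 𝟙 c, ⟨k, 𝟙 a', ?_⟩, ⟨𝟙 c, i, ?_⟩,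
    Category.id_comp k, Category.comp_id (𝟙 c), ?_⟩
  · simp
  · simp [← h]
  · exact (Category.id_comp i).trans (Category.comp_id i).symm

/-- The class of identity arrows `e c = G a`: the comma category on it is the pullback. -/
def IsEqToHom (c : C) (a : A) (v : e.obj c ⟶ G.obj a) : Prop :=
  ∃ h : e.obj c = G.obj a, v = eqToHom h

/-- The pullback square of a discrete op-fibration is exact: an arrow `f : e c ⟶ G a` factors
through the end point of its lift. -/
theorem isExactSquare_of_isEqToHom (he : IsDiscreteOpfibration e) :
    IsExactSquare (fst e G (IsEqToHom e G)) (snd e G (IsEqToHom e G)) e G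
      (square e G (IsEqToHom e G)) := by
  intro c a f
  obtain ⟨⟨c₀, k₀⟩, ⟨h₀, e₀⟩, hu⟩ := he c f
  refine ⟨⟨c₀, a, eqToHom h₀, ⟨h₀, rfl⟩⟩, k₀, 𝟙 a, ?_, ?_⟩
  · change e.map k₀ ≫ eqToHom h₀ ≫ G.map (𝟙 a) = f
    simpa using e₀
  rintro ⟨c₁, a₁, v, hv⟩ (k : c ⟶ c₁) (i : a₁ ⟶ a) (hf : e.map k ≫ v ≫ G.map i = f)
  obtain ⟨⟨c₂, n⟩, ⟨h₂, e₂⟩, -⟩ := he c₁ (v ≫ G.map i)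
  have h3 := hu ⟨c₂, k ≫ n⟩ ⟨h₂, by
    dsimp only at e₂ ⊢
    rw [e.map_comp, Category.assoc, e₂, hf]⟩
  obtain rfl : c₂ = c₀ := congrArg Sigma.fst h3
  obtain rfl : k ≫ n = k₀ := eq_of_heq (Sigma.mk.inj h3).2
  exact ⟨⟨c₁, a₁, v, hv⟩, k, 𝟙 _, ⟨n, i, e₂⟩, Category.comp_id k, rfl, Category.id_comp i |>.trans
    (Category.comp_id i).symm⟩

/-- A pullback of a discrete op-fibration is a discrete op-fibration. -/
theorem isDiscreteOpfibration_snd (he : IsDiscreteOpfibration e) :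
    IsDiscreteOpfibration (snd e G (IsEqToHom e G)) := by
  rintro ⟨c, a, v, hv⟩ a' (g : a ⟶ a')
  obtain ⟨⟨c₂, n⟩, ⟨h₂, e₂⟩, hu⟩ := he c (v ≫ G.map g)
  refine ⟨⟨⟨c₂, a', eqToHom h₂, ⟨h₂, rfl⟩⟩, ⟨n, g, e₂⟩⟩, ⟨rfl, Category.comp_id g⟩, ?_⟩
  rintro ⟨⟨c₃, a₃, v₃, h₃, rfl⟩, ⟨n₃, g₃, e₃⟩⟩ ⟨h4, h5⟩
  replace h4 : a₃ = a' := h4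
  subst h4
  obtain rfl : g₃ = g := (Category.comp_id g₃).symm.trans h5
  have h6 := hu ⟨c₃, n₃⟩ ⟨h₃, e₃⟩
  obtain rfl : c₃ = c₂ := congrArg Sigma.fst h6
  obtain rfl : n₃ = n := eq_of_heq (Sigma.mk.inj h6).2
  rfl

end CommaOn

end Comma

/-! ### Distributivity of `Π` over `Σ` -/

section Distributivity

variable {C D : Type} [Category.{0} C] [Category.{0} D]

/-- The functor of compatible families, a concrete form of `Π_G I`. -/
def families (G : C ⥤ D) (I : C ⥤ Type w) : D ⥤ Type w where
  obj d := {s : ∀ c, (d ⟶ G.obj c) → I.obj c // CompatFamily G I d s}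
  map w := TypeCat.ofHom fun s => ⟨fun c u => s.1 c (w ≫ u), by
    intro c c' k u
    rw [s.2 k]
    simp⟩
  map_id d := by
    apply ConcreteCategory.hom_ext
    intro s
    apply Subtype.ext
    funext c u
    simp
  map_comp f g := by
    apply ConcreteCategory.hom_ext
    intro s
    apply Subtype.ext
    funext c u
    simp

variable {A₂ B₂ B₁ X : Type} [Category.{0} A₂] [Category.{0} B₂] [Category.{0} B₁]
  [Category.{0} X] (F₂ : A₂ ⥤ X) (G₂ : A₂ ⥤ B₂) {H₁ : B₁ ⥤ X} (hH : IsDiscreteOpfibration H₁)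

/-- The sections over an object `b`: families that choose an object of `B₁` over `F₂ a` for
each arrow `b ⟶ G₂ a`. -/
noncomputable abbrev sections : B₂ ⥤ Type := families G₂ (F₂ ⋙ hH.fibre)

/-- Evaluation of sections at identity arrows. -/
noncomputable def evalSection : El (G₂ ⋙ sections F₂ G₂ hH) ⥤ El hH.fibre where
  obj z := ⟨F₂.obj z.base, z.elt.1 z.base (𝟙 _)⟩
  map {z z'} k := ⟨F₂.map k.hom, by
    have h1 := z.elt.2 k.hom (𝟙 _)
    have h2 := congrArg (fun s => s.1 z'.base (𝟙 _)) k.map_elt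
    have h3 : 𝟙 _ ≫ G₂.map k.hom = G₂.map k.hom ≫ 𝟙 _ := by simp
    exact h1.trans ((congrArg (z.elt.1 z'.base) h3).trans h2)⟩
  map_id _ := El.hom_ext (F₂.map_id _)
  map_comp _ _ := El.hom_ext (F₂.map_comp _ _)

/-- The evaluation functor of the distributivity square. -/
noncomputable def evalFunctor : El (G₂ ⋙ sections F₂ G₂ hH) ⥤ B₁ :=
  evalSection F₂ G₂ hH ⋙ hH.total

/-- The base change of `G₂` to the category of elements of the sections. -/
noncomputable def elBaseChange :
    El (G₂ ⋙ sections F₂ G₂ hH) ⥤ El (sections F₂ G₂ hH) where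
  obj z := ⟨G₂.obj z.base, z.elt⟩
  map k := ⟨G₂.map k.hom, k.map_elt⟩
  map_id _ := El.hom_ext (G₂.map_id _)
  map_comp _ _ := El.hom_ext (G₂.map_comp _ _)

variable {F₂ G₂} {P : El (sections F₂ G₂ hH) ⥤ Type w} {J : B₁ ⥤ Type w}
  (ε : elBaseChange F₂ G₂ hH ⋙ P ⟶ evalFunctor F₂ G₂ hH ⋙ J)

/-- The value at `u` of the element of `Π_{G₂} Δ_{F₂} Σ_{H₁} J` that corresponds to `x : P m`: the
value of the section `m` at `u`, and the element of `J` over it that `ε` determines. -/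
noncomputable def distribVal (m : El (sections F₂ G₂ hH)) (x : P.obj m) (a : A₂)
    (u : m.base ⟶ G₂.obj a) : (hH.sigma.obj J).obj (F₂.obj a) :=
  ⟨((sections F₂ G₂ hH).map u m.elt).1 a (𝟙 _),
    ε.app ⟨a, (sections F₂ G₂ hH).map u m.elt⟩ (P.map ⟨u, rfl⟩ x)⟩

/-- The value at `u` computed at any object of the category of elements that is equal to the
restriction of the section along `u`. -/
theorem distribVal_eq (m : El (sections F₂ G₂ hH)) (x : P.obj m)
    (c : El (G₂ ⋙ sections F₂ G₂ hH)) (φ : m ⟶ (elBaseChange F₂ G₂ hH).obj c) :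
    distribVal hH ε m x c.base φ.hom = ⟨c.elt.1 c.base (𝟙 _), ε.app c (P.map φ x)⟩ := by
  obtain ⟨a, t⟩ := c
  obtain ⟨u, hu⟩ := φ
  change m.base ⟶ G₂.obj a at u
  change (sections F₂ G₂ hH).map u m.elt = t at hu
  subst hu
  rfl

theorem sigma_map_distribVal (m : El (sections F₂ G₂ hH)) (x : P.obj m) {a a' : A₂}
    (k : a ⟶ a') (u : m.base ⟶ G₂.obj a) :
    (hH.sigma.obj J).map (F₂.map k) (distribVal hH ε m x a u) =
      distribVal hH ε m x a' (u ≫ G₂.map k) := by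
  let c : El (G₂ ⋙ sections F₂ G₂ hH) := ⟨a, (sections F₂ G₂ hH).map u m.elt⟩
  let c' : El (G₂ ⋙ sections F₂ G₂ hH) :=
    ⟨a', (sections F₂ G₂ hH).map (G₂.map k) ((sections F₂ G₂ hH).map u m.elt)⟩
  let κ : c ⟶ c' := ⟨k, rfl⟩
  let φ : m ⟶ (elBaseChange F₂ G₂ hH).obj c := ⟨u, rfl⟩
  have h1 := distribVal_eq hH ε m x c' (φ ≫ (elBaseChange F₂ G₂ hH).map κ)
  refine Eq.trans ?_ h1.symm
  have h2 := hH.sigmaMap_eq J (F₂.map k) (c.elt.1 a (𝟙 _)) (ε.app c (P.map φ x))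
    (c'.elt.1 a' (𝟙 _)) ((evalFunctor F₂ G₂ hH).map κ)
    (hH.over_total ((evalSection F₂ G₂ hH).map κ))
  refine h2.trans ?_
  have h3 := NatTrans.naturality_apply ε κ (P.map φ x)
  have h4 := h3.symm.trans (congrArg (ε.app c') (P.map_comp_apply _ _ _).symm)
  exact congrArg (Sigma.mk (β := fun y : {y // H₁.obj y = F₂.obj a'} => J.obj y.1)
    (c'.elt.1 a' (𝟙 _))) h4

theorem distribVal_map {m m' : El (sections F₂ G₂ hH)} (f : m ⟶ m') (x : P.obj m) (a : A₂)
    (u : m'.base ⟶ G₂.obj a) :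
    distribVal hH ε m' (P.map f x) a u = distribVal hH ε m x a (f.hom ≫ u) := by
  let c : El (G₂ ⋙ sections F₂ G₂ hH) := ⟨a, (sections F₂ G₂ hH).map u m'.elt⟩
  let φ : m' ⟶ (elBaseChange F₂ G₂ hH).obj c := ⟨u, rfl⟩
  refine Eq.trans ?_ (distribVal_eq hH ε m x c (f ≫ φ)).symm
  exact (distribVal_eq hH ε m' (P.map f x) c φ).trans
    (by rw [P.map_comp_apply])

/-- The value at `u` of the element of `Π_{G₂} Δ_{F₂} Σ_{H₁} J` that corresponds to an element of
`Σ P`. -/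
noncomputable def sigmaDistribVal {b : B₂} (a : A₂) (u : b ⟶ G₂.obj a)
    (z : ((El.isDiscreteOpfibration_proj (sections F₂ G₂ hH)).sigma.obj P).obj b) :
    (hH.sigma.obj J).obj (F₂.obj a) :=
  distribVal hH ε z.1.1 z.2 a (eqToHom z.1.2 ≫ u)

theorem sigmaDistribVal_mk (m : El (sections F₂ G₂ hH)) (x : P.obj m) (a : A₂)
    (u : m.base ⟶ G₂.obj a) :
    sigmaDistribVal hH ε a u ⟨⟨m, rfl⟩, x⟩ = distribVal hH ε m x a u :=
  congrArg (distribVal hH ε m x a) (Category.id_comp u)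

theorem sigmaDistribVal_map {b b' : B₂} (g : b ⟶ b') (a : A₂) (u : b' ⟶ G₂.obj a)
    (z : ((El.isDiscreteOpfibration_proj (sections F₂ G₂ hH)).sigma.obj P).obj b) :
    sigmaDistribVal hH ε a u
      (((El.isDiscreteOpfibration_proj (sections F₂ G₂ hH)).sigma.obj P).map g z) =
      sigmaDistribVal hH ε a (g ≫ u) z := by
  obtain ⟨⟨m, hm⟩, x⟩ := z
  change m.base = b at hm
  subst hm
  have h := (El.isDiscreteOpfibration_proj (sections F₂ G₂ hH)).sigmaMap_eq P g ⟨m, rfl⟩ x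
    ⟨⟨b', (sections F₂ G₂ hH).map g m.elt⟩, rfl⟩ ⟨g, rfl⟩
    ((Category.comp_id g).trans (Category.id_comp g).symm)
  refine (congrArg (sigmaDistribVal hH ε a u) h).trans ?_
  refine (sigmaDistribVal_mk hH ε ⟨b', (sections F₂ G₂ hH).map g m.elt⟩ _ a u).trans ?_
  refine Eq.trans ?_ (sigmaDistribVal_mk hH ε m x a (g ≫ u)).symm
  exact distribVal_map hH ε
    (show m ⟶ ⟨b', (sections F₂ G₂ hH).map g m.elt⟩ from ⟨g, rfl⟩) x a u

theorem sigma_map_sigmaDistribVal {b : B₂} {a a' : A₂} (k : a ⟶ a') (u : b ⟶ G₂.obj a)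
    (z : ((El.isDiscreteOpfibration_proj (sections F₂ G₂ hH)).sigma.obj P).obj b) :
    (hH.sigma.obj J).map (F₂.map k) (sigmaDistribVal hH ε a u z) =
      sigmaDistribVal hH ε a' (u ≫ G₂.map k) z :=
  (sigma_map_distribVal hH ε _ _ k _).trans (by rw [Category.assoc]; rfl)

/-- The counit of the distributivity square. -/
noncomputable def distribCounit :
    G₂ ⋙ (El.isDiscreteOpfibration_proj (sections F₂ G₂ hH)).sigma.obj P ⟶
      F₂ ⋙ hH.sigma.obj J where
  app a := TypeCat.ofHom fun z => sigmaDistribVal hH ε a (𝟙 _) z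
  naturality a a' k := by
    apply ConcreteCategory.hom_ext
    intro z
    have h1 := sigmaDistribVal_map hH ε (G₂.map k) a' (𝟙 _) z
    have h2 := sigma_map_sigmaDistribVal hH ε k (𝟙 _) z
    rw [Category.comp_id] at h1
    rw [Category.id_comp] at h2
    exact h1.trans h2.symm

theorem distribCounit_map {b : B₂} (a : A₂) (u : b ⟶ G₂.obj a)
    (z : ((El.isDiscreteOpfibration_proj (sections F₂ G₂ hH)).sigma.obj P).obj b) :
    (distribCounit hH ε).app a
      (((El.isDiscreteOpfibration_proj (sections F₂ G₂ hH)).sigma.obj P).map u z) =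
      sigmaDistribVal hH ε a u z := by
  have h1 := sigmaDistribVal_map hH ε u a (𝟙 _) z
  rw [Category.comp_id] at h1
  exact h1

theorem distribCounit_naturality {P' : El (sections F₂ G₂ hH) ⥤ Type w} {J' : B₁ ⥤ Type w}
    (ε' : elBaseChange F₂ G₂ hH ⋙ P' ⟶ evalFunctor F₂ G₂ hH ⋙ J') (π : P ⟶ P') (j : J ⟶ J')
    (h : ∀ c x, ε'.app c (π.app _ x) = j.app _ (ε.app c x)) (a : A₂)
    (z : ((El.isDiscreteOpfibration_proj (sections F₂ G₂ hH)).sigma.obj P).obj (G₂.obj a)) :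
    (distribCounit hH ε').app a
      (((El.isDiscreteOpfibration_proj (sections F₂ G₂ hH)).sigma.map π).app _ z) =
      (hH.sigma.map j).app _ ((distribCounit hH ε).app a z) := by
  have key : ∀ (m : El (sections F₂ G₂ hH)) (x : P.obj m) (a : A₂) (u : m.base ⟶ G₂.obj a),
      distribVal hH ε' m (π.app m x) a u =
        (hH.sigma.map j).app _ (distribVal hH ε m x a u) := by
    intro m x a u
    let c : El (G₂ ⋙ sections F₂ G₂ hH) := ⟨a, (sections F₂ G₂ hH).map u m.elt⟩
    let φ : m ⟶ (elBaseChange F₂ G₂ hH).obj c := ⟨u, rfl⟩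
    refine congrArg (Sigma.mk (β := fun y : {y // H₁.obj y = F₂.obj a} => J'.obj y.1)
      (((sections F₂ G₂ hH).map u m.elt).1 a (𝟙 _))) ?_
    refine Eq.trans ?_ (h c (P.map φ x))
    exact congrArg (ε'.app c) (NatTrans.naturality_apply π φ x).symm
  exact key z.1.1 z.2 a (eqToHom z.1.2 ≫ 𝟙 _)

/-- Distributivity: if `P` is `Π` of `Δ J` along `elBaseChange` and `evalFunctor`, then `Σ P` is
`Π_{G₂} Δ_{F₂} Σ_{H₁} J`. -/
theorem IsPi.distribCounit (hε : IsPi (elBaseChange F₂ G₂ hH) ε) :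
    IsPi G₂ (distribCounit hH ε) := by
  intro b σ hσ
  apply existsUnique_of_exists_of_unique
  -- The objects that occur in the family `σ` form a section; its elements form a family for `J`.
  · let s : (sections F₂ G₂ hH).obj b := ⟨fun a u => (σ a u).1, by
      intro a a' k u
      exact congrArg Sigma.fst (hσ k u)⟩
    let m : El (sections F₂ G₂ hH) := ⟨b, s⟩
    have hex : ∀ (c : El (G₂ ⋙ sections F₂ G₂ hH))
        (φ : m ⟶ (elBaseChange F₂ G₂ hH).obj c),
        ∃ j : J.obj ((evalFunctor F₂ G₂ hH).obj c),
          (⟨c.elt.1 c.base (𝟙 _), j⟩ : (hH.sigma.obj J).obj (F₂.obj c.base)) =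
            σ c.base φ.hom := by
      intro c φ
      have h1 : c.elt.1 c.base (𝟙 _) = (σ c.base φ.hom).1 := by
        have h2 := congrArg (fun t => t.1 c.base (𝟙 _)) φ.map_elt
        refine h2.symm.trans ?_
        exact congrArg (fun v => (σ c.base v).1) (Category.comp_id φ.hom)
      have key : ∀ (z : (hH.sigma.obj J).obj (F₂.obj c.base))
          (y : {y // H₁.obj y = F₂.obj c.base}) (_ : y = z.1),
          ∃ j : J.obj y.1, (⟨y, j⟩ : (hH.sigma.obj J).obj (F₂.obj c.base)) = z := by
        rintro z _ rfl
        exact ⟨z.2, rfl⟩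
      exact key _ _ h1
    choose ρ hρ using hex
    obtain ⟨x, hx, -⟩ := hε m ρ (by
      intro c c' κ φ
      have h1 := hσ κ.hom φ.hom
      rw [← hρ c φ] at h1
      have h2 := hH.sigmaMap_eq J (F₂.map κ.hom) (c.elt.1 c.base (𝟙 _)) (ρ c φ)
        (c'.elt.1 c'.base (𝟙 _)) ((evalFunctor F₂ G₂ hH).map κ)
        (hH.over_total ((evalSection F₂ G₂ hH).map κ))
      have h3 := h2.symm.trans (h1.trans
        (hρ c' (φ ≫ (elBaseChange F₂ G₂ hH).map κ)).symm)
      exact eq_of_heq (Sigma.mk.inj h3).2)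
    refine ⟨⟨⟨m, rfl⟩, x⟩, fun a u => ?_⟩
    refine (distribCounit_map hH ε a u _).trans ((sigmaDistribVal_mk hH ε m x a u).trans ?_)
    let c : El (G₂ ⋙ sections F₂ G₂ hH) := ⟨a, (sections F₂ G₂ hH).map u m.elt⟩
    let φ : m ⟶ (elBaseChange F₂ G₂ hH).obj c := ⟨u, rfl⟩
    refine (distribVal_eq hH ε m x c φ).trans ?_
    rw [hx c φ]
    exact hρ c φ
  · intro z z' h h'
    have hv : ∀ a (u : b ⟶ G₂.obj a), sigmaDistribVal hH ε a u z = sigmaDistribVal hH ε a u z' :=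
      fun a u => (distribCounit_map hH ε a u z).symm.trans
        ((h a u).trans ((h' a u).symm.trans (distribCounit_map hH ε a u z')))
    clear h h' hσ σ
    -- The values determine the section, and then, by `hε`, the element over it.
    obtain ⟨⟨⟨b', s⟩, hm⟩, x⟩ := z
    obtain ⟨⟨⟨b'', s'⟩, hm'⟩, x'⟩ := z'
    replace hm : b' = b := hm
    replace hm' : b'' = b := hm'
    subst hm
    subst hm'
    have hv' : ∀ a (u : b'' ⟶ G₂.obj a),
        distribVal hH ε ⟨b'', s⟩ x a u = distribVal hH ε ⟨b'', s'⟩ x' a u := fun a u =>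
      (sigmaDistribVal_mk hH ε ⟨b'', s⟩ x a u).symm.trans
        ((hv a u).trans (sigmaDistribVal_mk hH ε ⟨b'', s'⟩ x' a u))
    obtain rfl : s = s' := by
      apply Subtype.ext
      funext a u
      have h1 : s.1 a (u ≫ 𝟙 _) = s'.1 a (u ≫ 𝟙 _) := congrArg Sigma.fst (hv' a u)
      rwa [Category.comp_id] at h1
    obtain rfl : x = x' := by
      apply hε.ext
      intro c φ
      have h1 := (distribVal_eq hH ε _ x c φ).symm.trans
        ((hv' c.base φ.hom).trans (distribVal_eq hH ε _ x' c φ))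
      exact eq_of_heq (Sigma.mk.inj h1).2
    rfl

end Distributivity

/-! ### The evaluation functor is a discrete op-fibration -/

namespace IsDiscreteOpfibration

variable {C D E : Type} [Category.{0} C] [Category.{0} D] [Category.{0} E]

/-- Cancellation: if `G` and `F ⋙ G` are discrete op-fibrations, then so is `F`. -/
theorem of_comp {F : C ⥤ D} {G : D ⥤ E} (hG : IsDiscreteOpfibration G)
    (h : IsDiscreteOpfibration (F ⋙ G)) : IsDiscreteOpfibration F := by
  intro c d n
  obtain ⟨⟨c', k⟩, ⟨h₁, e₁⟩, hu⟩ := h c (G.map n)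
  obtain ⟨l, -, hl⟩ := hG (F.obj c) (G.map n)
  have e := (hl ⟨F.obj c', F.map k⟩ ⟨h₁, e₁⟩).trans (hl ⟨d, n⟩ ⟨rfl, by simp⟩).symm
  obtain rfl : F.obj c' = d := congrArg Sigma.fst e
  obtain rfl : F.map k = n := eq_of_heq (Sigma.mk.inj e).2
  refine ⟨⟨c', k⟩, ⟨rfl, by simp⟩, ?_⟩
  rintro ⟨c₂, k₂⟩ ⟨h₂, e₂⟩
  refine hu ⟨c₂, k₂⟩ ⟨congrArg G.obj h₂, ?_⟩
  dsimp only at h₂ e₂ ⊢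
  rw [← e₂, G.map_comp, eqToHom_map]
  rfl

/-- A fully faithful functor that is bijective on objects is a discrete op-fibration. -/
theorem of_fullyFaithful {F : C ⥤ D} [F.Full] [F.Faithful] (hF : Function.Bijective F.obj) :
    IsDiscreteOpfibration F := by
  intro c d g
  obtain ⟨c', rfl⟩ := hF.2 d
  refine ⟨⟨c', F.preimage g⟩, ⟨rfl, by simp⟩, ?_⟩
  rintro ⟨c₂, k₂⟩ ⟨h₂, e₂⟩
  obtain rfl : c₂ = c' := hF.1 h₂
  have : k₂ = F.preimage g := F.map_injective (by simpa using e₂)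
  rw [this]

end IsDiscreteOpfibration

section

variable {A₂ B₂ B₁ X : Type} [Category.{0} A₂] [Category.{0} B₂] [Category.{0} B₁]
  [Category.{0} X] (F₂ : A₂ ⥤ X) (G₂ : A₂ ⥤ B₂) {H₁ : B₁ ⥤ X} (hH : IsDiscreteOpfibration H₁)

/-- The evaluation functor lifts `F₂` along `H₁`. -/
theorem evalFunctor_comp :
    evalFunctor F₂ G₂ hH ⋙ H₁ = El.proj (G₂ ⋙ sections F₂ G₂ hH) ⋙ F₂ := by
  refine CategoryTheory.Functor.ext (fun z => (z.elt.1 z.base (𝟙 _)).2) fun z z' k => ?_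
  have h := hH.over_total ((evalSection F₂ G₂ hH).map k)
  unfold IsDiscreteOpfibration.Over at h
  rw [← Category.assoc]
  exact (comp_eqToHom_iff _ _ _).1 h

/-- The evaluation functor is a discrete op-fibration if `F₂` is: by cancellation, as its
composite with `H₁` is one. -/
theorem isDiscreteOpfibration_evalFunctor (hF : IsDiscreteOpfibration F₂) :
    IsDiscreteOpfibration (evalFunctor F₂ G₂ hH) := by
  apply hH.of_comp
  rw [evalFunctor_comp]
  exact (El.isDiscreteOpfibration_proj _).comp hF

end

/-! ### The counit of the composite -/

section Core

/-- Being `Π_G I` does not change when `I` is replaced by an isomorphic functor. -/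
theorem IsPi.of_iso_right {C D : Type} [Category.{0} C] [Category.{0} D] {G : C ⥤ D}
    {I I' : C ⥤ Type w} {R : D ⥤ Type w} {ε : G ⋙ R ⟶ I} (h : IsPi G ε) (α : I ≅ I') :
    IsPi G (ε ≫ α.hom) := by
  intro d s hs
  obtain ⟨x, hx, hu⟩ := h d (fun c u => α.inv.app c (s c u)) (by
    intro c c' k u
    exact (NatTrans.naturality_apply α.inv k (s c u)).symm.trans
      (congrArg (α.inv.app c') (hs k u)))
  refine ⟨x, fun c u => ?_, fun y hy => hu y fun c u => ?_⟩
  · have := congrArg (α.hom.app c) (hx c u)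
    simp only [Iso.inv_hom_id_app_apply] at this
    exact this
  · rw [← hy c u]
    simp

variable {M₁ M₂ A₁ B₁ X A₂ B₂ : Type} [Category.{0} M₁] [Category.{0} M₂] [Category.{0} A₁]
  [Category.{0} B₁] [Category.{0} X] [Category.{0} A₂] [Category.{0} B₂]

/-- The data that exhibit `K`, `G` as the composite of two polynomial functors: `M₁` and `M₂` are
equivalent to a comma category, with an exact square, and to the category of elements of the
sections, and the functors correspond. As `Σ_K` refers to equality of objects, `E₂` is bijective
on objects and the functors are equal, not just isomorphic. -/
structure CompositionData (F₂ : A₂ ⥤ X) (G₂ : A₂ ⥤ B₂) {H₁ : B₁ ⥤ X}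
    (hH : IsDiscreteOpfibration H₁) (G₁ : A₁ ⥤ B₁) (G : M₁ ⥤ M₂) (K : M₂ ⥤ B₂) where
  Q : ∀ c a, ((evalFunctor F₂ G₂ hH).obj c ⟶ G₁.obj a) → Prop
  exact : IsExactSquare (CommaOn.fst _ G₁ Q) (CommaOn.snd _ G₁ Q) (evalFunctor F₂ G₂ hH) G₁
    (CommaOn.square _ G₁ Q)
  E₁ : M₁ ⥤ CommaOn (evalFunctor F₂ G₂ hH) G₁ Q
  E₂ : M₂ ⥤ El (sections F₂ G₂ hH)
  equiv₁ : E₁.IsEquivalence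
  equiv₂ : E₂.IsEquivalence
  bijective₂ : Function.Bijective E₂.obj
  comm : G ⋙ E₂ = E₁ ⋙ CommaOn.fst _ G₁ Q ⋙ elBaseChange F₂ G₂ hH
  proj_comm : K = E₂ ⋙ El.proj _

namespace CompositionData

variable {F₂ : A₂ ⥤ X} {G₂ : A₂ ⥤ B₂} {H₁ : B₁ ⥤ X} {hH : IsDiscreteOpfibration H₁}
  {G₁ : A₁ ⥤ B₁} {G : M₁ ⥤ M₂} {K : M₂ ⥤ B₂} (c : CompositionData F₂ G₂ hH G₁ G K)

/-- The projection to `A₁`. -/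
noncomputable def toLeft : M₁ ⥤ A₁ := c.E₁ ⋙ CommaOn.snd _ G₁ c.Q

/-- A quasi-inverse of the equivalence of `M₂` with the category of sections. -/
noncomputable def inv₂ : El (sections F₂ G₂ hH) ⥤ M₂ :=
  haveI := c.equiv₂
  c.E₂.inv

instance : c.inv₂.IsEquivalence := by
  have := c.equiv₂
  unfold inv₂
  infer_instance

/-- The unit of the equivalence of `M₂` with the category of sections. -/
noncomputable def unit₂ : 𝟭 M₂ ≅ c.E₂ ⋙ c.inv₂ :=
  haveI := c.equiv₂
  c.E₂.asEquivalence.unitIso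

/-- `G` corresponds to the functor from the comma category to the category of sections. -/
noncomputable def isoG :
    c.E₁ ⋙ (CommaOn.fst _ G₁ c.Q ⋙ elBaseChange F₂ G₂ hH) ⋙ c.inv₂ ≅ G :=
  Functor.isoWhiskerRight (eqToIso c.comm.symm) c.inv₂ ≪≫
    Functor.isoWhiskerLeft G c.unit₂.symm

section Steps

variable {P : M₂ ⥤ Type w} {L : A₁ ⥤ Type w} {J : B₁ ⥤ Type w}

/-- The counit `ε`, transported along the equivalences to the comma category. -/
noncomputable def stepComma (ε : G ⋙ P ⟶ c.toLeft ⋙ L) :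
    (CommaOn.fst _ G₁ c.Q ⋙ elBaseChange F₂ G₂ hH) ⋙ c.inv₂ ⋙ P ⟶
      CommaOn.snd _ G₁ c.Q ⋙ L :=
  haveI := c.equiv₁
  (isPi_of_equivalence c.E₁ (CommaOn.snd _ G₁ c.Q ⋙ L)).lift
    (Z := (CommaOn.fst _ G₁ c.Q ⋙ elBaseChange F₂ G₂ hH) ⋙ c.inv₂ ⋙ P)
    (Functor.whiskerRight c.isoG.hom P ≫ ε)

theorem stepComma_app (ε : G ⋙ P ⟶ c.toLeft ⋙ L) (m : M₁)
    (x : P.obj (c.inv₂.obj ((elBaseChange F₂ G₂ hH).obj (c.E₁.obj m).left))) :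
    (c.stepComma ε).app (c.E₁.obj m) x = ε.app m (P.map (c.isoG.hom.app m) x) :=
  haveI := c.equiv₁
  (isPi_of_equivalence c.E₁ (CommaOn.snd _ G₁ c.Q ⋙ L)).lift_fac
    (Z := (CommaOn.fst _ G₁ c.Q ⋙ elBaseChange F₂ G₂ hH) ⋙ c.inv₂ ⋙ P)
    (Functor.whiskerRight c.isoG.hom P ≫ ε) m x

theorem isPi_stepComma {ε : G ⋙ P ⟶ c.toLeft ⋙ L} (hε : IsPi G ε) :
    IsPi (CommaOn.fst _ G₁ c.Q ⋙ elBaseChange F₂ G₂ hH) (c.stepComma ε) := by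
  have := c.equiv₁
  exact IsPi.of_fullyFaithful c.inv₂
    ((isPi_of_equivalence c.E₁ (CommaOn.snd _ G₁ c.Q ⋙ L)).of_comp (hε.of_iso c.isoG))

/-- The counit over the base change of `G₂`: `stepComma` lifted along the `Π` of base change. -/
noncomputable def stepEval {ε₁ : G₁ ⋙ J ⟶ L} (h₁ : IsPi G₁ ε₁) (ε : G ⋙ P ⟶ c.toLeft ⋙ L) :
    elBaseChange F₂ G₂ hH ⋙ c.inv₂ ⋙ P ⟶ evalFunctor F₂ G₂ hH ⋙ J :=
  (h₁.exactCounit c.exact).lift (Z := elBaseChange F₂ G₂ hH ⋙ c.inv₂ ⋙ P) (c.stepComma ε)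

theorem stepEval_fac {ε₁ : G₁ ⋙ J ⟶ L} (h₁ : IsPi G₁ ε₁) (ε : G ⋙ P ⟶ c.toLeft ⋙ L)
    (m : CommaOn (evalFunctor F₂ G₂ hH) G₁ c.Q)
    (x : P.obj (c.inv₂.obj ((elBaseChange F₂ G₂ hH).obj m.left))) :
    ε₁.app m.right (J.map m.hom ((c.stepEval h₁ ε).app m.left x)) =
      (c.stepComma ε).app m x :=
  (h₁.exactCounit c.exact).lift_fac (Z := elBaseChange F₂ G₂ hH ⋙ c.inv₂ ⋙ P)
    (c.stepComma ε) m x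

theorem isPi_stepEval {ε₁ : G₁ ⋙ J ⟶ L} (h₁ : IsPi G₁ ε₁) {ε : G ⋙ P ⟶ c.toLeft ⋙ L}
    (hε : IsPi G ε) : IsPi (elBaseChange F₂ G₂ hH) (c.stepEval h₁ ε) :=
  (h₁.exactCounit c.exact).of_comp (c.isPi_stepComma hε)

/-- The comparison of `Σ` along `K` with `Σ` along the projection of the category of elements of
the sections. -/
noncomputable def sigmaHom (hK : IsDiscreteOpfibration K) (P : M₂ ⥤ Type w) :
    hK.sigma.obj P ⟶
      (El.isDiscreteOpfibration_proj (sections F₂ G₂ hH)).sigma.obj (c.inv₂ ⋙ P) where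
  app b := TypeCat.ofHom fun z =>
    ⟨⟨c.E₂.obj z.1.1, (congrArg (fun t => t.obj z.1.1) c.proj_comm).symm.trans z.1.2⟩,
      P.map (c.unit₂.hom.app z.1.1) z.2⟩
  naturality b b' g := by
    apply ConcreteCategory.hom_ext
    rintro ⟨m, x⟩
    have h1 := (El.isDiscreteOpfibration_proj (sections F₂ G₂ hH)).sigmaMap_eq (c.inv₂ ⋙ P) g
      ⟨c.E₂.obj m.1, (congrArg (fun t => t.obj m.1) c.proj_comm).symm.trans m.2⟩
      (P.map (c.unit₂.hom.app m.1) x)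
      ⟨c.E₂.obj (hK.lift m g).1, (congrArg (fun t => t.obj (hK.lift m g).1)
        c.proj_comm).symm.trans (hK.obj_lift m g)⟩ (c.E₂.map (hK.lift m g).2) (by
        have h2 := hK.map_lift m g
        rw [Functor.congr_hom c.proj_comm] at h2
        simp only [Category.assoc, eqToHom_trans] at h2
        rw [eqToHom_comp_iff] at h2
        rw [← Functor.comp_map]
        dsimp only
        rw [h2, ← Category.assoc, eqToHom_trans])
    refine Eq.trans ?_ h1.symm
    refine congrArg (Sigma.mk (β := fun y : {y // (El.proj (sections F₂ G₂ hH)).obj y = b'} =>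
      (c.inv₂ ⋙ P).obj y.1) _) ?_
    refine (P.map_comp_apply _ _ _).symm.trans (Eq.trans ?_ (P.map_comp_apply _ _ _))
    exact congrArg (fun t => P.map t x) (c.unit₂.hom.naturality (hK.lift m g).2)

instance (hK : IsDiscreteOpfibration K) (P : M₂ ⥤ Type w) : IsIso (c.sigmaHom hK P) := by
  rw [NatTrans.isIso_iff_isIso_app]
  intro b
  rw [isIso_iff_bijective]
  constructor
  · rintro ⟨⟨m, hm⟩, x⟩ ⟨⟨m', hm'⟩, x'⟩ h
    have h1 : (⟨⟨c.E₂.obj m, _⟩, P.map (c.unit₂.hom.app m) x⟩ :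
        ((El.isDiscreteOpfibration_proj (sections F₂ G₂ hH)).sigma.obj (c.inv₂ ⋙ P)).obj b) =
        ⟨⟨c.E₂.obj m', _⟩, P.map (c.unit₂.hom.app m') x'⟩ := h
    obtain rfl : m = m' := c.bijective₂.1 (congrArg (fun z => z.1.1) h1)
    have h2 := eq_of_heq (Sigma.mk.inj h1).2
    have h3 : x = x' := ((isIso_iff_bijective (P.map (c.unit₂.hom.app m))).1 inferInstance).1 h2
    rw [h3]
  · rintro ⟨⟨e, he⟩, y⟩
    obtain ⟨m, rfl⟩ := c.bijective₂.2 e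
    obtain ⟨x, hx⟩ := ((isIso_iff_bijective (P.map (c.unit₂.hom.app m))).1 inferInstance).2 y
    subst hx
    exact ⟨⟨⟨m, (congrArg (fun t => t.obj m) c.proj_comm).trans he⟩, x⟩, rfl⟩

/-- The counit that exhibits `Σ_K P` as `Π_{G₂} Δ_{F₂} Σ_{H₁} J`. -/
noncomputable def counit (hK : IsDiscreteOpfibration K) {ε₁ : G₁ ⋙ J ⟶ L} (h₁ : IsPi G₁ ε₁)
    (ε : G ⋙ P ⟶ c.toLeft ⋙ L) : G₂ ⋙ hK.sigma.obj P ⟶ F₂ ⋙ hH.sigma.obj J :=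
  Functor.whiskerLeft G₂ (c.sigmaHom hK P) ≫ distribCounit hH (c.stepEval h₁ ε)

theorem isPi_counit (hK : IsDiscreteOpfibration K) {ε₁ : G₁ ⋙ J ⟶ L} (h₁ : IsPi G₁ ε₁)
    {ε : G ⋙ P ⟶ c.toLeft ⋙ L} (hε : IsPi G ε) : IsPi G₂ (c.counit hK h₁ ε) :=
  (IsPi.distribCounit hH _ (c.isPi_stepEval h₁ hε)).of_iso_left (asIso (c.sigmaHom hK P))

/-- The counit at an element `x` over an object `G m`, in terms of the given counits: it is an
element of `J` over the value of the section of `m`, and the value of `ε₁` at its image under the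
arrow of `m` is the value of `ε` at `x`. This determines the attribute data of the composite. -/
theorem counit_spec (hK : IsDiscreteOpfibration K) {ε₁ : G₁ ⋙ J ⟶ L} (h₁ : IsPi G₁ ε₁)
    (ε : G ⋙ P ⟶ c.toLeft ⋙ L) (m : M₁) (x : P.obj (G.obj m)) {a : A₂}
    (ha : (c.E₁.obj m).left.base = a) (hz : K.obj (G.obj m) = G₂.obj a) :
    ∃ hb : ((c.counit hK h₁ ε).app a ⟨⟨G.obj m, hz⟩, x⟩).1.1 =
        (evalFunctor F₂ G₂ hH).obj (c.E₁.obj m).left,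
      ε₁.app _ (J.map (eqToHom hb ≫ (c.E₁.obj m).hom)
        ((c.counit hK h₁ ε).app a ⟨⟨G.obj m, hz⟩, x⟩).2) = ε.app m x := by
  subst ha
  let φ : c.E₂.obj (G.obj m) ⟶ (elBaseChange F₂ G₂ hH).obj (c.E₁.obj m).left :=
    eqToHom (congrArg (fun t => t.obj m) c.comm)
  have h2 : (c.counit hK h₁ ε).app (c.E₁.obj m).left.base ⟨⟨G.obj m, hz⟩, x⟩ =
      ⟨(c.E₁.obj m).left.elt.1 (c.E₁.obj m).left.base (𝟙 _),
        (c.stepEval h₁ ε).app (c.E₁.obj m).left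
          ((c.inv₂ ⋙ P).map φ (P.map (c.unit₂.hom.app (G.obj m)) x))⟩ := by
    refine Eq.trans ?_ (distribVal_eq hH (c.stepEval h₁ ε) (c.E₂.obj (G.obj m))
      (P.map (c.unit₂.hom.app (G.obj m)) x) (c.E₁.obj m).left φ)
    refine congrArg (distribVal hH (c.stepEval h₁ ε) (c.E₂.obj (G.obj m))
      (P.map (c.unit₂.hom.app (G.obj m)) x) (c.E₁.obj m).left.base) ?_
    refine (Category.comp_id _).trans ?_
    exact (El.eqToHom_hom (congrArg (fun t => t.obj m) c.comm)).symm
  rw [h2]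
  refine ⟨rfl, ?_⟩
  refine Eq.trans (congrArg (fun t => ε₁.app (c.E₁.obj m).right (J.map t _))
    (Category.id_comp (c.E₁.obj m).hom)) ?_
  refine (c.stepEval_fac h₁ ε _ _).trans ((c.stepComma_app ε m _).trans ?_)
  apply congrArg (ε.app m)
  have h4 : (eqToIso c.comm.symm).hom.app m =
      eqToHom (congrArg (fun t => t.obj m) c.comm).symm := by simp
  have h5 : c.isoG.hom.app m =
      c.inv₂.map (eqToHom (congrArg (fun t => t.obj m) c.comm).symm) ≫
        c.unit₂.inv.app (G.obj m) :=
    congrArg (fun t => c.inv₂.map t ≫ c.unit₂.inv.app (G.obj m)) h4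
  have key : ∀ (e e' : El (sections F₂ G₂ hH)) (h : e = e') (y : (c.inv₂ ⋙ P).obj e),
      (c.inv₂ ⋙ P).map (eqToHom h.symm) ((c.inv₂ ⋙ P).map (eqToHom h) y) = y := by
    rintro e _ rfl y
    simp
  refine (congrArg (fun t => P.map t _) h5).trans ((P.map_comp_apply _ _ _).trans ?_)
  refine (congrArg (P.map (c.unit₂.inv.app (G.obj m))) (key _ _ _ _)).trans ?_
  refine (P.map_comp_apply _ _ _).symm.trans ?_
  refine (congrArg (fun t => P.map t x) (c.unit₂.hom_inv_id_app (G.obj m))).trans ?_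
  exact P.map_id_apply _ _

variable {P' : M₂ ⥤ Type w} {L' : A₁ ⥤ Type w} {J' : B₁ ⥤ Type w}

/-- The counit of the composite is natural, in morphisms of all the functors involved. -/
theorem counit_naturality (hK : IsDiscreteOpfibration K) {ε₁ : G₁ ⋙ J ⟶ L} (h₁ : IsPi G₁ ε₁)
    {ε₁' : G₁ ⋙ J' ⟶ L'} (h₁' : IsPi G₁ ε₁')
    (ε : G ⋙ P ⟶ c.toLeft ⋙ L) (ε' : G ⋙ P' ⟶ c.toLeft ⋙ L')
    (π : P ⟶ P') (j : J ⟶ J') (l : L ⟶ L')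
    (hj : ∀ a x, ε₁'.app a (j.app _ x) = l.app a (ε₁.app a x))
    (hπ : ∀ m x, ε'.app m (π.app _ x) = l.app _ (ε.app m x)) (a : A₂)
    (z : (hK.sigma.obj P).obj (G₂.obj a)) :
    (c.counit hK h₁' ε').app a ((hK.sigma.map π).app _ z) =
      (hH.sigma.map j).app _ ((c.counit hK h₁ ε).app a z) := by
  have := c.equiv₁
  have s1 : Functor.whiskerLeft ((CommaOn.fst _ G₁ c.Q ⋙ elBaseChange F₂ G₂ hH) ⋙ c.inv₂) π ≫
      c.stepComma ε' = c.stepComma ε ≫ Functor.whiskerLeft (CommaOn.snd _ G₁ c.Q) l := by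
    apply (isPi_of_equivalence c.E₁ (CommaOn.snd _ G₁ c.Q ⋙ L')).hom_ext
    intro m x
    refine (c.stepComma_app ε' m (π.app _ x)).trans ?_
    refine Eq.trans ?_ (congrArg (l.app _) (c.stepComma_app ε m x)).symm
    refine Eq.trans ?_ (hπ m _)
    exact congrArg (ε'.app m) (NatTrans.naturality_apply π (c.isoG.hom.app m) x).symm
  have s2 : Functor.whiskerLeft (elBaseChange F₂ G₂ hH ⋙ c.inv₂) π ≫ c.stepEval h₁' ε' =
      c.stepEval h₁ ε ≫ Functor.whiskerLeft (evalFunctor F₂ G₂ hH) j := by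
    apply (h₁'.exactCounit c.exact).hom_ext
    intro m x
    refine (c.stepEval_fac h₁' ε' m (π.app _ x)).trans ?_
    refine (ConcreteCategory.congr_hom (NatTrans.congr_app s1 m) x).trans ?_
    refine (congrArg (l.app _) (c.stepEval_fac h₁ ε m x)).symm.trans ?_
    refine (hj _ _).symm.trans (congrArg (ε₁'.app _) ?_)
    exact NatTrans.naturality_apply j m.hom _
  have s3 : (c.sigmaHom hK P').app _ ((hK.sigma.map π).app _ z) =
      ((El.isDiscreteOpfibration_proj (sections F₂ G₂ hH)).sigma.map
        (Functor.whiskerLeft c.inv₂ π)).app _ ((c.sigmaHom hK P).app _ z) := by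
    obtain ⟨⟨m, hm⟩, x⟩ := z
    refine congrArg (Sigma.mk (β := fun y : {y // (El.proj (sections F₂ G₂ hH)).obj y =
      G₂.obj a} => (c.inv₂ ⋙ P').obj y.1) _) ?_
    exact (NatTrans.naturality_apply π (c.unit₂.hom.app m) x).symm
  refine (congrArg ((distribCounit hH (c.stepEval h₁' ε')).app a) s3).trans ?_
  exact distribCounit_naturality hH (c.stepEval h₁ ε) (c.stepEval h₁' ε')
    (Functor.whiskerLeft c.inv₂ π) j
    (fun e x => ConcreteCategory.congr_hom (NatTrans.congr_app s2 e) x) a _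

end Steps

end CompositionData

end Core

/-! ### Isomorphisms of typed instances -/

theorem IsDiscreteOpfibration.sigma_map_eqToHom {C D : Type} [Category.{0} C] [Category.{0} D]
    {F : C ⥤ D} (hF : IsDiscreteOpfibration F) (I : C ⥤ Type w) {d d' : D} (h : d = d')
    (c : {c : C // F.obj c = d}) (x : I.obj c.1) :
    (hF.sigma.obj I).map (eqToHom h) ⟨c, x⟩ = ⟨⟨c.1, c.2.trans h⟩, x⟩ := by
  subst h
  exact (hF.sigma.obj I).map_id_apply _ _

section Typed

variable {τ : Type u} {dom : τ → Type w}

namespace TypedInstance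

variable {S : TypedSignature τ}

/-- An isomorphism of the structure parts that preserves the data. -/
def isoMk {I J : TypedInstance dom S} (e : I.str ≅ J.str)
    (h : ∀ a x, J.data a (e.hom.app _ x) = I.data a x) : I ≅ J where
  hom := ⟨e.hom, h⟩
  inv := ⟨e.inv, fun a x => by rw [← h]; simp⟩
  hom_inv_id := hom_ext e.hom_inv_id
  inv_hom_id := hom_ext e.inv_hom_id

end TypedInstance

namespace TypedMorphism

variable {S T : TypedSignature τ}

/-- The data of `Δ`. Data of attributes whose types are equal but not definitionally so are
compared by `HEq` here and below, which absorbs the casts in the definitions. -/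
theorem delta_data_heq (F : TypedMorphism S T) (J : TypedInstance dom T) (a : Fin S.numAttrs)
    (x : J.str.obj (F.functor.obj (S.attrOb a))) :
    HEq (((F.delta dom).obj J).data a x)
      (J.data (F.onAttr a) (J.str.map (eqToHom (F.attrOb_comm a)) x)) :=
  cast_heq _ _

/-- The data of `Π`, for any attribute `a` over `b` in place of the chosen one. -/
theorem pi_data_heq (F : TypedMorphism S T) (hF : F.IsPiReady) (I : TypedInstance dom S)
    (a : Fin S.numAttrs) (b : Fin T.numAttrs) (h : F.onAttr a = b)
    (x : (F.functor.ran.obj I.str).obj (T.attrOb b)) :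
    HEq (((F.pi dom hF).obj I).data b x)
      (I.data a (((F.functor.ranCounit (H := Type w)).app I.str).app (S.attrOb a)
        ((F.functor.ran.obj I.str).map
          (eqToHom ((F.attrOb_comm a).trans (congrArg T.attrOb h)).symm) x))) := by
  have ha : a = piAttr hF b := hF.1 (h.trans (onAttr_piAttr hF b).symm)
  subst ha
  exact cast_heq _ _

/-- The data of `Σ`, for any attribute `a` over `b` in place of the chosen one. -/
theorem sigma_data_heq (F : TypedMorphism S T) (hF : F.IsSigmaReady) (I : TypedInstance dom S)
    (a : Fin S.numAttrs) (b : Fin T.numAttrs)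
    (z : (hF.opfibration.sigma.obj I.str).obj (T.attrOb b)) (ha : S.attrOb a = z.1.1)
    (hb : F.onAttr a = b) :
    HEq (((F.sigma dom hF).obj I).data b z)
      (I.data a (I.str.map (eqToHom ha.symm) z.2)) := by
  obtain rfl : a = hF.attr b z.1 :=
    (hF.attr_pullback z.1.1 b z.1.2).unique ⟨ha, hb⟩ ⟨hF.attrOb_attr b z.1, hF.onAttr_attr b z.1⟩
  exact cast_heq _ _

/-- A functor `Ψ` is the typed `Π_G` of `Φ` if there is a natural family of counits that have the
pointwise universal property and preserve the data. -/
theorem nonempty_iso_pi {𝒳 : Type*} [Category 𝒳] (G : TypedMorphism S T) (hG : G.IsPiReady)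
    (Ψ : 𝒳 ⥤ TypedInstance dom T) (Φ : 𝒳 ⥤ TypedInstance dom S)
    (ε : ∀ x, G.functor ⋙ (Ψ.obj x).str ⟶ (Φ.obj x).str)
    (hε : ∀ x, IsPi G.functor (ε x))
    (nat : ∀ {x y : 𝒳} (f : x ⟶ y) (s : S.Schema)
      (z : (Ψ.obj x).str.obj (G.functor.obj s)),
      (ε y).app s ((Ψ.map f).nat.app _ z) = (Φ.map f).nat.app s ((ε x).app s z))
    (data : ∀ x (a : Fin S.numAttrs) (z : (Ψ.obj x).str.obj (G.functor.obj (S.attrOb a))),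
      HEq ((Φ.obj x).data a ((ε x).app (S.attrOb a) z))
        ((Ψ.obj x).data (G.onAttr a) ((Ψ.obj x).str.map (eqToHom (G.attrOb_comm a)) z))) :
    Nonempty (Ψ ≅ Φ ⋙ G.pi dom hG) := by
  have hr := fun x => isPi_ranCounit G.functor (Φ.obj x).str
  let e : ∀ x, (Ψ.obj x).str ≅ G.functor.ran.obj (Φ.obj x).str := fun x =>
    { hom := (hr x).lift (ε x)
      inv := (hε x).lift ((G.functor.ranCounit (H := Type w)).app (Φ.obj x).str)
      hom_inv_id := (hε x).hom_ext fun s z => by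
        refine ((hε x).lift_fac _ s _).trans ?_
        exact (hr x).lift_fac (ε x) s z
      inv_hom_id := (hr x).hom_ext fun s z => by
        refine ((hr x).lift_fac _ s _).trans ?_
        exact (hε x).lift_fac _ s z }
  refine ⟨NatIso.ofComponents (fun x => TypedInstance.isoMk (e x) ?_) ?_⟩
  · intro b z
    obtain ⟨a, rfl⟩ := hG.2 b
    apply eq_of_heq
    refine (G.pi_data_heq hG (Φ.obj x) a _ rfl _).trans ?_
    have h1 := NatTrans.naturality_apply (e x).hom (eqToHom (G.attrOb_comm a).symm) z
    have h2 := (hr x).lift_fac (ε x) (S.attrOb a) ((Ψ.obj x).str.map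
      (eqToHom (G.attrOb_comm a).symm) z)
    have h3 := (congrArg (((G.functor.ranCounit (H := Type w)).app (Φ.obj x).str).app
      (S.attrOb a)) h1).symm.trans h2
    refine HEq.trans ?_ ((data x a ((Ψ.obj x).str.map
      (eqToHom (G.attrOb_comm a).symm) z)).trans ?_)
    · exact heq_of_eq (congrArg ((Φ.obj x).data a) h3)
    · refine heq_of_eq (congrArg ((Ψ.obj x).data (G.onAttr a)) ?_)
      rw [← Functor.map_comp_apply]
      simp
  · intro x y f
    apply TypedInstance.hom_ext
    apply (hr y).hom_ext
    intro s z
    refine ((hr y).lift_fac (ε y) s _).trans ((nat f s z).trans ?_)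
    refine (congrArg ((Φ.map f).nat.app s) ((hr x).lift_fac (ε x) s z)).symm.trans ?_
    have h1 := congr_app ((G.functor.ranCounit (H := Type w)).naturality
      (Φ.map f).nat) s
    exact (ConcreteCategory.congr_hom h1 (((hr x).lift (ε x)).app _ z)).symm

end TypedMorphism

/-! ### Composition of typed signature morphisms -/

namespace SignatureMorphism

variable {S T U : Signature}

/-- The path map of the composite is the composite of the path maps. -/
theorem lift_comp_map (F : SignatureMorphism S T) (G : SignatureMorphism T U) {x y : S.Node}
    (p : Quiver.Path x y) :
    (Paths.lift (C := Paths U.Node) ⟨fun x => G.onNode (F.onNode x),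
      fun e => G.onPath.map (F.onEdge e)⟩).map (X := (x : Paths S.Node)) (Y := (y : Paths S.Node)) p
      = G.onPath.map (F.onPath.map (X := (x : Paths S.Node)) (Y := (y : Paths S.Node)) p) := by
  induction p with
  | nil => rfl
  | cons p e ih =>
    have h := G.onPath.map_comp (F.onPath.map (X := (x : Paths S.Node)) p) (F.onEdge e)
    refine Eq.trans ?_ h.symm
    rw [← ih]
    rfl

/-- The composite of signature morphisms. -/
def comp (F : SignatureMorphism S T) (G : SignatureMorphism T U) : SignatureMorphism S U where
  onNode x := G.onNode (F.onNode x)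
  onEdge e := G.onPath.map (F.onEdge e)
  respects E hE := by
    rw [lift_comp_map, lift_comp_map]
    exact congrArg G.functor.map (F.respects E hE)

theorem comp_functor (F : SignatureMorphism S T) (G : SignatureMorphism T U) :
    (F.comp G).functor = F.functor ⋙ G.functor := by
  apply CategoryTheory.Quotient.lift_unique'
  refine CategoryTheory.Functor.ext (fun _ => rfl) fun x y p => ?_
  refine Eq.trans ?_ ((Category.id_comp _).trans (Category.comp_id _)).symm
  exact congrArg (CategoryTheory.Quotient.functor U.rel).map (lift_comp_map F G p)

end SignatureMorphism

namespace TypedMorphism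

variable {S T U : TypedSignature τ}

/-- The composite of typed signature morphisms. -/
def comp (F : TypedMorphism S T) (G : TypedMorphism T U) : TypedMorphism S U where
  toSignatureMorphism := F.toSignatureMorphism.comp G.toSignatureMorphism
  onAttr a := G.onAttr (F.onAttr a)
  attrNode_comm a := (congrArg G.onNode (F.attrNode_comm a)).trans (G.attrNode_comm _)
  attrType_comm a := (G.attrType_comm _).trans (F.attrType_comm a)

theorem comp_functor (F : TypedMorphism S T) (G : TypedMorphism T U) :
    (F.comp G).functor = F.functor ⋙ G.functor :=
  SignatureMorphism.comp_functor _ _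

theorem IsSigmaReady.comp {F : TypedMorphism S T} {G : TypedMorphism T U} (hF : F.IsSigmaReady)
    (hG : G.IsSigmaReady) : (F.comp G).IsSigmaReady where
  opfibration := by
    rw [comp_functor]
    exact hF.opfibration.comp hG.opfibration
  attr_pullback x b h := by
    rw [comp_functor] at h
    obtain ⟨a, ⟨h1, h2⟩, hu⟩ := hG.attr_pullback (F.functor.obj x) b h
    obtain ⟨a', ⟨h1', h2'⟩, hu'⟩ := hF.attr_pullback x a h1.symm
    refine ⟨a', ⟨h1', (congrArg G.onAttr h2').trans h2⟩, ?_⟩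
    rintro a'' ⟨h3, h4⟩
    exact hu' _ ⟨h3, hu _ ⟨(F.attrOb_comm a'').symm.trans (congrArg F.functor.obj h3), h4⟩⟩

/-- `Σ` along a composite is the composite of `Σ`. -/
theorem nonempty_sigma_comp_iso {F : TypedMorphism S T} {G : TypedMorphism T U}
    (hF : F.IsSigmaReady) (hG : G.IsSigmaReady) :
    Nonempty ((F.comp G).sigma dom (hF.comp hG) ≅ F.sigma dom hF ⋙ G.sigma dom hG) := by
  have hc : ∀ x, (F.comp G).functor.obj x = G.functor.obj (F.functor.obj x) := fun x =>
    congrArg (fun t => t.obj x) (comp_functor F G)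
  -- An object over `u` along the composite is sent to its image under `F`, and itself over that.
  let hom : ∀ I : S.Schema ⥤ Type w, (hF.comp hG).opfibration.sigma.obj I ⟶
      hG.opfibration.sigma.obj (hF.opfibration.sigma.obj I) := fun I =>
    { app := fun u => TypeCat.ofHom fun z =>
        ⟨⟨F.functor.obj z.1.1, (hc _).symm.trans z.1.2⟩, ⟨⟨z.1.1, rfl⟩, z.2⟩⟩
      naturality := by
        intro u u' g
        apply ConcreteCategory.hom_ext
        rintro ⟨x, i⟩
        have hl := (hF.comp hG).opfibration.map_lift x g
        rw [Functor.congr_hom (comp_functor F G)] at hl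
        simp only [Category.assoc, eqToHom_trans] at hl
        rw [eqToHom_comp_iff] at hl
        have h1 := hF.opfibration.sigmaMap_eq I
          (F.functor.map ((hF.comp hG).opfibration.lift x g).2) ⟨x.1, rfl⟩ i
          ⟨((hF.comp hG).opfibration.lift x g).1, rfl⟩ ((hF.comp hG).opfibration.lift x g).2
          ((Category.comp_id _).trans (Category.id_comp _).symm)
        have h2 := hG.opfibration.sigmaMap_eq (hF.opfibration.sigma.obj I) g
          ⟨F.functor.obj x.1, (hc _).symm.trans x.2⟩ ⟨⟨x.1, rfl⟩, i⟩
          ⟨F.functor.obj ((hF.comp hG).opfibration.lift x g).1,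
            (hc _).symm.trans ((hF.comp hG).opfibration.obj_lift x g)⟩
          (F.functor.map ((hF.comp hG).opfibration.lift x g).2) (by
            refine Eq.trans hl ?_
            rw [← Category.assoc, eqToHom_trans])
        refine Eq.trans ?_ h2.symm
        exact congrArg (Sigma.mk (β := fun y : {y // G.functor.obj y = u'} =>
          (hF.opfibration.sigma.obj I).obj y.1) _) h1.symm }
  have hb : ∀ I u, Function.Bijective ((hom I).app u) := by
    intro I u
    constructor
    · rintro ⟨⟨x, hx⟩, i⟩ ⟨⟨x', hx'⟩, i'⟩ h
      have h0 : (⟨⟨F.functor.obj x, _⟩, ⟨⟨x, rfl⟩, i⟩⟩ :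
          (hG.opfibration.sigma.obj (hF.opfibration.sigma.obj I)).obj u) =
          ⟨⟨F.functor.obj x', _⟩, ⟨⟨x', rfl⟩, i'⟩⟩ := h
      have key : ∀ (z z' : (hG.opfibration.sigma.obj (hF.opfibration.sigma.obj I)).obj u),
          z = z' → (⟨z.2.1.1, z.2.2⟩ : (x : S.Schema) × I.obj x) = ⟨z'.2.1.1, z'.2.2⟩ := by
        rintro z _ rfl
        rfl
      have h1 := key _ _ h0
      obtain rfl : x = x' := congrArg Sigma.fst h1
      obtain rfl : i = i' := eq_of_heq (Sigma.mk.inj h1).2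
      rfl
    · have key : ∀ (y : T.Schema) (hy : G.functor.obj y = u) (x : S.Schema)
          (hx : F.functor.obj x = y) (i : I.obj x), ∃ z, (hom I).app u z =
            (⟨⟨y, hy⟩, ⟨⟨x, hx⟩, i⟩⟩ :
              (hG.opfibration.sigma.obj (hF.opfibration.sigma.obj I)).obj u) := by
        rintro _ hy x rfl i
        exact ⟨⟨⟨x, (hc x).trans hy⟩, i⟩, rfl⟩
      rintro ⟨⟨y, hy⟩, ⟨⟨x, hx⟩, i⟩⟩
      exact key y hy x hx i
  have hi : ∀ I, IsIso (hom I) := fun I =>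
    (NatTrans.isIso_iff_isIso_app _).2 fun u => (isIso_iff_bijective _).2 (hb I u)
  refine ⟨NatIso.ofComponents
    (fun I => TypedInstance.isoMk (@asIso _ _ _ _ (hom I.str) (hi I.str)) ?_) ?_⟩
  · rintro b ⟨⟨x, hx⟩, i⟩
    apply eq_of_heq
    obtain ⟨a, ⟨h1, h2⟩, -⟩ := hG.attr_pullback (F.functor.obj x) b ((hc x).symm.trans hx)
    obtain ⟨a', ⟨rfl, rfl⟩, -⟩ := hF.attr_pullback x a h1.symm
    refine (G.sigma_data_heq hG _ (F.onAttr a') b _ h1 h2).trans ?_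
    refine HEq.trans ?_ ((F.comp G).sigma_data_heq (hF.comp hG) I a' b _ rfl h2).symm
    refine HEq.trans (heq_of_eq (congrArg (((F.sigma dom hF).obj I).data (F.onAttr a'))
      (hF.opfibration.sigma_map_eqToHom I.str h1.symm ⟨_, rfl⟩ i))) ?_
    exact F.sigma_data_heq hF I a' (F.onAttr a') _ rfl rfl
  · intro I J f
    rfl

end TypedMorphism
end Typed

/-! ### The functor that a composite query denotes -/

section Denote

theorem map_map_eqToHom {C : Type} [Category.{0} C] (I : C ⥤ Type w) {x y z : C} (h : x = y)
    (h' : y = z) (t : I.obj x) :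
    I.map (eqToHom h') (I.map (eqToHom h) t) = I.map (eqToHom (h.trans h')) t := by
  rw [← Functor.map_comp_apply, eqToHom_trans]

variable {τ : Type u}

theorem map_eqToHom_self {C : Type} [Category.{0} C] (I : C ⥤ Type w) {x : C} (h : x = x)
    (t : I.obj x) : I.map (eqToHom h) t = t :=
  I.map_id_apply _ _

/-- Typed composition data: composition data of the schemas, and for each attribute of `M₁` an
attribute `attr` of `A₂` to which it corresponds. The object of the comma category to which an
attribute belongs lies over the node of `attr`, and its arrow is an identity; so no arrow enters
into the comparison of the data. -/
structure TypedCompositionData {A₁ B₁ X A₂ B₂ M₁ M₂ : TypedSignature τ} (G₁ : TypedMorphism A₁ B₁)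
    (H₁ : TypedMorphism B₁ X) (hH : H₁.IsSigmaReady) (F₂ : TypedMorphism A₂ X)
    (G₂ : TypedMorphism A₂ B₂) (L : TypedMorphism M₁ A₁) (G : TypedMorphism M₁ M₂)
    (K : TypedMorphism M₂ B₂) where
  data : CompositionData F₂.functor G₂.functor hH.opfibration G₁.functor G.functor K.functor
  left_comm : L.functor = data.toLeft
  attr : Fin M₁.numAttrs → Fin A₂.numAttrs
  base_attr : ∀ i, (data.E₁.obj (M₁.attrOb i)).left.base = A₂.attrOb (attr i)
  hom_attr : ∀ i, ∃ h, (data.E₁.obj (M₁.attrOb i)).hom = eqToHom h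
  onAttr_right : ∀ i, K.onAttr (G.onAttr i) = G₂.onAttr (attr i)
  onAttr_left : ∀ i, H₁.onAttr (G₁.onAttr (L.onAttr i)) = F₂.onAttr (attr i)

namespace TypedCompositionData

variable {S A₁ B₁ X A₂ B₂ M₁ M₂ : TypedSignature τ} {F₁ : TypedMorphism A₁ S}
  {G₁ : TypedMorphism A₁ B₁}
  {H₁ : TypedMorphism B₁ X} {hH : H₁.IsSigmaReady} {F₂ : TypedMorphism A₂ X}
  {G₂ : TypedMorphism A₂ B₂} {L : TypedMorphism M₁ A₁} {G : TypedMorphism M₁ M₂}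
  {K : TypedMorphism M₂ B₂} (c : TypedCompositionData G₁ H₁ hH F₂ G₂ L G K)
  {dom : τ → Type w}

theorem functor_eq : (L.comp F₁).functor = c.data.toLeft ⋙ F₁.functor := by
  rw [TypedMorphism.comp_functor, c.left_comm]

/-- The counit of `Π_G`, along the equality of the restriction along `L.comp F₁` with the
restriction in two steps. -/
noncomputable def leftCounit (I : S.Schema ⥤ Type w) :
    G.functor ⋙ G.functor.ran.obj ((L.comp F₁).functor ⋙ I) ⟶
      c.data.toLeft ⋙ F₁.functor ⋙ I :=
  (G.functor.ranCounit (H := Type w)).app ((L.comp F₁).functor ⋙ I) ≫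
    (Functor.isoWhiskerRight (eqToIso c.functor_eq) I).hom

theorem leftCounit_app (I : S.Schema ⥤ Type w) (m : M₁.Schema)
    (x : (G.functor.ran.obj ((L.comp F₁).functor ⋙ I)).obj (G.functor.obj m)) :
    (c.leftCounit I).app m x = I.map (eqToHom (congrArg (fun t => t.obj m) c.functor_eq))
      (((G.functor.ranCounit (H := Type w)).app ((L.comp F₁).functor ⋙ I)).app m x) := by
  have : (eqToIso (c.functor_eq (F₁ := F₁))).hom.app m =
      eqToHom (congrArg (fun t => t.obj m) c.functor_eq) := by simp
  exact congrArg (fun t => I.map t (((G.functor.ranCounit (H := Type w)).app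
    ((L.comp F₁).functor ⋙ I)).app m x)) this

theorem leftCounit_naturality {I I' : S.Schema ⥤ Type w} (α : I ⟶ I') (m : M₁.Schema)
    (x : (G.functor.ran.obj ((L.comp F₁).functor ⋙ I)).obj (G.functor.obj m)) :
    (c.leftCounit I').app m
      ((G.functor.ran.map (Functor.whiskerLeft (L.comp F₁).functor α)).app _ x) =
      α.app _ ((c.leftCounit I).app m x) := by
  rw [leftCounit_app, leftCounit_app]
  have h1 := congr_app ((G.functor.ranCounit (H := Type w)).naturality
    (Functor.whiskerLeft (L.comp F₁).functor α)) m
  have h2 := ConcreteCategory.congr_hom h1 x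
  refine (congrArg (I'.map _) h2).trans ?_
  exact (NatTrans.naturality_apply α _ _).symm

theorem isPi_leftCounit (I : S.Schema ⥤ Type w) :
    IsPi G.functor (c.leftCounit (F₁ := F₁) I) :=
  (isPi_ranCounit G.functor _).of_iso_right _

/-- `Σ_K Π_G Δ_{F₁ L}` is `Π_{G₂} Δ_{F₂} Σ_{H₁} Π_{G₁} Δ_{F₁}` on typed instances: the counit of the
composition data is natural and preserves the data. -/
theorem nonempty_iso (c : TypedCompositionData G₁ H₁ hH F₂ G₂ L G K) (hG₁ : G₁.IsPiReady)
    (hG₂ : G₂.IsPiReady) (hG : G.IsPiReady) (hK : K.IsSigmaReady) :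
    Nonempty ((L.comp F₁).delta dom ⋙ G.pi dom hG ⋙ K.sigma dom hK ≅
      (F₁.delta dom ⋙ G₁.pi dom hG₁ ⋙ H₁.sigma dom hH ⋙ F₂.delta dom) ⋙ G₂.pi dom hG₂) := by
  have h₁ := fun I : TypedInstance dom S => isPi_ranCounit G₁.functor (F₁.functor ⋙ I.str)
  refine TypedMorphism.nonempty_iso_pi G₂ hG₂ _ _
    (fun I => c.data.counit hK.opfibration (h₁ I) (c.leftCounit I.str))
    (fun I => c.data.isPi_counit hK.opfibration (h₁ I) (c.isPi_leftCounit I.str)) ?_ ?_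
  · intro I I' f s z
    refine c.data.counit_naturality hK.opfibration (h₁ I) (h₁ I') (c.leftCounit I.str)
      (c.leftCounit I'.str)
      (G.functor.ran.map (Functor.whiskerLeft (L.comp F₁).functor f.nat))
      (G₁.functor.ran.map (Functor.whiskerLeft F₁.functor f.nat))
      (Functor.whiskerLeft F₁.functor f.nat) ?_ ?_ s z
    · intro a x
      exact ConcreteCategory.congr_hom (congr_app ((G₁.functor.ranCounit (H := Type w)).naturality
        (Functor.whiskerLeft F₁.functor f.nat)) a) x
    · exact c.leftCounit_naturality f.nat
  · intro I b z
    obtain ⟨⟨m₂, hm₂⟩, x⟩ := z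
    obtain ⟨j, ⟨hj, hjb⟩, -⟩ := hK.attr_pullback m₂ (G₂.onAttr b)
      (hm₂.trans (G₂.attrOb_comm b))
    obtain ⟨i, rfl⟩ := hG.2 j
    have hm : m₂ = G.functor.obj (M₁.attrOb i) := hj.symm.trans (G.attrOb_comm i).symm
    subst hm
    obtain rfl : c.attr i = b := hG₂.1 ((c.onAttr_right i).symm.trans hjb)
    obtain ⟨hb, hs⟩ := c.data.counit_spec hK.opfibration (h₁ I) (c.leftCounit I.str)
      (M₁.attrOb i) x (c.base_attr i) hm₂
    obtain ⟨hh, hhom⟩ := c.hom_attr i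
    have hright : (c.data.E₁.obj (M₁.attrOb i)).right = A₁.attrOb (L.onAttr i) :=
      (congrArg (fun t => t.obj (M₁.attrOb i)) c.left_comm).symm.trans (L.attrOb_comm i)
    set z' := (c.data.counit hK.opfibration (h₁ I) (c.leftCounit I.str)).app
      (A₂.attrOb (c.attr i)) ⟨⟨G.functor.obj (M₁.attrOb i), hm₂⟩, x⟩ with hz'
    have hy : z'.1.1 = G₁.functor.obj (c.data.E₁.obj (M₁.attrOb i)).right := hb.trans hh
    have ha : B₁.attrOb (G₁.onAttr (L.onAttr i)) = z'.1.1 :=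
      (hy.trans ((congrArg G₁.functor.obj hright).trans (G₁.attrOb_comm _))).symm
    -- The data of both sides are unfolded to data of `I`: `l1` to `l5` along `F₂`, `H₁`, `G₁`,
    -- `F₁`, and `r2` to `r5` along `G₂`, `K`, `G`, `L.comp F₁`. The elements agree
    -- by `counit_spec`.
    have l1 := F₂.delta_data_heq ((H₁.sigma dom hH).obj ((G₁.pi dom hG₁).obj
      ((F₁.delta dom).obj I))) (c.attr i) z'
    have l2 := hH.opfibration.sigma_map_eqToHom _ (F₂.attrOb_comm (c.attr i)) z'.1 z'.2
    have l3 := H₁.sigma_data_heq hH ((G₁.pi dom hG₁).obj ((F₁.delta dom).obj I))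
      (G₁.onAttr (L.onAttr i)) (F₂.onAttr (c.attr i))
      ⟨⟨z'.1.1, z'.1.2.trans (F₂.attrOb_comm (c.attr i))⟩, z'.2⟩ ha (c.onAttr_left i)
    have l4 := G₁.pi_data_heq hG₁ ((F₁.delta dom).obj I) (L.onAttr i) _ rfl
      ((G₁.functor.ran.obj (F₁.functor ⋙ I.str)).map (eqToHom ha.symm) z'.2)
    have l5 := F₁.delta_data_heq I (L.onAttr i) (((G₁.functor.ranCounit (H := Type w)).app
      (F₁.functor ⋙ I.str)).app (A₁.attrOb (L.onAttr i))
        ((G₁.functor.ran.obj (F₁.functor ⋙ I.str)).map (eqToHom (G₁.attrOb_comm _).symm)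
          ((G₁.functor.ran.obj (F₁.functor ⋙ I.str)).map (eqToHom ha.symm) z'.2)))
    have r2 := hK.opfibration.sigma_map_eqToHom
      (G.functor.ran.obj ((L.comp F₁).functor ⋙ I.str)) (G₂.attrOb_comm (c.attr i))
      ⟨G.functor.obj (M₁.attrOb i), hm₂⟩ x
    have r3 := K.sigma_data_heq hK ((G.pi dom hG).obj (((L.comp F₁).delta dom).obj I))
      (G.onAttr i) (G₂.onAttr (c.attr i))
      ⟨⟨G.functor.obj (M₁.attrOb i), hm₂.trans (G₂.attrOb_comm (c.attr i))⟩, x⟩ hj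
      (c.onAttr_right i)
    have r4 := G.pi_data_heq hG (((L.comp F₁).delta dom).obj I) i _ rfl
      ((G.functor.ran.obj ((L.comp F₁).functor ⋙ I.str)).map (eqToHom hj.symm) x)
    have r5 := (L.comp F₁).delta_data_heq I i (((G.functor.ranCounit (H := Type w)).app
      ((L.comp F₁).functor ⋙ I.str)).app (M₁.attrOb i)
        ((G.functor.ran.obj ((L.comp F₁).functor ⋙ I.str)).map (eqToHom (G.attrOb_comm _).symm)
          ((G.functor.ran.obj ((L.comp F₁).functor ⋙ I.str)).map (eqToHom hj.symm) x)))
    refine l1.trans ((heq_of_eq (congrArg _ l2)).trans (l3.trans (l4.trans (l5.trans ?_))))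
    refine HEq.trans ?_ (HEq.trans (heq_of_eq (congrArg _ r2)) (r3.trans (r4.trans r5))).symm
    refine heq_of_eq (congrArg (I.data (F₁.onAttr (L.onAttr i))) ?_)
    have key : ∀ (a : A₁.Schema) (h : a = A₁.attrOb (L.onAttr i))
        (v : z'.1.1 = G₁.functor.obj a) (t : I.str.obj (F₁.functor.obj a)),
        ((G₁.functor.ranCounit (H := Type w)).app (F₁.functor ⋙ I.str)).app a
          ((G₁.functor.ran.obj (F₁.functor ⋙ I.str)).map (eqToHom v) z'.2) = t →
        ((G₁.functor.ranCounit (H := Type w)).app (F₁.functor ⋙ I.str)).app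
          (A₁.attrOb (L.onAttr i))
          ((G₁.functor.ran.obj (F₁.functor ⋙ I.str)).map (eqToHom (G₁.attrOb_comm _).symm)
            ((G₁.functor.ran.obj (F₁.functor ⋙ I.str)).map (eqToHom ha.symm) z'.2)) =
          I.str.map (eqToHom (congrArg F₁.functor.obj h)) t := by
      rintro _ rfl v _ rfl
      rw [← Functor.map_comp_apply, eqToHom_trans, eqToHom_refl, Functor.map_id_apply]
    have hcomp : eqToHom hb ≫ (c.data.E₁.obj (M₁.attrOb i)).hom = eqToHom hy := by
      rw [hhom]
      exact eqToHom_trans _ _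
    have hs' := (congrArg (fun t => ((G₁.functor.ranCounit (H := Type w)).app
      (F₁.functor ⋙ I.str)).app (c.data.E₁.obj (M₁.attrOb i)).right
        ((G₁.functor.ran.obj (F₁.functor ⋙ I.str)).map t z'.2)) hcomp).symm.trans
        (hs.trans (c.leftCounit_app I.str (M₁.attrOb i) x))
    refine (congrArg (I.str.map _) (key _ hright hy _ hs')).trans ?_
    refine (map_map_eqToHom I.str _ _ _).trans ((map_map_eqToHom I.str _ _ _).trans ?_)
    refine congrArg (I.str.map _) (congrArg (((G.functor.ranCounit (H := Type w)).app
      ((L.comp F₁).functor ⋙ I.str)).app (M₁.attrOb i)) ?_)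
    refine Eq.symm ((map_map_eqToHom _ _ _ _).trans ?_)
    exact map_eqToHom_self _ _ _

end TypedCompositionData

/-- The typed signature morphisms of typed composition data, composed with `F₁` and `H₂`, denote
the composite of the functors of the queries `f` and `g`. -/
theorem nonempty_denote_iso {S X T : TypedSignature τ} {dom : τ → Type w} (f : FQLQuery S X)
    (g : FQLQuery X T) {M₁ M₂ : TypedSignature τ} {L : TypedMorphism M₁ f.mid₁}
    {G : TypedMorphism M₁ M₂} {K : TypedMorphism M₂ g.mid₂}
    (c : TypedCompositionData f.G f.H f.sigmaReady g.F g.G L G K)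
    (hG : G.IsPiReady) (hK : K.IsSigmaReady) :
    Nonempty ((L.comp f.F).delta dom ⋙ G.pi dom hG ⋙
      (K.comp g.H).sigma dom (hK.comp g.sigmaReady) ≅ f.denote dom ⋙ g.denote dom) := by
  obtain ⟨e₁⟩ := TypedMorphism.nonempty_sigma_comp_iso (dom := dom) hK g.sigmaReady
  obtain ⟨e₂⟩ := c.nonempty_iso (F₁ := f.F) (dom := dom) f.piReady g.piReady hG hK
  exact ⟨Functor.isoWhiskerLeft ((L.comp f.F).delta dom ⋙ G.pi dom hG) e₁ ≪≫
    Functor.isoWhiskerRight e₂ (g.H.sigma dom g.sigmaReady)⟩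

end Denote

/-! ### Tables of finite categories -/

/-- The table of a finite category: number of objects; source and target of each arrow;
identity of each object; composites of the pairs of arrows. Entries for pairs that are not
composable have no meaning. -/
abbrev CatTable : Type := ℕ × List (ℕ × ℕ) × List ℕ × List (List ℕ)

namespace CatTable

/-- The number of objects. -/
def numOb (t : CatTable) : ℕ := t.1

/-- The number of arrows. -/
def numAr (t : CatTable) : ℕ := t.2.1.length

/-- The source of an arrow. -/
def src (t : CatTable) (r : ℕ) : ℕ := (t.2.1.getD r (0, 0)).1

/-- The target of an arrow. -/
def tgt (t : CatTable) (r : ℕ) : ℕ := (t.2.1.getD r (0, 0)).2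

/-- The identity of an object. -/
def ident (t : CatTable) (x : ℕ) : ℕ := t.2.2.1.getD x 0

/-- The composite of two arrows, in diagrammatic order. -/
def comp (t : CatTable) (r s : ℕ) : ℕ := (t.2.2.2.getD r []).getD s 0

end CatTable

/-- The table `t` describes the category `C`, by a numbering of the objects and of the arrows. -/
structure Pres (t : CatTable) (C : Type) [Category.{0} C] where
  ob : C → ℕ
  ar : ∀ {x y : C}, (x ⟶ y) → ℕ
  ob_lt : ∀ x, ob x < t.numOb
  ob_inj : Function.Injective ob
  ob_surj : ∀ i < t.numOb, ∃ x, ob x = i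
  ar_lt : ∀ {x y : C} (k : x ⟶ y), ar k < t.numAr
  ar_inj : ∀ {x y : C} (k l : x ⟶ y), ar k = ar l → k = l
  ar_surj : ∀ r < t.numAr, ∃ (x y : C) (k : x ⟶ y), ar k = r
  src_ar : ∀ {x y : C} (k : x ⟶ y), t.src (ar k) = ob x
  tgt_ar : ∀ {x y : C} (k : x ⟶ y), t.tgt (ar k) = ob y
  ident_ob : ∀ x, t.ident (ob x) = ar (𝟙 x)
  comp_ar : ∀ {x y z : C} (k : x ⟶ y) (l : y ⟶ z), t.comp (ar k) (ar l) = ar (k ≫ l)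

namespace Pres

variable {t : CatTable} {C : Type} [Category.{0} C] (p : Pres t C)

theorem forall_ob {P : ℕ → Prop} : (∀ i < t.numOb, P i) ↔ ∀ x, P (p.ob x) :=
  ⟨fun h x => h _ (p.ob_lt x), fun h i hi => by
    obtain ⟨x, rfl⟩ := p.ob_surj i hi
    exact h x⟩

theorem forall_ar {P : ℕ → Prop} :
    (∀ r < t.numAr, P r) ↔ ∀ (x y : C) (k : x ⟶ y), P (p.ar k) :=
  ⟨fun h _ _ k => h _ (p.ar_lt k), fun h i hi => by
    obtain ⟨x, y, k, rfl⟩ := p.ar_surj i hi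
    exact h x y k⟩

theorem exists_hom {x y : C} {r : ℕ} (hr : r < t.numAr) (hx : t.src r = p.ob x)
    (hy : t.tgt r = p.ob y) : ∃ k : x ⟶ y, p.ar k = r := by
  obtain ⟨x', y', k, rfl⟩ := p.ar_surj r hr
  obtain rfl := p.ob_inj ((p.src_ar k).symm.trans hx)
  obtain rfl := p.ob_inj ((p.tgt_ar k).symm.trans hy)
  exact ⟨k, rfl⟩

theorem ar_eqToHom_comp {x x' y y' : C} (h : x' = x) (k : x ⟶ y) (h' : y = y') :
    p.ar (eqToHom h ≫ k ≫ eqToHom h') = p.ar k := by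
  subst h
  subst h'
  simp

theorem src_lt (p : Pres t C) {r : ℕ} (hr : r < t.numAr) : t.src r < t.numOb := by
  obtain ⟨x, y, k, rfl⟩ := p.ar_surj r hr
  rw [p.src_ar]
  exact p.ob_lt x

theorem tgt_lt (p : Pres t C) {r : ℕ} (hr : r < t.numAr) : t.tgt r < t.numOb := by
  obtain ⟨x, y, k, rfl⟩ := p.ar_surj r hr
  rw [p.tgt_ar]
  exact p.ob_lt y

theorem ident_spec (p : Pres t C) {x : ℕ} (hx : x < t.numOb) :
    t.ident x < t.numAr ∧ t.src (t.ident x) = x ∧ t.tgt (t.ident x) = x := by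
  obtain ⟨x, rfl⟩ := p.ob_surj x hx
  rw [p.ident_ob]
  exact ⟨p.ar_lt _, p.src_ar _, p.tgt_ar _⟩

theorem comp_spec (p : Pres t C) {r s : ℕ} (hr : r < t.numAr) (hs : s < t.numAr)
    (h : t.tgt r = t.src s) :
    t.comp r s < t.numAr ∧ t.src (t.comp r s) = t.src r ∧ t.tgt (t.comp r s) = t.tgt s := by
  obtain ⟨x, y, k, rfl⟩ := p.ar_surj r hr
  obtain ⟨y', z, l, rfl⟩ := p.ar_surj s hs
  rw [p.tgt_ar, p.src_ar] at h
  obtain rfl := p.ob_inj h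
  rw [p.comp_ar, p.src_ar, p.tgt_ar, p.src_ar, p.tgt_ar]
  exact ⟨p.ar_lt _, rfl, rfl⟩

/-! ### The signature of a table -/

/-- The graph of a table: its objects and all its arrows. -/
def graph (p : Pres t C) : FinGraph where
  numNodes := t.numOb
  numEdges := t.numAr
  src e := ⟨t.src e, p.src_lt e.2⟩
  tgt e := ⟨t.tgt e, p.tgt_lt e.2⟩

/-- The node of an object. -/
def node (x : C) : p.graph.Node := (⟨p.ob x, p.ob_lt x⟩ : Fin t.numOb)

/-- The number of a node. -/
def nodeVal (i : p.graph.Node) : ℕ := Fin.val (n := t.numOb) i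

theorem nodeVal_lt (i : p.graph.Node) : p.nodeVal i < t.numOb := Fin.isLt (n := t.numOb) i

theorem node_ext {i j : p.graph.Node} (h : p.nodeVal i = p.nodeVal j) : i = j :=
  Fin.ext (n := t.numOb) h

/-- The edge of a given number. -/
def edgeAt {i j : p.graph.Node} (r : ℕ) (hr : r < t.numAr) (hi : t.src r = p.nodeVal i)
    (hj : t.tgt r = p.nodeVal j) : i ⟶ j :=
  ⟨⟨r, hr⟩, Fin.ext (n := t.numOb) hi, Fin.ext (n := t.numOb) hj⟩

theorem src_edge {i j : p.graph.Node} (e : i ⟶ j) : t.src (Fin.val e.1) = p.nodeVal i :=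
  congrArg (Fin.val (n := t.numOb)) e.2.1

theorem tgt_edge {i j : p.graph.Node} (e : i ⟶ j) : t.tgt (Fin.val e.1) = p.nodeVal j :=
  congrArg (Fin.val (n := t.numOb)) e.2.2

theorem edge_ext {i j : p.graph.Node} {e e' : i ⟶ j} (h : Fin.val e.1 = Fin.val e'.1) : e = e' :=
  Subtype.ext (Fin.ext h)

/-- The edge of an arrow. -/
def edge {x y : C} (k : x ⟶ y) : p.node x ⟶ p.node y :=
  p.edgeAt (p.ar k) (p.ar_lt k) (p.src_ar k) (p.tgt_ar k)

/-- The equation that makes the edge of an identity the empty path. -/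
def identEquation (x : p.graph.Node) : PathEquation p.graph where
  source := x
  target := x
  lhs := Quiver.Path.nil.cons (p.edgeAt (t.ident (p.nodeVal x)) (p.ident_spec (p.nodeVal_lt x)).1
    (p.ident_spec (p.nodeVal_lt x)).2.1 (p.ident_spec (p.nodeVal_lt x)).2.2)
  rhs := .nil

/-- The source of an edge. -/
def srcNode (r : Fin t.numAr) : p.graph.Node := p.graph.src r

/-- The target of an edge. -/
def tgtNode (r : Fin t.numAr) : p.graph.Node := p.graph.tgt r

/-- The edge of the composite of two edges. -/
def compEdge (r s : Fin t.numAr) (h : t.tgt r = t.src s) : p.srcNode r ⟶ p.tgtNode s :=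
  p.edgeAt (t.comp r s) (p.comp_spec r.2 s.2 h).1 (p.comp_spec r.2 s.2 h).2.1
    (p.comp_spec r.2 s.2 h).2.2

/-- The equation of two edges with the edge of their composite. -/
def compEquation (r s : Fin t.numAr) (h : t.tgt r = t.src s) : PathEquation p.graph where
  source := p.srcNode r
  target := p.tgtNode s
  lhs := (Quiver.Path.nil.cons
    (p.edgeAt (i := p.srcNode r) (j := p.tgtNode r) r r.2 rfl rfl)).cons
      (p.edgeAt s s.2 h.symm rfl)
  rhs := Quiver.Path.nil.cons (p.compEdge r s h)

/-- The signature with all arrows as edges and with the composition table as equations. -/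
@[reducible]
def sig : Signature where
  graph := p.graph
  eqns := (List.finRange t.numOb).map (fun x => p.identEquation x) ++
    (List.finRange t.numAr).flatMap fun r : Fin t.numAr =>
      (List.finRange t.numAr).flatMap fun s : Fin t.numAr =>
        if h : t.tgt r = t.src s then [p.compEquation r s h] else []

theorem mem_eqns {E : PathEquation p.graph} : E ∈ p.sig.eqns ↔
    (∃ x, p.identEquation x = E) ∨ ∃ r s h, p.compEquation r s h = E := by
  refine List.mem_append.trans (or_congr (List.mem_map.trans ?_) (List.mem_flatMap.trans ⟨?_, ?_⟩))
  · exact exists_congr fun x => and_iff_right (List.mem_finRange x)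
  · rintro ⟨r, -, hr⟩
    obtain ⟨s, -, hs⟩ := List.mem_flatMap.1 hr
    split_ifs at hs with h
    · exact ⟨r, s, h, (List.mem_singleton.1 hs).symm⟩
    · exact (List.not_mem_nil hs).elim
  · rintro ⟨r, s, h, rfl⟩
    refine ⟨r, List.mem_finRange r, List.mem_flatMap.2 ⟨s, List.mem_finRange s, ?_⟩⟩
    rw [dif_pos h]
    exact List.mem_singleton.2 rfl

/-- The object of a node. -/
noncomputable def obAt (i : p.graph.Node) : C := (p.ob_surj (p.nodeVal i) (p.nodeVal_lt i)).choose

theorem ob_obAt (i : p.graph.Node) : p.ob (p.obAt i) = p.nodeVal i :=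
  (p.ob_surj (p.nodeVal i) (p.nodeVal_lt i)).choose_spec

theorem obAt_node (x : C) : p.obAt (p.node x) = x := p.ob_inj (p.ob_obAt _)

theorem node_obAt (i : p.graph.Node) : p.node (p.obAt i) = i := p.node_ext (p.ob_obAt i)

/-- The arrow of an edge. -/
noncomputable def arAt {i j : p.graph.Node} (e : i ⟶ j) : p.obAt i ⟶ p.obAt j :=
  (p.exists_hom e.1.2 ((p.src_edge e).trans (p.ob_obAt i).symm)
    ((p.tgt_edge e).trans (p.ob_obAt j).symm)).choose

theorem ar_arAt {i j : p.graph.Node} (e : i ⟶ j) : p.ar (p.arAt e) = Fin.val e.1 :=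
  (p.exists_hom e.1.2 ((p.src_edge e).trans (p.ob_obAt i).symm)
    ((p.tgt_edge e).trans (p.ob_obAt j).symm)).choose_spec

/-- The evaluation of paths. -/
noncomputable def evalPath : Paths p.graph.Node ⥤ C := Paths.lift ⟨p.obAt, fun e => p.arAt e⟩

/-- The number of the arrow that a path denotes. -/
noncomputable def pathAr {i j : p.graph.Node} (q : Quiver.Path i j) : ℕ :=
  p.ar (p.evalPath.map (X := (i : Paths p.graph.Node)) (Y := (j : Paths p.graph.Node)) q)

theorem pathAr_nil (i : p.graph.Node) :
    p.pathAr (Quiver.Path.nil : Quiver.Path i i) = t.ident (p.nodeVal i) := by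
  rw [← ob_obAt, ident_ob]
  rfl

theorem pathAr_cons {i j k : p.graph.Node} (q : Quiver.Path i j) (e : j ⟶ k) :
    p.pathAr (q.cons e) = t.comp (p.pathAr q) (Fin.val e.1) := by
  rw [← ar_arAt]
  exact (p.comp_ar _ _).symm

theorem pathAr_single {i j : p.graph.Node} (e : i ⟶ j) :
    p.pathAr (Quiver.Path.nil.cons e) = Fin.val e.1 :=
  (congrArg p.ar (Category.id_comp (p.arAt e))).trans (p.ar_arAt e)

theorem pathAr_eqn {E : PathEquation p.graph} (hE : E ∈ p.sig.eqns) :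
    p.pathAr E.lhs = p.pathAr E.rhs := by
  obtain ⟨x, rfl⟩ | ⟨r, s, h, rfl⟩ := p.mem_eqns.1 hE
  · exact (p.pathAr_single _).trans (p.pathAr_nil x).symm
  · refine (p.pathAr_cons _ _).trans ?_
    exact (congrArg (t.comp · s) (p.pathAr_single _)).trans
      (p.pathAr_single (p.compEdge r s h)).symm

/-- The functor from the schema of the signature of a table to the category that the table
describes. It is fully faithful and bijective on objects. -/
noncomputable def ofSchema : p.sig.Schema ⥤ C :=
  CategoryTheory.Quotient.lift p.sig.rel p.evalPath (by
    rintro x y _ _ ⟨E, hE, rfl, rfl, rfl, rfl⟩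
    exact p.ar_inj _ _ (p.pathAr_eqn hE))

theorem rel_of_eqn {E : PathEquation p.graph} (hE : E ∈ p.sig.eqns) :
    p.sig.pathHom E.lhs = p.sig.pathHom E.rhs :=
  CategoryTheory.Quotient.sound _ ⟨E, hE, rfl, rfl, rfl, rfl⟩

/-- Appending an edge to a path composes with the arrow of that edge. -/
theorem pathHom_cons (S : Signature) {x y z : S.Node} (q : Quiver.Path x y) (e : y ⟶ z) :
    S.pathHom (q.cons e) = S.pathHom q ≫ S.pathHom (Quiver.Path.nil.cons e) :=
  (CategoryTheory.Quotient.functor S.rel).map_comp (X := (x : Paths S.Node)) q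
    (Quiver.Path.nil.cons e : Quiver.Path y z)

/-- Each path equals the edge of the arrow that it denotes. -/
theorem pathHom_eq {i j : p.graph.Node} (q : Quiver.Path i j) :
    ∀ (e : i ⟶ j), p.pathAr q = Fin.val e.1 →
      p.sig.pathHom q = p.sig.pathHom (Quiver.Path.nil.cons e) := by
  induction q with
  | nil =>
    intro e h
    rw [pathAr_nil] at h
    have h1 := p.rel_of_eqn (p.mem_eqns.2 (Or.inl ⟨i, rfl⟩))
    refine h1.symm.trans ?_
    exact congrArg (fun e => p.sig.pathHom (Quiver.Path.nil.cons e)) (p.edge_ext h)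
  | @cons j k q e' ih =>
    intro e h
    rw [pathAr_cons] at h
    obtain ⟨l, hl⟩ : ∃ l : i ⟶ j, p.pathAr q = Fin.val l.1 :=
      ⟨p.edgeAt (p.pathAr q) (p.ar_lt _) ((p.src_ar _).trans (p.ob_obAt i))
        ((p.tgt_ar _).trans (p.ob_obAt j)), rfl⟩
    refine (pathHom_cons p.sig q e').trans ?_
    refine (congrArg (· ≫ p.sig.pathHom (Quiver.Path.nil.cons e')) (ih l hl)).trans ?_
    refine (pathHom_cons p.sig (Quiver.Path.nil.cons l) e').symm.trans ?_
    rw [hl] at h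
    have hc : t.tgt (Fin.val l.1) = t.src (Fin.val e'.1) :=
      (p.tgt_edge l).trans (p.src_edge e').symm
    have h1 := p.rel_of_eqn (p.mem_eqns.2 (Or.inr ⟨l.1, e'.1, hc, rfl⟩))
    obtain ⟨l, rfl, rfl⟩ := l
    obtain ⟨e', h2, rfl⟩ := e'
    refine h1.trans ?_
    exact congrArg (fun e => p.sig.pathHom (Quiver.Path.nil.cons e)) (p.edge_ext h)

/-- The node of an object of the schema. -/
def nodeOf {S : Signature} (x : S.Schema) : S.Node := x.as

theorem exists_pathHom (S : Signature) {x y : S.Schema} (f : x ⟶ y) :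
    ∃ q : Quiver.Path (nodeOf x) (nodeOf y), S.pathHom q = f :=
  (CategoryTheory.Quotient.functor S.rel).map_surjective f

theorem exists_edge {x y : p.sig.Schema} (f : x ⟶ y) :
    ∃ e : nodeOf x ⟶ nodeOf y, p.sig.pathHom (Quiver.Path.nil.cons e) = f := by
  obtain ⟨q, rfl⟩ := exists_pathHom _ f
  let l : nodeOf x ⟶ nodeOf y :=
      p.edgeAt (p.pathAr q) (p.ar_lt _) ((p.src_ar _).trans (p.ob_obAt _))
        ((p.tgt_ar _).trans (p.ob_obAt _))
  exact ⟨l, (p.pathHom_eq q l rfl).symm⟩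

instance : p.ofSchema.Faithful where
  map_injective {x y} f g h := by
    obtain ⟨e, rfl⟩ := p.exists_edge f
    obtain ⟨e', rfl⟩ := p.exists_edge g
    have h1 : p.pathAr (Quiver.Path.nil.cons e) = p.pathAr (Quiver.Path.nil.cons e') :=
      congrArg p.ar h
    exact congrArg (fun e => p.sig.pathHom (Quiver.Path.nil.cons e))
      (p.edge_ext ((p.pathAr_single e).symm.trans (h1.trans (p.pathAr_single e'))))

instance : p.ofSchema.Full where
  map_surjective {x y} f := by
    let l : nodeOf x ⟶ nodeOf y :=
        p.edgeAt (p.ar f) (p.ar_lt _) ((p.src_ar _).trans (p.ob_obAt _))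
          ((p.tgt_ar _).trans (p.ob_obAt _))
    exact ⟨p.sig.pathHom (Quiver.Path.nil.cons l), p.ar_inj _ _ (p.pathAr_single l)⟩

theorem bijective_ofSchema : Function.Bijective p.ofSchema.obj := by
  constructor
  · rintro ⟨x⟩ ⟨y⟩ h
    have h1 : p.node (p.obAt x) = p.node (p.obAt y) := congrArg p.node h
    exact congrArg p.sig.ob ((p.node_obAt x).symm.trans (h1.trans (p.node_obAt y)))
  · intro x
    exact ⟨⟨p.node x⟩, p.obAt_node x⟩

instance : p.ofSchema.IsEquivalence where
  essSurj := ⟨fun x => ⟨⟨p.node x⟩, ⟨eqToIso (p.obAt_node x)⟩⟩⟩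

theorem isFinite : p.sig.IsFinite := fun x y =>
  Finite.of_injective (fun f : x ⟶ y => (⟨p.ar (p.ofSchema.map f), p.ar_lt _⟩ : Fin t.numAr))
    fun _ _ h => p.ofSchema.map_injective (p.ar_inj _ _ (congrArg Fin.val h))

/-- The strict inverse of `ofSchema`. -/
def toSchema : C ⥤ p.sig.Schema where
  obj x := p.sig.ob (p.node x)
  map k := p.sig.pathHom (Quiver.Path.nil.cons (p.edge k))
  map_id x := (p.pathHom_eq (Quiver.Path.nil : Quiver.Path (p.node x) (p.node x))
    (p.edge (𝟙 x))
    ((p.pathAr_nil _).trans (p.ident_ob x))).symm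
  map_comp {x y z} k l := by
    refine (p.pathHom_eq ((Quiver.Path.nil.cons (p.edge k)).cons (p.edge l)) (p.edge (k ≫ l))
      ?_).symm.trans (pathHom_cons _ _ _)
    exact (p.pathAr_cons _ _).trans ((congrArg (t.comp · (p.ar l)) (p.pathAr_single _)).trans
      (p.comp_ar k l))

theorem toSchema_ofSchema : p.toSchema ⋙ p.ofSchema = 𝟭 C := by
  refine CategoryTheory.Functor.ext (fun x => p.obAt_node x) fun x y k => ?_
  apply p.ar_inj
  exact (p.pathAr_single (p.edge k)).trans (p.ar_eqToHom_comp _ k _).symm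

end Pres

/-! ### Codes of signatures and of morphisms -/

/-- Decidable equality with values in `Bool`, named so that rules for primitive recursive functions
can refer to it. -/
def eqb {α : Type*} [DecidableEq α] (a b : α) : Bool := decide (a = b)

theorem eqb_iff {α : Type*} [DecidableEq α] {a b : α} : eqb a b = true ↔ a = b := decide_eq_true_iff

theorem List.ofFn_eq_map_range {α : Type*} {n : ℕ} (f : Fin n → α) (g : ℕ → α)
    (h : ∀ i, f i = g i) : List.ofFn f = (List.range n).map g := by
  rw [List.ofFn_eq_map, ← List.map_coe_finRange_eq_range, List.map_map]
  exact List.map_congr_left fun i _ => h i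

theorem List.getD_ofFn {α : Type*} {n : ℕ} (f : Fin n → α) (i : Fin n) (d : α) :
    (List.ofFn f).getD i d = f i := by
  simp

theorem List.getD_map_range {α : Type*} {n i : ℕ} (g : ℕ → α) (h : i < n) (d : α) :
    ((List.range n).map g).getD i d = g i := by
  simp [h]

/-- The number of a node of a graph. -/
def FinGraph.nodeVal {G : FinGraph} (x : G.Node) : ℕ := Fin.val (n := G.numNodes) x

theorem FinGraph.node_ext {G : FinGraph} {x y : G.Node}
    (h : FinGraph.nodeVal x = FinGraph.nodeVal y) : x = y :=
  Fin.ext (n := G.numNodes) h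

namespace CatTable

/-- The code of the equations of the signature of a table. -/
def eqnsCode (t : CatTable) : List (ℕ × List ℕ × List ℕ) :=
  (List.range t.numOb).map (fun x => (x, [t.ident x], [])) ++
    (List.range t.numAr).flatMap fun r => (List.range t.numAr).flatMap fun s =>
      bif eqb (t.tgt r) (t.src s) then [(t.src r, [r, s], [t.comp r s])] else []

/-- The code of the signature of a table, with attributes. -/
def sigCode {τ : Type u} (t : CatTable) (attrs : List (ℕ × τ)) : SignatureCode τ :=
  (t.numOb, t.2.1, t.eqnsCode, attrs)

end CatTable

theorem pathHom_comp (S : Signature) {x y z : S.Node} (q : Quiver.Path x y)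
    (q' : Quiver.Path y z) : S.pathHom (q.comp q') = S.pathHom q ≫ S.pathHom q' :=
  (CategoryTheory.Quotient.functor S.rel).map_comp (X := (x : Paths S.Node)) q q'

namespace Pres

variable {t : CatTable} {C : Type} [Category.{0} C] (p : Pres t C)

/-- The code of the equations of the signature of a table depends on the table only, not on the
category that it describes. -/
theorem code_eqns : (p.sig.eqns.map fun E =>
    (Fin.val (n := p.sig.graph.numNodes) E.source, pathCode E.lhs, pathCode E.rhs)) =
      t.eqnsCode := by
  unfold CatTable.eqnsCode
  refine List.map_append.trans (congrArg₂ (· ++ ·) ?_ ?_)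
  · rw [← List.map_coe_finRange_eq_range]
    refine List.map_map.trans (Eq.trans ?_ (List.map_map (l := List.finRange t.numOb)
      (f := Fin.val) (g := fun x => (x, [t.ident x], ([] : List ℕ)))).symm)
    rfl
  · refine List.map_flatMap.trans ?_
    rw [← List.map_coe_finRange_eq_range, List.flatMap_map]
    refine List.flatMap_congr fun r _ => List.map_flatMap.trans ?_
    rw [List.flatMap_map]
    refine List.flatMap_congr fun s _ => ?_
    by_cases h : t.tgt r = t.src s
    · rw [dif_pos h, eqb_iff.2 h]
      rfl
    · rw [dif_neg h, Bool.eq_false_iff.2 (mt eqb_iff.1 h)]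
      rfl

/-- The signature of a table, with attributes. -/
def typedSig {τ : Type u} {k : ℕ} (attrNode : Fin k → p.sig.Node) (attrType : Fin k → τ) :
    TypedSignature τ where
  toSignature := p.sig
  numAttrs := k
  attrNode := attrNode
  attrType := attrType

theorem code_typedSig {τ : Type u} {k : ℕ} (attrNode : Fin k → p.sig.Node)
    (attrType : Fin k → τ) : (p.typedSig attrNode attrType).code =
      t.sigCode (List.ofFn fun a => (p.nodeVal (attrNode a), attrType a)) := by
  refine Prod.ext rfl (Prod.ext ?_ (Prod.ext p.code_eqns rfl))
  refine List.ext_getElem List.length_ofFn fun i h h' => (List.getElem_ofFn _).trans ?_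
  have key : ∀ (l : List (ℕ × ℕ)) (i : ℕ) (h : i < l.length),
      ((l.getD i (0, 0)).1, (l.getD i (0, 0)).2) = l[i] := by
    intro l i h
    rw [List.getD_eq_getElem _ _ h]
  exact key t.2.1 i h'

variable {T : Signature} (Φ : C ⥤ T.Schema) (W : ℕ → List ℕ)

/-- The words `W` describe the action of `Φ` on arrows: `W r` is the code of a path that represents
the image of the arrow of number `r`. -/
def IsWords : Prop := ∀ {x y : C} (k : x ⟶ y),
  ∃ q : Quiver.Path (nodeOf (Φ.obj x)) (nodeOf (Φ.obj y)),
    T.pathHom q = Φ.map k ∧ pathCode q = W (p.ar k)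

variable {Φ W} (hW : p.IsWords Φ W)

/-- The action of the words on paths represents the action of `Φ` on the arrows of the paths. -/
theorem pathHom_lift {x y : p.sig.Node} (q : Quiver.Path x y) :
    T.pathHom ((Paths.lift (C := Paths T.Node) ⟨fun x => nodeOf (Φ.obj (p.obAt x)),
      fun e => (hW (p.arAt e)).choose⟩).map (X := (x : Paths p.sig.Node))
        (Y := (y : Paths p.sig.Node)) q) = Φ.map (p.evalPath.map q) := by
  induction q with
  | nil => exact (Φ.map_id _).symm
  | cons q e ih =>
    refine (pathHom_comp T _ _).trans ?_
    refine Eq.trans ?_ (Φ.map_comp _ _).symm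
    exact congrArg₂ (· ≫ ·) ih (hW (p.arAt e)).choose_spec.1

/-- The signature morphism of a functor, along the given words. -/
noncomputable def ofFunctor : SignatureMorphism p.sig T where
  onNode x := nodeOf (Φ.obj (p.obAt x))
  onEdge e := (hW (p.arAt e)).choose
  respects E hE := by
    refine (p.pathHom_lift hW E.lhs).trans (Eq.trans ?_ (p.pathHom_lift hW E.rhs).symm)
    exact congrArg Φ.map (p.ar_inj _ _ (p.pathAr_eqn hE))

theorem functor_ofFunctor : (p.ofFunctor hW).functor = p.ofSchema ⋙ Φ := by
  apply CategoryTheory.Quotient.lift_unique'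
  refine CategoryTheory.Functor.ext (fun _ => rfl) fun x y q => ?_
  refine Eq.trans ?_ ((Category.id_comp _).trans (Category.comp_id _)).symm
  exact p.pathHom_lift hW q

end Pres

/-! ### Codes of composites -/

/-- The code of the composite of two morphisms. -/
def compCode (F G : MorphismCode) : MorphismCode :=
  (F.1.map fun x => G.1.getD x 0, F.2.1.map fun w => w.flatMap fun e => G.2.1.getD e [],
    F.2.2.map fun a => G.2.2.getD a 0)

/-- The image of a word under a morphism. -/
def wordMap (F : MorphismCode) (w : List ℕ) : List ℕ := w.flatMap fun e => F.2.1.getD e []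

section

variable {τ : Type u} {S T U : TypedSignature τ} (F : TypedMorphism S T)

theorem TypedMorphism.code_node (x : S.Node) :
    F.code.1.getD (FinGraph.nodeVal x) 0 = FinGraph.nodeVal (F.onNode x) :=
  List.getD_ofFn _ _ _

theorem TypedMorphism.code_edge {x y : S.Node} (e : x ⟶ y) :
    F.code.2.1.getD (Fin.val e.1) [] = pathCode (F.onEdge e) := by
  obtain ⟨e, rfl, rfl⟩ := e
  exact List.getD_ofFn _ _ _

theorem TypedMorphism.code_attr (a : Fin S.numAttrs) :
    F.code.2.2.getD (Fin.val a) 0 = Fin.val (F.onAttr a) :=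
  List.getD_ofFn _ _ _

theorem pathCode_comp {G : FinGraph} {x y z : G.Node} (q : Quiver.Path x y)
    (q' : Quiver.Path y z) : pathCode (q.comp q') = pathCode q ++ pathCode q' := by
  induction q' with
  | nil => exact (List.append_nil _).symm
  | cons q' e ih =>
    rw [Quiver.Path.comp_cons, pathCode, pathCode, ih, List.append_assoc]

theorem TypedMorphism.pathCode_onPath {x y : S.Node} (q : Quiver.Path x y) :
    pathCode (F.onPath.map (X := (x : Paths S.Node)) (Y := (y : Paths S.Node)) q) =
      wordMap F.code (pathCode q) := by
  induction q with
  | nil => rfl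
  | cons q e ih =>
    refine (pathCode_comp _ _).trans
      ((congrArg (· ++ pathCode (F.onEdge e)) ih).trans ?_)
    rw [wordMap, wordMap, pathCode, List.flatMap_append, List.flatMap_singleton, code_edge]

theorem TypedMorphism.code_comp (G : TypedMorphism T U) :
    (F.comp G).code = compCode F.code G.code := by
  refine Prod.ext ?_ (Prod.ext ?_ ?_)
  · refine Eq.trans ?_ List.map_ofFn.symm
    exact congrArg List.ofFn (funext fun x => (G.code_node (F.onNode x)).symm)
  · refine Eq.trans ?_ List.map_ofFn.symm
    exact congrArg List.ofFn (funext fun e => G.pathCode_onPath _)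
  · refine Eq.trans ?_ List.map_ofFn.symm
    exact congrArg List.ofFn (funext fun a => (G.code_attr (F.onAttr a)).symm)

end

/-! ### Words and paths -/

/-- The node that the word `w` reaches from `x`, with `none` if `w` is not a path. -/
def walk (edges : List (ℕ × ℕ)) (x : ℕ) (w : List ℕ) : Option ℕ :=
  w.foldl (fun o e => o.bind fun y =>
    edges[e]?.bind fun st => bif eqb st.1 y then some st.2 else none) (some x)

theorem walk_append (edges : List (ℕ × ℕ)) (x : ℕ) (w : List ℕ) (e : ℕ) :
    walk edges x (w ++ [e]) = (walk edges x w).bind fun y =>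
      edges[e]?.bind fun st => bif eqb st.1 y then some st.2 else none := by
  unfold walk
  rw [List.foldl_append]
  rfl

/-- The edges of a graph as a list. -/
def FinGraph.edges (G : FinGraph) : List (ℕ × ℕ) :=
  List.ofFn fun e => ((G.src e).val, (G.tgt e).val)

theorem FinGraph.length_edges (G : FinGraph) : G.edges.length = G.numEdges := List.length_ofFn

theorem FinGraph.getElem?_edges {G : FinGraph} {x y : G.Node} (e : x ⟶ y) :
    G.edges[Fin.val e.1]? = some (FinGraph.nodeVal x, FinGraph.nodeVal y) := by
  obtain ⟨e, rfl, rfl⟩ := e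
  simp [edges, nodeVal]

theorem walk_pathCode {G : FinGraph} {x y : G.Node} (q : Quiver.Path x y) :
    walk G.edges (FinGraph.nodeVal x) (pathCode q) = some (FinGraph.nodeVal y) := by
  induction q with
  | nil => rfl
  | cons q e ih =>
    rw [pathCode, walk_append, ih, Option.bind_some, FinGraph.getElem?_edges, Option.bind_some,
      eqb_iff.2 rfl]
    rfl

/-- A word along which the walk from `x` succeeds is the code of a path. -/
theorem exists_path {G : FinGraph} (x : G.Node) (w : List ℕ) :
    ∀ n, walk G.edges (FinGraph.nodeVal x) w = some n →
      ∃ (y : G.Node) (q : Quiver.Path x y), pathCode q = w ∧ FinGraph.nodeVal y = n := by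
  induction w using List.reverseRecOn with
  | nil =>
    intro n h
    exact ⟨x, .nil, rfl, Option.some.inj h⟩
  | append_singleton w e ih =>
    intro n h
    rw [walk_append] at h
    obtain ⟨m, hm, h⟩ := Option.bind_eq_some_iff.1 h
    obtain ⟨y, q, rfl, rfl⟩ := ih m hm
    obtain ⟨⟨s, t⟩, hst, h⟩ := Option.bind_eq_some_iff.1 h
    obtain ⟨he, h1⟩ := List.getElem?_eq_some_iff.1 hst
    have he' : e < G.numEdges := by simpa [FinGraph.edges] using he
    have h2 : ((G.src ⟨e, he'⟩).val, (G.tgt ⟨e, he'⟩).val) = (s, t) := by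
      simpa [FinGraph.edges] using h1
    obtain ⟨rfl, rfl⟩ := Prod.mk.inj h2
    by_cases h3 : (G.src ⟨e, he'⟩).val = FinGraph.nodeVal y
    · dsimp only at h
      rw [eqb_iff.2 h3] at h
      have hy : G.src ⟨e, he'⟩ = y := Fin.ext h3
      exact ⟨G.tgt ⟨e, he'⟩, q.cons ⟨⟨e, he'⟩, hy, rfl⟩, rfl, Option.some.inj h⟩
    · dsimp only at h
      rw [Bool.eq_false_iff.2 (mt eqb_iff.1 h3)] at h
      exact (Option.some_ne_none _ h.symm).elim

theorem pathCode_injective {G : FinGraph} {x y : G.Node} (q : Quiver.Path x y) :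
    ∀ {y' : G.Node} (q' : Quiver.Path x y'), pathCode q = pathCode q' →
      ∃ h : y = y', q.cast rfl h = q' := by
  induction q with
  | nil =>
    intro y' q' h
    cases q' with
    | nil => exact ⟨rfl, rfl⟩
    | cons q' e' => exact (List.append_ne_nil_of_right_ne_nil _ (List.cons_ne_nil _ _) h.symm).elim
  | cons q e ih =>
    intro y' q' h
    cases q' with
    | nil => exact (List.append_ne_nil_of_right_ne_nil _ (List.cons_ne_nil _ _) h).elim
    | cons q' e' =>
      rw [pathCode, pathCode] at h
      obtain ⟨h1, h2⟩ := List.append_inj' h rfl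
      obtain ⟨rfl, rfl⟩ := ih q' h1
      obtain ⟨e, rfl, rfl⟩ := e
      obtain ⟨e', h3, rfl⟩ := e'
      obtain rfl : e = e' := Fin.ext (List.cons.inj h2).1
      exact ⟨rfl, rfl⟩

theorem eq_of_pathCode {G : FinGraph} {x y : G.Node} {q q' : Quiver.Path x y}
    (h : pathCode q = pathCode q') : q = q' := by
  obtain ⟨_, rfl⟩ := pathCode_injective q q' h
  rfl

/-- A path splits where its code does. -/
theorem exists_path_append {G : FinGraph} {x z : G.Node} (q : Quiver.Path x z) (u v : List ℕ)
    (h : pathCode q = u ++ v) : ∃ (y : G.Node) (q₁ : Quiver.Path x y) (q₂ : Quiver.Path y z),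
      pathCode q₁ = u ∧ pathCode q₂ = v ∧ q₁.comp q₂ = q := by
  induction q generalizing v with
  | nil =>
    obtain ⟨rfl, rfl⟩ := List.append_eq_nil_iff.1 h.symm
    exact ⟨x, .nil, .nil, rfl, rfl, rfl⟩
  | cons q e ih =>
    rcases List.eq_nil_or_concat v with rfl | ⟨v, e', rfl⟩
    · exact ⟨_, q.cons e, .nil, h.trans (List.append_nil u), rfl, rfl⟩
    · rw [pathCode, List.concat_eq_append, ← List.append_assoc] at h
      obtain ⟨h1, h2⟩ := List.append_inj' h rfl
      obtain ⟨y, q₁, q₂, rfl, rfl, rfl⟩ := ih v h1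
      exact ⟨y, q₁, q₂.cons e, rfl, by rw [pathCode, h2, List.concat_eq_append], rfl⟩

/-! ### Derivations of path equations -/

/-- A step of a derivation, the replacement of one side of an equation by the other inside a word:
the part before, the equation (start node, side to be replaced, other side), the part after. -/
abbrev DerivationStep : Type := List ℕ × (ℕ × List ℕ × List ℕ) × List ℕ

/-- The step `s` applies to the word `w` that starts at `a`: it splits `w` accordingly, and its
equation is among the given ones, in either direction, and starts where the first part ends. -/
def stepValid (edges : List (ℕ × ℕ)) (eqns : List (ℕ × List ℕ × List ℕ)) (a : ℕ) (w : List ℕ)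
    (s : DerivationStep) : Bool :=
  eqb w (s.1 ++ s.2.1.2.1 ++ s.2.2) &&
    (eqns.any (fun E => eqb E s.2.1) || eqns.any fun E => eqb E (s.2.1.1, s.2.1.2.2, s.2.1.2.1)) &&
    eqb (walk edges a s.1) (some s.2.1.1)

/-- The word that a chain of steps reaches from `w`, with `none` if a step does not apply. -/
def derive (edges : List (ℕ × ℕ)) (eqns : List (ℕ × List ℕ × List ℕ)) (a : ℕ) (w : List ℕ)
    (l : List DerivationStep) : Option (List ℕ) :=
  l.foldl (fun o s => o.bind fun w =>
    bif stepValid edges eqns a w s then some (s.1 ++ s.2.1.2.2 ++ s.2.2) else none) (some w)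

/-- The equations of a signature as a list. -/
def Signature.eqnsCode (S : Signature) : List (ℕ × List ℕ × List ℕ) :=
  S.eqns.map fun E => (Fin.val (n := S.graph.numNodes) E.source, pathCode E.lhs, pathCode E.rhs)

theorem derive_append (edges : List (ℕ × ℕ)) (eqns : List (ℕ × List ℕ × List ℕ)) (a : ℕ)
    (w : List ℕ) (l l' : List DerivationStep) :
    derive edges eqns a w (l ++ l') =
      (derive edges eqns a w l).bind fun w' => derive edges eqns a w' l' := by
  have key : ∀ (l' : List DerivationStep) (o : Option (List ℕ)),
      l'.foldl (fun o s => o.bind fun w =>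
      bif stepValid edges eqns a w s then some (s.1 ++ s.2.1.2.2 ++ s.2.2) else none) o =
      o.bind fun w' => derive edges eqns a w' l' := by
    rintro l' (_ | w')
    · induction l' with
      | nil => rfl
      | cons s l' ih => exact ih
    · rfl
  unfold derive
  rw [List.foldl_append]
  exact key l' _

section

variable {S : Signature}

theorem mem_eqnsCode {c : ℕ × List ℕ × List ℕ} : c ∈ S.eqnsCode ↔ ∃ E ∈ S.eqns,
    (FinGraph.nodeVal E.source, pathCode E.lhs, pathCode E.rhs) = c := List.mem_map

theorem pathHom_eqn {E : PathEquation S.graph} (hE : E ∈ S.eqns) :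
    S.pathHom E.lhs = S.pathHom E.rhs :=
  CategoryTheory.Quotient.sound _ ⟨E, hE, rfl, rfl, rfl, rfl⟩

theorem stepValid_iff {a : ℕ} {w : List ℕ} {s : DerivationStep} :
    stepValid S.graph.edges S.eqnsCode a w s = true ↔
      w = s.1 ++ s.2.1.2.1 ++ s.2.2 ∧
      (s.2.1 ∈ S.eqnsCode ∨ (s.2.1.1, s.2.1.2.2, s.2.1.2.1) ∈ S.eqnsCode) ∧
      walk S.graph.edges a s.1 = some s.2.1.1 := by
  unfold stepValid
  simp only [Bool.and_eq_true, Bool.or_eq_true, List.any_eq_true, eqb_iff, and_assoc]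
  simp

theorem pathHom_stepValid {x y : S.Node} (q : Quiver.Path x y) {s : DerivationStep}
    (h : stepValid S.graph.edges S.eqnsCode (FinGraph.nodeVal x) (pathCode q) s = true) :
    ∃ q' : Quiver.Path x y, pathCode q' = s.1 ++ s.2.1.2.2 ++ s.2.2 ∧
      S.pathHom q' = S.pathHom q := by
  obtain ⟨u, ⟨n, l, r⟩, v⟩ := s
  obtain ⟨h1, h2, h3⟩ := stepValid_iff.1 h
  dsimp only at h1 h2 h3 ⊢
  rw [List.append_assoc] at h1
  obtain ⟨z, q₁, q₂, rfl, h4, rfl⟩ := exists_path_append q u (l ++ v) h1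
  obtain ⟨z', q₃, q₄, rfl, rfl, rfl⟩ := exists_path_append q₂ l v h4
  have hz : n = FinGraph.nodeVal z := Option.some.inj (h3.symm.trans (walk_pathCode q₁))
  subst hz
  obtain ⟨q₅, h5, h6⟩ :
      ∃ q₅ : Quiver.Path z z', pathCode q₅ = r ∧ S.pathHom q₅ = S.pathHom q₃ := by
    rcases h2 with h2 | h2
    · obtain ⟨E, hE, h7⟩ := mem_eqnsCode.1 h2
      obtain ⟨h8, h9, rfl⟩ : _ ∧ _ ∧ _ := by simpa using h7
      obtain ⟨x', y', lhs, rhs⟩ := E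
      obtain rfl := FinGraph.node_ext h8
      obtain ⟨rfl, rfl⟩ := pathCode_injective _ _ h9
      exact ⟨rhs, rfl, (pathHom_eqn hE).symm⟩
    · obtain ⟨E, hE, h7⟩ := mem_eqnsCode.1 h2
      obtain ⟨h8, rfl, h9⟩ : _ ∧ _ ∧ _ := by simpa using h7
      obtain ⟨x', y', lhs, rhs⟩ := E
      obtain rfl := FinGraph.node_ext h8
      obtain ⟨rfl, rfl⟩ := pathCode_injective _ _ h9
      exact ⟨lhs, rfl, pathHom_eqn hE⟩
  refine ⟨q₁.comp (q₅.comp q₄), ?_, ?_⟩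
  · rw [pathCode_comp, pathCode_comp, h5, List.append_assoc]
  · rw [pathHom_comp, pathHom_comp, pathHom_comp, pathHom_comp, h6]

/-- Soundness of derivations: they lead from a path to an equivalent path. -/
theorem pathHom_derive {x y : S.Node} (l : List DerivationStep) : ∀ (q : Quiver.Path x y)
    {w : List ℕ}, derive S.graph.edges S.eqnsCode (FinGraph.nodeVal x) (pathCode q) l = some w →
    ∃ q' : Quiver.Path x y, pathCode q' = w ∧ S.pathHom q' = S.pathHom q := by
  induction l with
  | nil =>
    intro q w h
    exact ⟨q, Option.some.inj h, rfl⟩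
  | cons s l ih =>
    intro q w h
    rw [← List.singleton_append, derive_append] at h
    obtain ⟨w', h1, h2⟩ := Option.bind_eq_some_iff.1 h
    have h3 : (bif stepValid S.graph.edges S.eqnsCode (FinGraph.nodeVal x) (pathCode q) s then
      some (s.1 ++ s.2.1.2.2 ++ s.2.2) else none) = some w' := h1
    cases h4 : stepValid S.graph.edges S.eqnsCode (FinGraph.nodeVal x) (pathCode q) s with
    | false =>
      rw [h4] at h3
      exact (Option.some_ne_none _ h3.symm).elim
    | true =>
      rw [h4] at h3
      obtain ⟨q', h5, h6⟩ := pathHom_stepValid q h4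
      obtain ⟨q'', h7, h8⟩ := ih q' (h5.symm ▸ (Option.some.inj h3).symm ▸ h2)
      exact ⟨q'', h7, h8.trans h6⟩

end

section

variable {S : Signature}

/-- Completeness of derivations: equivalent paths are connected by one, since the congruence that
the equations generate is the equivalence relation generated by single replacements. -/
theorem exists_derive {x y : S.Node} {q q' : Quiver.Path x y} (h : S.pathHom q = S.pathHom q') :
    ∃ l, derive S.graph.edges S.eqnsCode (FinGraph.nodeVal x) (pathCode q) l =
      some (pathCode q') := by
  have h1 : Relation.ReflTransGen (Relation.SymmGen (@HomRel.CompClosure (Paths S.Node) _ S.rel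
      (x : Paths S.Node) (y : Paths S.Node))) q q' := by
    rw [Relation.EqvGen.reflTransGen_symmGen]
    exact (CategoryTheory.Quotient.functor_homRel_eq_compClosure_eqvGen S.rel _ _).1 h
  -- A valid step is a derivation, and each pair of the closure of the relation is a valid step.
  have step : ∀ (q₁ q₂ : Quiver.Path x y) (u : List ℕ) (E : ℕ × List ℕ × List ℕ) (v : List ℕ),
      pathCode q₁ = u ++ E.2.1 ++ v → pathCode q₂ = u ++ E.2.2 ++ v →
      (E ∈ S.eqnsCode ∨ (E.1, E.2.2, E.2.1) ∈ S.eqnsCode) →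
      walk S.graph.edges (FinGraph.nodeVal x) u = some E.1 →
      derive S.graph.edges S.eqnsCode (FinGraph.nodeVal x) (pathCode q₁) [(u, E, v)] =
        some (pathCode q₂) := by
    intro q₁ q₂ u E v h1 h2 h3 h4
    have h5 := (stepValid_iff (S := S) (a := FinGraph.nodeVal x) (w := pathCode q₁)
      (s := (u, E, v))).2 ⟨h1, h3, h4⟩
    change (bif stepValid S.graph.edges S.eqnsCode (FinGraph.nodeVal x) (pathCode q₁) (u, E, v) then
      some (u ++ E.2.2 ++ v) else none) = _
    rw [h5, h2]
    rfl
  have clos : ∀ q₁ q₂ : Quiver.Path x y, @HomRel.CompClosure (Paths S.Node) _ S.rel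
      (x : Paths S.Node) (y : Paths S.Node) q₁ q₂ → ∃ u E v,
      pathCode q₁ = u ++ E.2.1 ++ v ∧ pathCode q₂ = u ++ E.2.2 ++ v ∧ E ∈ S.eqnsCode ∧
      walk S.graph.edges (FinGraph.nodeVal x) u = some E.1 := by
    rintro _ _ ⟨a, b, f, _, _, g, ⟨E, hE, rfl, rfl, rfl, rfl⟩⟩
    refine ⟨pathCode (G := S.graph) (f : Quiver.Path x E.source),
      (FinGraph.nodeVal E.source, pathCode E.lhs, pathCode E.rhs),
      pathCode (G := S.graph) (g : Quiver.Path E.target y), ?_, ?_,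
      mem_eqnsCode.2 ⟨E, hE, rfl⟩, walk_pathCode (G := S.graph) _⟩
    · refine (pathCode_comp (G := S.graph) _ _).trans ?_
      rw [List.append_assoc]
      exact congrArg _ (pathCode_comp (G := S.graph) _ _)
    · refine (pathCode_comp (G := S.graph) _ _).trans ?_
      rw [List.append_assoc]
      exact congrArg _ (pathCode_comp (G := S.graph) _ _)
  clear h
  induction h1 with
  | refl => exact ⟨[], rfl⟩
  | tail _ h2 ih =>
    obtain ⟨l, hl⟩ := ih
    rcases h2 with h2 | h2
    · obtain ⟨u, E, v, h3, h4, h5, h6⟩ := clos _ _ h2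
      refine ⟨l ++ [(u, E, v)], ?_⟩
      rw [derive_append, hl]
      exact step _ _ u E v h3 h4 (Or.inl h5) h6
    · obtain ⟨u, E, v, h3, h4, h5, h6⟩ := clos _ _ h2
      refine ⟨l ++ [(u, (E.1, E.2.2, E.2.1), v)], ?_⟩
      rw [derive_append, hl]
      exact step _ _ u (E.1, E.2.2, E.2.1) v h4 h3 (Or.inr h5) h6

end

/-! ### Certificates of finite schemas -/

/-- The number of nodes, the edges and the equations of a signature. -/
abbrev RawSignature : Type := ℕ × List (ℕ × ℕ) × List (ℕ × List ℕ × List ℕ)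

/-- A certificate of the finiteness of a schema: source, target and normal form of each arrow;
identity of each node; composite of each arrow with each edge; derivations of the normal forms
of these composites. -/
abbrev SchemaCert : Type :=
  List (ℕ × ℕ × List ℕ) × List ℕ × List (List ℕ) × List (List (List DerivationStep))

/-- The finite data of a signature without attributes. -/
def Signature.raw (S : Signature) : RawSignature := (S.graph.numNodes, S.graph.edges, S.eqnsCode)

namespace SchemaCert

/-- Source, target and normal form of an arrow. -/
def rep (c : SchemaCert) (i : ℕ) : ℕ × ℕ × List ℕ := c.1.getD i (0, 0, [])

/-- The composite of an arrow with an edge; it has a meaning if the edge starts at the target of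
the arrow. -/
def act (c : SchemaCert) (i e : ℕ) : ℕ := (c.2.2.1.getD i []).getD e 0

/-- The composite of an arrow with a path. -/
def actWord (c : SchemaCert) (i : ℕ) (w : List ℕ) : ℕ := w.foldl c.act i

/-- The identity of a node. -/
def idt (c : SchemaCert) (x : ℕ) : ℕ := c.2.1.getD x 0

/-- The derivation of the normal form of the composite of an arrow with an edge. -/
def der (c : SchemaCert) (i e : ℕ) : List DerivationStep := (c.2.2.2.getD i []).getD e []

/-- Each node has an identity, with the empty word as normal form. -/
def checkIdt (s : RawSignature) (c : SchemaCert) : Bool :=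
  (List.range s.1).all fun x => eqb c.1[c.idt x]? (some (x, x, []))

/-- The normal form of each arrow is a path from its source to its target, the arrow is the
composite of the identity with its normal form, and its source is a node. -/
def checkRep (s : RawSignature) (c : SchemaCert) : Bool :=
  (List.range c.1.length).all fun i =>
    eqb (walk s.2.1 (c.rep i).1 (c.rep i).2.2) (some (c.rep i).2.1) &&
    eqb (c.actWord (c.idt (c.rep i).1) (c.rep i).2.2) i &&
    decide ((c.rep i).1 < s.1)

/-- The composites with edges are arrows with the right source and target, whose normal forms
are derived from those of the factors. -/
def checkAct (s : RawSignature) (c : SchemaCert) : Bool :=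
  (List.range c.1.length).all fun i => (List.range s.2.1.length).all fun e =>
    !eqb (s.2.1.getD e (0, 0)).1 (c.rep i).2.1 ||
      (decide (c.act i e < c.1.length) && eqb (c.rep (c.act i e)).1 (c.rep i).1 &&
        eqb (c.rep (c.act i e)).2.1 (s.2.1.getD e (0, 0)).2 &&
        eqb (derive s.2.1 s.2.2 (c.rep i).1 ((c.rep i).2.2 ++ [e]) (c.der i e))
          (some (c.rep (c.act i e)).2.2))

/-- The action of paths on arrows respects the equations. -/
def checkEqns (s : RawSignature) (c : SchemaCert) : Bool :=
  s.2.2.all fun E => (List.range c.1.length).all fun i =>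
    !eqb (c.rep i).2.1 E.1 || eqb (c.actWord i E.2.1) (c.actWord i E.2.2)

/-- The certificate is valid. -/
def check (s : RawSignature) (c : SchemaCert) : Bool :=
  checkIdt s c && checkRep s c && checkAct s c && checkEqns s c

/-- The table that a certificate describes, for a signature with `n` nodes. -/
def table (n : ℕ) (c : SchemaCert) : CatTable :=
  (n, c.1.map (fun r => (r.1, r.2.1)), c.2.1,
    (List.range c.1.length).map fun i => (List.range c.1.length).map fun j =>
      c.actWord i (c.rep j).2.2)

/-- The validity of a certificate for the signature `S`, in terms of the nodes, edges and equations
of `S`; `check` decides it. -/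
structure Valid (S : Signature) (c : SchemaCert) : Prop where
  idt_spec : ∀ x : S.Node, c.1[c.idt (FinGraph.nodeVal x)]? =
    some (FinGraph.nodeVal x, FinGraph.nodeVal x, [])
  walk_rep : ∀ i < c.1.length, walk S.graph.edges (c.rep i).1 (c.rep i).2.2 = some (c.rep i).2.1
  actWord_rep : ∀ i < c.1.length, c.actWord (c.idt (c.rep i).1) (c.rep i).2.2 = i
  src_lt : ∀ i < c.1.length, (c.rep i).1 < S.graph.numNodes
  act_spec : ∀ i < c.1.length, ∀ {x y : S.Node} (e : x ⟶ y), FinGraph.nodeVal x = (c.rep i).2.1 →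
    c.act i (Fin.val e.1) < c.1.length ∧ (c.rep (c.act i (Fin.val e.1))).1 = (c.rep i).1 ∧
    (c.rep (c.act i (Fin.val e.1))).2.1 = FinGraph.nodeVal y ∧
    derive S.graph.edges S.eqnsCode (c.rep i).1 ((c.rep i).2.2 ++ [Fin.val e.1])
      (c.der i (Fin.val e.1)) = some (c.rep (c.act i (Fin.val e.1))).2.2
  eqns_spec : ∀ E ∈ S.eqns, ∀ i < c.1.length, (c.rep i).2.1 = FinGraph.nodeVal E.source →
    c.actWord i (pathCode E.lhs) = c.actWord i (pathCode E.rhs)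

/-- The test decides validity. -/
theorem check_iff {S : Signature} {c : SchemaCert} : check S.raw c = true ↔ Valid S c := by
  have h1 : checkIdt S.raw c = true ↔ ∀ x : S.Node, c.1[c.idt (FinGraph.nodeVal x)]? =
      some (FinGraph.nodeVal x, FinGraph.nodeVal x, []) := by
    unfold checkIdt
    simp only [List.all_eq_true, List.mem_range, eqb_iff]
    exact ⟨fun h x => h _ (Fin.isLt (n := S.graph.numNodes) x),
      fun h x hx => h (⟨x, hx⟩ : Fin S.graph.numNodes)⟩
  have h2 : checkRep S.raw c = true ↔ ∀ i < c.1.length,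
      (walk S.graph.edges (c.rep i).1 (c.rep i).2.2 = some (c.rep i).2.1 ∧
      c.actWord (c.idt (c.rep i).1) (c.rep i).2.2 = i) ∧ (c.rep i).1 < S.graph.numNodes := by
    unfold checkRep
    simp only [List.all_eq_true, List.mem_range, eqb_iff, Bool.and_eq_true, decide_eq_true_iff]
    rfl
  have h3 : checkAct S.raw c = true ↔ ∀ i < c.1.length, ∀ {x y : S.Node} (e : x ⟶ y),
      FinGraph.nodeVal x = (c.rep i).2.1 →
    c.act i (Fin.val e.1) < c.1.length ∧ (c.rep (c.act i (Fin.val e.1))).1 = (c.rep i).1 ∧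
    (c.rep (c.act i (Fin.val e.1))).2.1 = FinGraph.nodeVal y ∧
    derive S.graph.edges S.eqnsCode (c.rep i).1 ((c.rep i).2.2 ++ [Fin.val e.1])
      (c.der i (Fin.val e.1)) = some (c.rep (c.act i (Fin.val e.1))).2.2 := by
    unfold checkAct
    simp only [List.all_eq_true, List.mem_range, eqb_iff, Bool.and_eq_true, decide_eq_true_iff,
      Bool.or_eq_true, Bool.not_eq_true', Bool.eq_false_iff, ne_eq, ← imp_iff_not_or, and_assoc]
    refine forall₂_congr fun i hi => ⟨fun h x y e hx => ?_, fun h e he => ?_⟩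
    · have h4 := h (Fin.val e.1) (e.1.2.trans_eq (FinGraph.length_edges S.graph).symm)
      have h5 : S.raw.2.1.getD (Fin.val e.1) (0, 0) =
          (FinGraph.nodeVal x, FinGraph.nodeVal y) := by
        rw [List.getD_eq_getElem?_getD]
        exact congrArg (Option.getD · (0, 0)) (FinGraph.getElem?_edges e)
      rw [h5] at h4
      exact h4 hx
    · obtain ⟨x, y, e, rfl⟩ : ∃ (x y : S.Node) (e' : x ⟶ y), Fin.val e'.1 = e :=
        ⟨S.graph.src ⟨e, he.trans_eq (FinGraph.length_edges S.graph)⟩, _, ⟨⟨e, _⟩, rfl, rfl⟩, rfl⟩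
      have h5 : S.raw.2.1.getD (Fin.val e.1) (0, 0) =
          (FinGraph.nodeVal x, FinGraph.nodeVal y) := by
        rw [List.getD_eq_getElem?_getD]
        exact congrArg (Option.getD · (0, 0)) (FinGraph.getElem?_edges e)
      rw [h5]
      exact fun hx => h e hx
  have h4 : checkEqns S.raw c = true ↔ ∀ E ∈ S.eqns, ∀ i < c.1.length,
      (c.rep i).2.1 = FinGraph.nodeVal E.source →
      c.actWord i (pathCode E.lhs) = c.actWord i (pathCode E.rhs) := by
    unfold checkEqns
    simp only [List.all_eq_true, List.mem_range, eqb_iff,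
      Bool.or_eq_true, Bool.not_eq_true', Bool.eq_false_iff, ne_eq, ← imp_iff_not_or]
    exact List.forall_mem_map
  unfold check
  rw [Bool.and_eq_true, Bool.and_eq_true, Bool.and_eq_true, h1, h2, h3, h4]
  exact ⟨fun ⟨⟨⟨a, b⟩, c⟩, d⟩ => ⟨a, fun i hi => (b i hi).1.1, fun i hi => (b i hi).1.2,
    fun i hi => (b i hi).2, c, d⟩, fun h => ⟨⟨⟨h.idt_spec, fun i hi => ⟨⟨h.walk_rep i hi,
    h.actWord_rep i hi⟩, h.src_lt i hi⟩⟩, h.act_spec⟩, h.eqns_spec⟩⟩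

end SchemaCert

namespace SchemaCert

namespace Valid

variable {S : Signature} {c : SchemaCert} (h : Valid S c)

/-- The entries of the certificate with a given target. -/
def Entry (S : Signature) (c : SchemaCert) (x : S.Node) : Type :=
  {i : ℕ // i < c.1.length ∧ (c.rep i).2.1 = FinGraph.nodeVal x}

/-- The action of the paths on the entries of a certificate. -/
def pathAction : Paths S.Node ⥤ Type :=
  Paths.lift ⟨fun x => Entry S c x, fun {x y} e => TypeCat.ofHom fun i : Entry S c x =>
    (⟨c.act i.1 (Fin.val e.1), (h.act_spec i.1 i.2.1 e i.2.2.symm).1,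
      (h.act_spec i.1 i.2.1 e i.2.2.symm).2.2.1⟩ : Entry S c y)⟩

theorem actWord_append (c : SchemaCert) (i : ℕ) (w w' : List ℕ) :
    c.actWord i (w ++ w') = c.actWord (c.actWord i w) w' := List.foldl_append

theorem pathAction_val {x y : S.Node} (q : Quiver.Path x y) (i : Entry S c x) :
    Subtype.val (p := fun i => i < c.1.length ∧ (c.rep i).2.1 = FinGraph.nodeVal y)
      (h.pathAction.map (X := (x : Paths S.Node)) (Y := (y : Paths S.Node)) q i) =
      c.actWord i.1 (pathCode q) := by
  induction q with
  | nil => rfl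
  | cons q e ih =>
    rw [pathCode, actWord_append, ← ih]
    rfl

/-- The action of the schema on the entries of a certificate. It plays the role of the Yoneda
embedding: the action on the identities separates arrows. -/
def action : S.Schema ⥤ Type :=
  CategoryTheory.Quotient.lift S.rel h.pathAction (by
    rintro x y _ _ ⟨E, hE, rfl, rfl, rfl, rfl⟩
    apply ConcreteCategory.hom_ext
    intro i
    apply Subtype.ext
    refine (h.pathAction_val E.lhs i).trans (Eq.trans ?_ (h.pathAction_val E.rhs i).symm)
    exact h.eqns_spec E hE i.1 i.2.1 i.2.2)

theorem rep_idt (h : Valid S c) (x : S.Node) : c.idt (FinGraph.nodeVal x) < c.1.length ∧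
    c.rep (c.idt (FinGraph.nodeVal x)) = (FinGraph.nodeVal x, FinGraph.nodeVal x, []) := by
  obtain ⟨h1, h2⟩ := List.getElem?_eq_some_iff.1 (h.idt_spec x)
  refine ⟨h1, ?_⟩
  unfold rep
  rw [List.getD_eq_getElem _ _ h1, h2]

/-- The entry of an identity. -/
def idEntry (x : S.Node) : Entry S c x :=
  ⟨c.idt (FinGraph.nodeVal x), (h.rep_idt x).1, by rw [(h.rep_idt x).2]⟩

/-- The entry of an arrow: its action on the identity of its source. -/
def entry {x y : S.Schema} (f : x ⟶ y) : Entry S c (Pres.nodeOf y) :=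
  h.action.map f (h.idEntry (Pres.nodeOf x))

theorem entry_pathHom {x y : S.Node} (q : Quiver.Path x y) :
    (h.entry (S.pathHom q)).1 = c.actWord (c.idt (FinGraph.nodeVal x)) (pathCode q) :=
  h.pathAction_val q (h.idEntry x)

/-- A path is equivalent to the normal form of the entry of its arrow. -/
theorem exists_normalForm {x y : S.Node} (q : Quiver.Path x y) :
    (c.rep (h.entry (S.pathHom q)).1).1 = FinGraph.nodeVal x ∧
      ∃ q' : Quiver.Path x y, pathCode q' = (c.rep (h.entry (S.pathHom q)).1).2.2 ∧
        S.pathHom q' = S.pathHom q := by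
  induction q with
  | nil =>
    rw [entry_pathHom]
    have h1 := (h.rep_idt x).2
    refine ⟨congrArg Prod.fst h1, .nil, (congrArg (fun r => r.2.2) h1).symm, rfl⟩
  | @cons y z q e ih =>
    obtain ⟨h1, q', h2, h3⟩ := ih
    have h4 : (h.entry (S.pathHom (q.cons e))).1 =
        c.act (h.entry (S.pathHom q)).1 (Fin.val e.1) := by
      rw [entry_pathHom, entry_pathHom, pathCode, actWord_append]
      rfl
    rw [h4]
    obtain ⟨h5, h6, h7, h8⟩ := h.act_spec _ (h.entry (S.pathHom q)).2.1 e
      (h.entry (S.pathHom q)).2.2.symm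
    refine ⟨h6.trans h1, ?_⟩
    rw [h1, ← h2] at h8
    obtain ⟨q'', h9, h10⟩ := pathHom_derive _ (q'.cons e) h8
    refine ⟨q'', h9, h10.trans ?_⟩
    rw [Pres.pathHom_cons S q', Pres.pathHom_cons S q, h3]

theorem table_rep {r : ℕ} (hr : r < c.1.length) (n : ℕ) :
    (table n c).src r = (c.rep r).1 ∧ (table n c).tgt r = (c.rep r).2.1 := by
  unfold table CatTable.src CatTable.tgt rep
  dsimp only
  rw [List.getD_eq_getElem _ _ hr, List.getD_eq_getElem _ _ (by simpa using hr)]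
  simp

theorem table_comp {r s : ℕ} (hr : r < c.1.length) (hs : s < c.1.length) (n : ℕ) :
    (table n c).comp r s = c.actWord r (c.rep s).2.2 := by
  unfold table CatTable.comp
  dsimp only
  rw [List.getD_map_range _ hr, List.getD_map_range _ hs]

/-- The table of a valid certificate describes the schema. Distinct arrows have distinct entries
because they are represented by the normal forms of these. -/
def pres : Pres (table S.graph.numNodes c) S.Schema where
  ob x := FinGraph.nodeVal (Pres.nodeOf x)
  ar f := (h.entry f).1
  ob_lt x := Fin.isLt (n := S.graph.numNodes) _
  ob_inj x y hxy := congrArg S.ob (FinGraph.node_ext hxy)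
  ob_surj i hi := ⟨S.ob (⟨i, hi⟩ : Fin S.graph.numNodes), rfl⟩
  ar_lt f := (h.entry f).2.1.trans_eq (List.length_map _).symm
  ar_inj {x y} f g hfg := by
    obtain ⟨q, rfl⟩ := Pres.exists_pathHom _ f
    obtain ⟨q', rfl⟩ := Pres.exists_pathHom _ g
    obtain ⟨-, q₁, h1, h2⟩ := h.exists_normalForm q
    obtain ⟨-, q₂, h3, h4⟩ := h.exists_normalForm q'
    have h5 : (h.entry (S.pathHom q)).1 = (h.entry (S.pathHom q')).1 := hfg
    rw [h5, ← h3] at h1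
    refine h2.symm.trans (Eq.trans ?_ h4)
    rw [eq_of_pathCode h1]
  ar_surj r hr := by
    have hr' : r < c.1.length := hr.trans_eq (List.length_map _)
    obtain ⟨y, q, h1, h2⟩ := exists_path (G := S.graph)
      (⟨(c.rep r).1, h.src_lt r hr'⟩ : Fin S.graph.numNodes) _ _ (h.walk_rep r hr')
    refine ⟨_, _, S.pathHom q, (h.entry_pathHom q).trans ?_⟩
    rw [h1]
    exact h.actWord_rep r hr'
  src_ar {x y} f := by
    obtain ⟨q, rfl⟩ := Pres.exists_pathHom _ f
    exact (table_rep (h.entry _).2.1 _).1.trans (h.exists_normalForm q).1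
  tgt_ar {x y} f := (table_rep (h.entry f).2.1 _).2.trans (h.entry f).2.2
  ident_ob x := by
    have h1 := h.entry_pathHom (Quiver.Path.nil : Quiver.Path (Pres.nodeOf x) (Pres.nodeOf x))
    exact h1.symm
  comp_ar {x y z} f g := by
    obtain ⟨q, rfl⟩ := Pres.exists_pathHom _ f
    obtain ⟨q', rfl⟩ := Pres.exists_pathHom _ g
    obtain ⟨-, q₁, h1, h2⟩ := h.exists_normalForm q'
    refine (table_comp (h.entry _).2.1 (h.entry _).2.1 _).trans ?_
    refine Eq.trans ?_ (congrArg (fun t => (h.entry (S.pathHom q ≫ t)).1) h2)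
    refine Eq.trans ?_ (congrArg (fun t => (h.entry t).1) (pathHom_comp S q q₁))
    refine Eq.trans ?_ (h.entry_pathHom (q.comp q₁)).symm
    rw [pathCode_comp, actWord_append, h1]
    exact congrArg (fun i => c.actWord i _) (h.entry_pathHom q)

/-- The words of a valid certificate. -/
theorem isWords : h.pres.IsWords (𝟭 S.Schema) fun r => (c.rep r).2.2 := by
  intro x y k
  obtain ⟨q, rfl⟩ := Pres.exists_pathHom _ k
  obtain ⟨-, q₁, h1, h2⟩ := h.exists_normalForm q
  exact ⟨q₁, h2, h1⟩

end Valid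

/-- A finite schema has a valid certificate: number all arrows, choose a path for each, the empty
one for identities, and derivations between equivalent paths. -/
theorem exists_valid (S : Signature) (hS : S.IsFinite) : ∃ c, Valid S c := by
  have hfin : Finite ((x : Fin S.graph.numNodes) × (y : Fin S.graph.numNodes) ×
      (S.ob x ⟶ S.ob y)) := by
    have := fun x y : Fin S.graph.numNodes => hS (S.ob x) (S.ob y)
    infer_instance
  obtain ⟨n, ⟨φ⟩⟩ := Finite.exists_equiv_fin ((x : Fin S.graph.numNodes) ×
    (y : Fin S.graph.numNodes) × (S.ob x ⟶ S.ob y))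
  let num : ∀ {x y : S.Node}, (S.ob x ⟶ S.ob y) → Fin n := fun {x y} f => φ ⟨x, y, f⟩
  have hword : ∀ (x y : S.Node) (f : S.ob x ⟶ S.ob y), ∃ q : Quiver.Path x y, S.pathHom q = f ∧
      ∀ h : x = y, f = eqToHom (congrArg S.ob h) → pathCode q = [] := by
    intro x y f
    by_cases h : ∃ h : x = y, f = eqToHom (congrArg S.ob h)
    · obtain ⟨rfl, rfl⟩ := h
      exact ⟨.nil, rfl, fun _ _ => rfl⟩
    · obtain ⟨q, hq⟩ := Pres.exists_pathHom _ f
      exact ⟨q, hq, fun h1 h2 => (h ⟨h1, h2⟩).elim⟩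
  choose word hword hnil using hword
  have hder : ∀ (x y z : S.Node) (f : S.ob x ⟶ S.ob y) (e : y ⟶ z), ∃ l,
      derive S.graph.edges S.eqnsCode (FinGraph.nodeVal x) (pathCode (word x y f) ++ [Fin.val e.1])
        l = some (pathCode (word x z (f ≫ S.pathHom (Quiver.Path.nil.cons e)))) := by
    intro x y z f e
    refine exists_derive (q := (word x y f).cons e) ?_
    rw [Pres.pathHom_cons, hword, hword]
  choose der hder using hder
  let c : SchemaCert :=
    (List.ofFn fun i => (Fin.val (φ.symm i).1, Fin.val (φ.symm i).2.1,
        pathCode (word _ _ (φ.symm i).2.2)),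
      List.ofFn fun x : Fin S.graph.numNodes => (num (𝟙 (S.ob x))).val,
      List.ofFn fun i => List.ofFn fun e : Fin S.graph.numEdges =>
        if h : S.graph.src e = (φ.symm i).2.1 then
          (num ((φ.symm i).2.2 ≫ S.pathHom (Quiver.Path.nil.cons ⟨e, h, rfl⟩))).val else 0,
      List.ofFn fun i => List.ofFn fun e : Fin S.graph.numEdges =>
        if h : S.graph.src e = (φ.symm i).2.1 then der _ _ _ (φ.symm i).2.2 ⟨e, h, rfl⟩ else [])
  have hlen : c.1.length = n := List.length_ofFn
  have hnum : ∀ i < c.1.length, ∃ (x y : S.Node) (f : S.ob x ⟶ S.ob y), (num f).val = i := by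
    intro i hi
    refine ⟨(φ.symm ⟨i, hi.trans_eq hlen⟩).1, (φ.symm ⟨i, hi.trans_eq hlen⟩).2.1,
      (φ.symm ⟨i, hi.trans_eq hlen⟩).2.2, ?_⟩
    exact congrArg Fin.val (φ.apply_symm_apply _)
  have hrep : ∀ {x y : S.Node} (f : S.ob x ⟶ S.ob y), c.rep (num f).val =
      (FinGraph.nodeVal x, FinGraph.nodeVal y, pathCode (word x y f)) := by
    intro x y f
    refine (List.getD_ofFn _ (num f) _).trans ?_
    rw [φ.symm_apply_apply]
    rfl
  have hidt : ∀ x : S.Node, c.idt (FinGraph.nodeVal x) = (num (𝟙 (S.ob x))).val := fun x =>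
    List.getD_ofFn (fun x : Fin S.graph.numNodes => (num (𝟙 (S.ob x))).val) x _
  have hact : ∀ {x y z : S.Node} (f : S.ob x ⟶ S.ob y) (e : y ⟶ z),
      c.act (num f).val (Fin.val e.1) =
        (num (f ≫ S.pathHom (Quiver.Path.nil.cons e))).val ∧
      c.der (num f).val (Fin.val e.1) = der x y z f e := by
    rintro x y z f ⟨e, he, rfl⟩
    constructor
    · unfold act
      refine (congrArg (fun l => List.getD l (Fin.val e) 0) (List.getD_ofFn _ (num f) _)).trans
        ((List.getD_ofFn _ e _).trans ?_)
      rw [φ.symm_apply_apply]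
      exact dif_pos he
    · unfold SchemaCert.der
      refine (congrArg (fun l => List.getD l (Fin.val e) []) (List.getD_ofFn _ (num f) _)).trans
        ((List.getD_ofFn _ e _).trans ?_)
      rw [φ.symm_apply_apply]
      exact dif_pos he
  have hword' : ∀ {x y z : S.Node} (f : S.ob x ⟶ S.ob y) (q : Quiver.Path y z),
      c.actWord (num f).val (pathCode q) = (num (f ≫ S.pathHom q)).val := by
    intro x y z f q
    induction q with
    | nil => exact congrArg (fun f => (num f).val) (Category.comp_id f).symm
    | cons q e ih =>
      rw [pathCode, Valid.actWord_append, ih]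
      refine (hact _ e).1.trans ?_
      rw [Category.assoc, ← Pres.pathHom_cons]
  have hlt : ∀ {x y : S.Node} (f : S.ob x ⟶ S.ob y), (num f).val < c.1.length :=
    fun f => (num f).2.trans_eq hlen.symm
  refine ⟨c, ?_, ?_, ?_, ?_, ?_, ?_⟩
  · intro x
    rw [hidt, List.getElem?_eq_getElem (hlt _), ← List.getD_eq_getElem _ (0, 0, [])]
    refine congrArg some ((hrep (𝟙 (S.ob x))).trans ?_)
    rw [hnil x x (𝟙 _) rfl rfl]
  · intro i hi
    obtain ⟨x, y, f, rfl⟩ := hnum i hi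
    rw [hrep]
    exact walk_pathCode (G := S.graph) _
  · intro i hi
    obtain ⟨x, y, f, rfl⟩ := hnum i hi
    rw [hrep]
    dsimp only
    rw [hidt, hword', hword]
    exact congrArg (fun f => (num f).val) (Category.id_comp f)
  · intro i hi
    obtain ⟨x, y, f, rfl⟩ := hnum i hi
    rw [hrep]
    exact Fin.isLt (n := S.graph.numNodes) x
  · intro i hi y' z e hy
    obtain ⟨x, y, f, rfl⟩ := hnum i hi
    rw [hrep] at hy
    obtain rfl := FinGraph.node_ext hy
    rw [(hact f e).1, (hact f e).2, hrep, hrep]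
    exact ⟨hlt _, rfl, rfl, hder _ _ _ f e⟩
  · intro E hE i hi hy
    obtain ⟨x, y, f, rfl⟩ := hnum i hi
    rw [hrep] at hy
    obtain rfl := FinGraph.node_ext hy
    rw [hword', hword', pathHom_eqn hE]

end SchemaCert

/-! ### Tables from lists of objects and arrows -/

/-- An arrow in a list: source, target, and a pair of numbers that determines it between
these. -/
abbrev ArrowCode : Type := ℕ × ℕ × ℕ × ℕ

/-- The table on `n` objects with the arrows `R`, where `ident` and `comp` hold the pairs of numbers
that determine the identities and the composites. -/
def tableOfLists (n : ℕ) (R : List ArrowCode) (ident : List (ℕ × ℕ))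
    (comp : List (List (ℕ × ℕ))) : CatTable :=
  (n, R.map (fun r => (r.1, r.2.1)),
    (List.range n).map (fun i => R.idxOf (i, i, ident.getD i (0, 0))),
    (List.range R.length).map fun r => (List.range R.length).map fun s =>
      R.idxOf ((R.getD r (0, 0, 0, 0)).1, (R.getD s (0, 0, 0, 0)).2.1,
        (comp.getD r []).getD s (0, 0)))

/-- The table of lists describes a category if the objects and the arrows correspond to the
entries. -/
def Pres.ofLists {C : Type} [Category.{0} C] {n : ℕ} {R : List ArrowCode}
    {ident : List (ℕ × ℕ)} {comp : List (List (ℕ × ℕ))}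
    (ob : C → ℕ) (ob_lt : ∀ x, ob x < n) (ob_inj : Function.Injective ob)
    (ob_surj : ∀ i < n, ∃ x, ob x = i) (nodup : R.Nodup)
    (code : ∀ {x y : C}, (x ⟶ y) → ℕ × ℕ)
    (code_inj : ∀ {x y : C} (k l : x ⟶ y), code k = code l → k = l)
    (mem : ∀ {x y : C} (k : x ⟶ y), (ob x, ob y, code k) ∈ R)
    (of_mem : ∀ r ∈ R, ∃ (x y : C) (k : x ⟶ y), (ob x, ob y, code k) = r)
    (hident : ∀ x, ident.getD (ob x) (0, 0) = code (𝟙 x))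
    (hcomp : ∀ {x y z : C} (k : x ⟶ y) (l : y ⟶ z),
      (comp.getD (R.idxOf (ob x, ob y, code k)) []).getD (R.idxOf (ob y, ob z, code l)) (0, 0) =
        code (k ≫ l)) :
    Pres (tableOfLists n R ident comp) C where
  ob := ob
  ar {x y} k := R.idxOf (ob x, ob y, code k)
  ob_lt := ob_lt
  ob_inj := ob_inj
  ob_surj := ob_surj
  ar_lt k := (List.idxOf_lt_length_iff.2 (mem k)).trans_eq (List.length_map _).symm
  ar_inj {x y} k l h := by
    have h1 := (List.idxOf_inj (mem k)).1 h
    exact code_inj k l (Prod.mk.inj (Prod.mk.inj h1).2).2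
  ar_surj r hr := by
    have hr' : r < R.length := hr.trans_eq (List.length_map _)
    obtain ⟨x, y, k, hk⟩ := of_mem R[r] (List.getElem_mem hr')
    refine ⟨x, y, k, ?_⟩
    rw [hk]
    exact nodup.idxOf_getElem r hr'
  src_ar {x y} k := by
    have h1 := List.idxOf_lt_length_iff.2 (mem k)
    unfold tableOfLists CatTable.src
    dsimp only
    rw [List.getD_eq_getElem _ _ (by simpa using h1), List.getElem_map, List.getElem_idxOf]
  tgt_ar {x y} k := by
    have h1 := List.idxOf_lt_length_iff.2 (mem k)
    unfold tableOfLists CatTable.tgt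
    dsimp only
    rw [List.getD_eq_getElem _ _ (by simpa using h1), List.getElem_map, List.getElem_idxOf]
  ident_ob x := by
    unfold tableOfLists CatTable.ident
    dsimp only
    rw [List.getD_map_range _ (ob_lt x), hident]
  comp_ar {x y z} k l := by
    have h1 := List.idxOf_lt_length_iff.2 (mem k)
    have h2 := List.idxOf_lt_length_iff.2 (mem l)
    unfold tableOfLists CatTable.comp
    dsimp only
    rw [List.getD_map_range _ h1, List.getD_map_range _ h2, hcomp,
      List.getD_eq_getElem _ _ h1, List.getD_eq_getElem _ _ h2, List.getElem_idxOf,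
      List.getElem_idxOf]

/-! ### Tables of functors -/

/-- The values of a functor on objects and on arrows. -/
abbrev FunTable : Type := List ℕ × List ℕ

namespace FunTable

/-- The value on an object. -/
def ob (φ : FunTable) (x : ℕ) : ℕ := φ.1.getD x 0

/-- The value on an arrow. -/
def ar (φ : FunTable) (r : ℕ) : ℕ := φ.2.getD r 0

end FunTable

/-- The table `φ` describes the functor `F`. -/
structure IsFun {t u : CatTable} {C D : Type} [Category.{0} C] [Category.{0} D] (p : Pres t C)
    (q : Pres u D) (F : C ⥤ D) (φ : FunTable) : Prop where
  ob : ∀ x, φ.ob (p.ob x) = q.ob (F.obj x)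
  ar : ∀ {x y : C} (k : x ⟶ y), φ.ar (p.ar k) = q.ar (F.map k)

/-! ### Lists of words over an alphabet -/

/-- The lists of length `n` with entries in `L`, by an explicit recursion on `n`. -/
def listsOf {α : Type*} (L : List α) (n : ℕ) : List (List α) :=
  Nat.rec [[]] (fun _ ls => L.flatMap fun x => ls.map fun l => x :: l) n

theorem mem_listsOf {α : Type*} {L : List α} {n : ℕ} {l : List α} :
    l ∈ listsOf L n ↔ l.length = n ∧ ∀ x ∈ l, x ∈ L := by
  induction n generalizing l with
  | zero =>
    refine List.mem_singleton.trans ⟨?_, fun h => List.length_eq_zero_iff.1 h.1⟩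
    rintro rfl
    exact ⟨rfl, fun x hx => (List.not_mem_nil hx).elim⟩
  | succ n ih =>
    refine List.mem_flatMap.trans ⟨?_, ?_⟩
    · rintro ⟨x, hx, h⟩
      obtain ⟨l, hl, rfl⟩ := List.mem_map.1 h
      obtain ⟨h1, h2⟩ := ih.1 hl
      refine ⟨congrArg (· + 1) h1, fun y hy => ?_⟩
      rcases List.mem_cons.1 hy with rfl | hy
      · exact hx
      · exact h2 y hy
    · rintro ⟨h1, h2⟩
      obtain ⟨x, l, rfl⟩ := List.exists_cons_of_length_eq_add_one h1
      exact ⟨x, h2 x List.mem_cons_self, List.mem_map.2 ⟨l, ih.2 ⟨Nat.succ.inj h1,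
        fun y hy => h2 y (List.mem_cons_of_mem _ hy)⟩, rfl⟩⟩

theorem nodup_flatMap_map {α β γ : Type*} {L : List α} {K : α → List β} {f : α → β → γ}
    (hL : L.Nodup) (hK : ∀ a, (K a).Nodup)
    (hf : ∀ a b a' b', f a b = f a' b' → a = a' ∧ b = b') :
    (L.flatMap fun a => (K a).map fun b => f a b).Nodup := by
  rw [List.nodup_flatMap]
  refine ⟨fun a _ => (hK a).map fun b b' h => (hf a b a b' h).2, ?_⟩
  refine hL.imp fun {a a'} hne => ?_
  intro c hc hc'
  obtain ⟨b, -, rfl⟩ := List.mem_map.1 hc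
  obtain ⟨b', -, h⟩ := List.mem_map.1 hc'
  exact hne (hf _ _ _ _ h).1.symm

theorem nodup_listsOf {α : Type*} {L : List α} (hL : L.Nodup) (n : ℕ) : (listsOf L n).Nodup := by
  induction n with
  | zero => exact List.nodup_singleton _
  | succ n ih => exact nodup_flatMap_map hL (fun _ => ih) fun a b a' b' h => List.cons.inj h

/-- The matrices with `m` rows, `n` columns and entries in `L`. -/
def matricesOf (L : List ℕ) (m n : ℕ) : List (List (List ℕ)) := listsOf (listsOf L n) m

/-- The entry of a matrix in row `a` and column `u`, with `0` outside. -/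
def entry (rows : List (List ℕ)) (a u : ℕ) : ℕ := (rows.getD a []).getD u 0

/-- The matrix with given entries. -/
def matrix (m n : ℕ) (f : ℕ → ℕ → ℕ) : List (List ℕ) :=
  (List.range m).map fun a => (List.range n).map fun u => f a u

theorem entry_matrix {m n : ℕ} {f : ℕ → ℕ → ℕ} {a u : ℕ} (ha : a < m) (hu : u < n) :
    entry (matrix m n f) a u = f a u := by
  unfold entry matrix
  rw [List.getD_map_range _ ha, List.getD_map_range _ hu]

theorem List.eq_map_range {α : Type*} {l : List α} {n : ℕ} (h : l.length = n) (d : α) :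
    l = (List.range n).map fun i => l.getD i d := by
  subst h
  refine List.ext_getElem (by simp) fun i h h' => ?_
  rw [List.getElem_map, List.getElem_range, List.getD_eq_getElem _ _ h]

theorem mem_matricesOf {L : List ℕ} {m n : ℕ} {rows : List (List ℕ)} :
    rows ∈ matricesOf L m n ↔
      rows = matrix m n (entry rows) ∧ ∀ a < m, ∀ u < n, entry rows a u ∈ L := by
  constructor
  · intro h
    obtain ⟨h1, h2⟩ := mem_listsOf.1 h
    have h3 : ∀ a < m, (rows.getD a []).length = n ∧ ∀ x ∈ rows.getD a [], x ∈ L := by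
      intro a ha
      rw [← h1] at ha
      apply mem_listsOf.1
      rw [List.getD_eq_getElem _ _ ha]
      exact h2 _ (List.getElem_mem ha)
    refine ⟨(List.eq_map_range h1 []).trans ?_, fun a ha u hu => ?_⟩
    · refine List.map_congr_left fun a ha => ?_
      exact List.eq_map_range (h3 a (List.mem_range.1 ha)).1 0
    · have h4 := h3 a ha
      unfold entry
      rw [List.getD_eq_getElem _ _ (hu.trans_eq h4.1.symm)]
      exact h4.2 _ (List.getElem_mem _)
  · rintro ⟨h1, h2⟩
    rw [h1]
    refine mem_listsOf.2 ⟨by simp [matrix], fun row hrow => ?_⟩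
    obtain ⟨a, ha, rfl⟩ := List.mem_map.1 hrow
    refine mem_listsOf.2 ⟨by simp, fun x hx => ?_⟩
    obtain ⟨u, hu, rfl⟩ := List.mem_map.1 hx
    exact h2 a (List.mem_range.1 ha) u (List.mem_range.1 hu)

theorem matrix_congr {m n : ℕ} {f g : ℕ → ℕ → ℕ} (h : ∀ a < m, ∀ u < n, f a u = g a u) :
    matrix m n f = matrix m n g :=
  List.map_congr_left fun a ha => List.map_congr_left fun u hu =>
    h a (List.mem_range.1 ha) u (List.mem_range.1 hu)

/-! ### The table of the category of sections -/

/-- The tables of the categories `A₁`, `B₁`, `A₂`, `B₂` and of the functors `G₁`, `H₁`, `F₂`,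
`G₂` of two queries. -/
abbrev CompInput : Type :=
  (CatTable × CatTable × CatTable × CatTable) × (FunTable × FunTable × FunTable × FunTable)

namespace CompInput

/-- The table of `A₁`. -/
def A₁ (d : CompInput) : CatTable := d.1.1
/-- The table of `B₁`. -/
def B₁ (d : CompInput) : CatTable := d.1.2.1
/-- The table of `A₂`. -/
def A₂ (d : CompInput) : CatTable := d.1.2.2.1
/-- The table of `B₂`. -/
def B₂ (d : CompInput) : CatTable := d.1.2.2.2
/-- The table of `G₁`. -/
def G₁ (d : CompInput) : FunTable := d.2.1
/-- The table of `H₁`. -/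
def H₁ (d : CompInput) : FunTable := d.2.2.1
/-- The table of `F₂`. -/
def F₂ (d : CompInput) : FunTable := d.2.2.2.1
/-- The table of `G₂`. -/
def G₂ (d : CompInput) : FunTable := d.2.2.2.2

/-- The arrow `u` goes from `b` to the value of `G₂` at `a`. -/
def relevant (d : CompInput) (b a u : ℕ) : Bool :=
  eqb (d.B₂.src u) b && eqb (d.B₂.tgt u) (d.G₂.ob a)

/-- The code of a section: an object of `B₂` and the matrix of the values at the arrows of `B₂`
into the image of `G₂`, filled up by zeros. -/
abbrev SectionCode : Type := ℕ × List (List ℕ)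

/-- The candidates for sections: all matrices with entries in a range that contains the objects of
`B₁`, and also `0` if `B₁` is empty. -/
def sectionCandidates (d : CompInput) : List SectionCode :=
  (List.range d.B₂.numOb).flatMap fun b =>
    (matricesOf (List.range (d.B₁.numOb + 1)) d.A₂.numOb d.B₂.numAr).map fun rows => (b, rows)

/-- The entries of a section at the arrows into the image of `G₂` are objects over the values of
`F₂`; the others are `0`, so that the code of a section is unique. -/
def valuesValid (d : CompInput) (z : SectionCode) : Bool :=
  (List.range d.A₂.numOb).all fun a => (List.range d.B₂.numAr).all fun u =>
    bif d.relevant z.1 a u then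
      decide (entry z.2 a u < d.B₁.numOb) && eqb (d.H₁.ob (entry z.2 a u)) (d.F₂.ob a)
    else eqb (entry z.2 a u) 0

/-- There is an arrow of `B₁` from `x` to `y` over the value of `F₂` at `k`. As `H₁` is a discrete
op-fibration, this says that `y` is the transport of `x`. -/
def transport (d : CompInput) (x y k : ℕ) : Bool :=
  (List.range d.B₁.numAr).any fun w =>
    eqb (d.B₁.src w) x && eqb (d.B₁.tgt w) y && eqb (d.H₁.ar w) (d.F₂.ar k)

/-- The values of a section are compatible. -/
def valuesCompatible (d : CompInput) (z : SectionCode) : Bool :=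
  (List.range d.A₂.numAr).all fun k => (List.range d.B₂.numAr).all fun u =>
    !d.relevant z.1 (d.A₂.src k) u ||
      d.transport (entry z.2 (d.A₂.src k) u) (entry z.2 (d.A₂.tgt k) (d.B₂.comp u (d.G₂.ar k))) k

/-- The codes of all sections. -/
def sectionList (d : CompInput) : List SectionCode :=
  d.sectionCandidates.filter fun z => d.valuesValid z && d.valuesCompatible z

/-- A section in a list. -/
def sectionAt (O : List SectionCode) (i : ℕ) : SectionCode := O.getD i (0, [])

/-- The arrow `u` of `B₂` carries the first section to the second. -/
def sectionArrow (d : CompInput) (z z' : SectionCode) (u : ℕ) : Bool :=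
  eqb (d.B₂.src u) z.1 && eqb (d.B₂.tgt u) z'.1 &&
    (List.range d.A₂.numOb).all fun a => (List.range d.B₂.numAr).all fun v =>
      !d.relevant z'.1 a v || eqb (entry z.2 a (d.B₂.comp u v)) (entry z'.2 a v)

/-- The arrows between the sections of a list `O`. -/
def sectionArrowsOf (d : CompInput) (O : List SectionCode) : List ArrowCode :=
  (List.range O.length).flatMap fun i => (List.range O.length).flatMap fun j =>
    ((List.range d.B₂.numAr).filter fun u => d.sectionArrow (sectionAt O i) (sectionAt O j) u).map
      fun u => (i, j, u, 0)

/-- The arrows of the category of sections. -/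
def sectionArrows (d : CompInput) : List ArrowCode := d.sectionArrowsOf d.sectionList

end CompInput

/-- All values of a function of two entries of a list. -/
def pairTable {β : Type*} (R : List ArrowCode) (f : ArrowCode → ArrowCode → β) : List (List β) :=
  (List.range R.length).map fun r => (List.range R.length).map fun s =>
    f (R.getD r (0, 0, 0, 0)) (R.getD s (0, 0, 0, 0))

theorem getD_pairTable {β : Type*} {R : List ArrowCode} {f : ArrowCode → ArrowCode → β}
    {x y : ArrowCode} (hx : x ∈ R) (hy : y ∈ R) (d : β) :
    ((pairTable R f).getD (R.idxOf x) []).getD (R.idxOf y) d = f x y := by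
  have h1 := List.idxOf_lt_length_iff.2 hx
  have h2 := List.idxOf_lt_length_iff.2 hy
  unfold pairTable
  rw [List.getD_map_range _ h1, List.getD_map_range _ h2, List.getD_eq_getElem _ _ h1,
    List.getD_eq_getElem _ _ h2, List.getElem_idxOf, List.getElem_idxOf]

namespace CompInput

/-- The table of the category of sections. -/
def sectionTable (d : CompInput) : CatTable :=
  tableOfLists d.sectionList.length d.sectionArrows
    (d.sectionList.map fun z => (d.B₂.ident z.1, 0))
    (pairTable d.sectionArrows fun r s => (d.B₂.comp r.2.2.1 s.2.2.1, 0))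

end CompInput

section

variable {A₁ B₁ X A₂ B₂ : Type} [Category.{0} A₁] [Category.{0} B₁] [Category.{0} X]
  [Category.{0} A₂] [Category.{0} B₂]

/-- The input `d` describes the given categories and functors. -/
structure CompInput.Describes (d : CompInput) (G₁ : A₁ ⥤ B₁) (H₁ : B₁ ⥤ X) (F₂ : A₂ ⥤ X)
    (G₂ : A₂ ⥤ B₂) where
  A₁ : Pres d.A₁ A₁
  B₁ : Pres d.B₁ B₁
  A₂ : Pres d.A₂ A₂
  B₂ : Pres d.B₂ B₂
  tableX : CatTable
  X : Pres tableX X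
  G₁ : IsFun A₁ B₁ G₁ d.G₁
  H₁ : IsFun B₁ X H₁ d.H₁
  F₂ : IsFun A₂ X F₂ d.F₂
  G₂ : IsFun A₂ B₂ G₂ d.G₂

namespace CompInput.Describes

variable {d : CompInput} {G₁ : A₁ ⥤ B₁} {H₁ : B₁ ⥤ X} {F₂ : A₂ ⥤ X} {G₂ : A₂ ⥤ B₂}
  (D : d.Describes G₁ H₁ F₂ G₂) (hH : IsDiscreteOpfibration H₁)

theorem fibre_map_iff {x x' : X} (g : x ⟶ x') (c : {c : B₁ // H₁.obj c = x})
    (c' : {c : B₁ // H₁.obj c = x'}) : hH.fibre.map g c = c' ↔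
      ∃ m : c.1 ⟶ c'.1, IsDiscreteOpfibration.Over c c' g m :=
  ⟨hH.exists_over, fun ⟨m, hm⟩ => hH.fibre_map_eq m hm⟩

theorem over_iff {x x' : X} (g : x ⟶ x') (c : {c : B₁ // H₁.obj c = x})
    (c' : {c : B₁ // H₁.obj c = x'}) (m : c.1 ⟶ c'.1) :
    IsDiscreteOpfibration.Over c c' g m ↔ d.H₁.ar (D.B₁.ar m) = D.X.ar g := by
  obtain ⟨c, rfl⟩ := c
  obtain ⟨c', rfl⟩ := c'
  unfold IsDiscreteOpfibration.Over
  rw [D.H₁.ar, eqToHom_refl, eqToHom_refl, Category.comp_id, Category.id_comp]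
  exact ⟨fun h => congrArg D.X.ar h, fun h => D.X.ar_inj _ _ h⟩

theorem transport_iff {a a' : A₂} (k : a ⟶ a') (c : {c : B₁ // H₁.obj c = F₂.obj a})
    (c' : {c : B₁ // H₁.obj c = F₂.obj a'}) :
    d.transport (D.B₁.ob c.1) (D.B₁.ob c'.1) (D.A₂.ar k) = true ↔
      hH.fibre.map (F₂.map k) c = c' := by
  rw [fibre_map_iff]
  unfold CompInput.transport
  simp only [List.any_eq_true, List.mem_range, Bool.and_eq_true, eqb_iff, D.F₂.ar]
  constructor
  · rintro ⟨w, hw, ⟨h1, h2⟩, h3⟩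
    obtain ⟨m, rfl⟩ := D.B₁.exists_hom hw h1 h2
    exact ⟨m, (D.over_iff _ c c' m).2 h3⟩
  · rintro ⟨m, hm⟩
    exact ⟨D.B₁.ar m, D.B₁.ar_lt m, ⟨D.B₁.src_ar m, D.B₁.tgt_ar m⟩, (D.over_iff _ c c' m).1 hm⟩

theorem relevant_iff {b : B₂} {a : A₂} {u : ℕ} (hu : u < d.B₂.numAr) :
    d.relevant (D.B₂.ob b) (D.A₂.ob a) u = true ↔ ∃ u' : b ⟶ G₂.obj a, D.B₂.ar u' = u := by
  unfold CompInput.relevant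
  rw [Bool.and_eq_true, eqb_iff, eqb_iff, D.G₂.ob]
  constructor
  · rintro ⟨h1, h2⟩
    exact D.B₂.exists_hom hu h1 h2
  · rintro ⟨u', rfl⟩
    exact ⟨D.B₂.src_ar u', D.B₂.tgt_ar u'⟩

open Classical in
/-- The values of a section as a function of numbers, with `0` at the numbers of no arrow into the
image of `G₂`. -/
noncomputable def sectionValue {b : B₂} (s : (sections F₂ G₂ hH).obj b) (a u : ℕ) : ℕ :=
  if h : ∃ (a' : A₂) (u' : b ⟶ G₂.obj a'), D.A₂.ob a' = a ∧ D.B₂.ar u' = u then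
    D.B₁.ob (s.1 h.choose h.choose_spec.choose).1 else 0

theorem sectionValue_eq {b : B₂} (s : (sections F₂ G₂ hH).obj b) (a : A₂) (u : b ⟶ G₂.obj a) :
    D.sectionValue hH s (D.A₂.ob a) (D.B₂.ar u) = D.B₁.ob (s.1 a u).1 := by
  have h : ∃ (a' : A₂) (u' : b ⟶ G₂.obj a'), D.A₂.ob a' = D.A₂.ob a ∧ D.B₂.ar u' = D.B₂.ar u :=
    ⟨a, u, rfl, rfl⟩
  unfold sectionValue
  rw [dif_pos h]
  have key : ∀ (a' : A₂) (u' : b ⟶ G₂.obj a'), D.A₂.ob a' = D.A₂.ob a →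
      D.B₂.ar u' = D.B₂.ar u → D.B₁.ob (s.1 a' u').1 = D.B₁.ob (s.1 a u).1 := by
    intro a' u' h1 h2
    obtain rfl := D.A₂.ob_inj h1
    obtain rfl := D.B₂.ar_inj _ _ h2
    rfl
  exact key _ _ h.choose_spec.choose_spec.1 h.choose_spec.choose_spec.2

theorem sectionValue_of_not {b : B₂} (s : (sections F₂ G₂ hH).obj b) (a : A₂) {u : ℕ}
    (hu : u < d.B₂.numAr) (h : d.relevant (D.B₂.ob b) (D.A₂.ob a) u = false) :
    D.sectionValue hH s (D.A₂.ob a) u = 0 := by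
  unfold sectionValue
  rw [dif_neg]
  rintro ⟨a', u', h1, h2⟩
  obtain rfl := D.A₂.ob_inj h1
  rw [(D.relevant_iff hu).2 ⟨u', h2⟩] at h
  exact Bool.noConfusion h

/-- The code of a section. -/
noncomputable def sectionCode (z : El (sections F₂ G₂ hH)) : CompInput.SectionCode :=
  (D.B₂.ob z.base, matrix d.A₂.numOb d.B₂.numAr (D.sectionValue hH z.elt))

theorem entry_sectionCode (z : El (sections F₂ G₂ hH)) (a : A₂) (u : z.base ⟶ G₂.obj a) :
    entry (D.sectionCode hH z).2 (D.A₂.ob a) (D.B₂.ar u) = D.B₁.ob (z.elt.1 a u).1 :=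
  (entry_matrix (D.A₂.ob_lt a) (D.B₂.ar_lt u)).trans (D.sectionValue_eq hH z.elt a u)

theorem sectionCode_injective : Function.Injective (D.sectionCode hH) := by
  rintro ⟨b, s⟩ ⟨b', s'⟩ h
  obtain rfl : b = b' := D.B₂.ob_inj (congrArg Prod.fst h)
  have h1 : s = s' := by
    apply Subtype.ext
    funext a u
    apply Subtype.ext
    apply D.B₁.ob_inj
    have h2 := D.entry_sectionCode hH ⟨b, s⟩ a u
    rw [h] at h2
    exact h2.symm.trans (D.entry_sectionCode hH ⟨b, s'⟩ a u)
  rw [h1]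

/-- The list of sections is complete, and it contains nothing else. -/
theorem mem_sectionList {z : CompInput.SectionCode} :
    z ∈ d.sectionList ↔ ∃ x, D.sectionCode hH x = z := by
  have hval : ∀ z : CompInput.SectionCode, d.valuesValid z = true ↔ ∀ (a : A₂), ∀ u < d.B₂.numAr,
      (d.relevant z.1 (D.A₂.ob a) u = true → entry z.2 (D.A₂.ob a) u < d.B₁.numOb ∧
        d.H₁.ob (entry z.2 (D.A₂.ob a) u) = D.X.ob (F₂.obj a)) ∧
      (d.relevant z.1 (D.A₂.ob a) u = false → entry z.2 (D.A₂.ob a) u = 0) := by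
    intro z
    unfold CompInput.valuesValid
    simp only [List.all_eq_true, List.mem_range]
    rw [D.A₂.forall_ob (P := fun a => ∀ u < d.B₂.numAr, _)]
    refine forall_congr' fun a => forall₂_congr fun u hu => ?_
    cases d.relevant z.1 (D.A₂.ob a) u <;> simp [eqb_iff, D.F₂.ob]
  have hcomp : ∀ z : CompInput.SectionCode, d.valuesCompatible z = true ↔
      ∀ (a a' : A₂) (k : a ⟶ a'), ∀ u < d.B₂.numAr, d.relevant z.1 (D.A₂.ob a) u = true →
        d.transport (entry z.2 (D.A₂.ob a) u)
          (entry z.2 (D.A₂.ob a') (d.B₂.comp u (D.B₂.ar (G₂.map k)))) (D.A₂.ar k) = true := by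
    intro z
    unfold CompInput.valuesCompatible
    simp only [List.all_eq_true, List.mem_range]
    rw [D.A₂.forall_ar (P := fun k => ∀ u < d.B₂.numAr, _)]
    refine forall_congr' fun a => forall_congr' fun a' => forall_congr' fun k =>
      forall₂_congr fun u hu => ?_
    rw [D.A₂.src_ar, D.A₂.tgt_ar, D.G₂.ar]
    cases d.relevant z.1 (D.A₂.ob a) u <;> simp
  have hcand : z ∈ d.sectionCandidates ↔ z.1 < d.B₂.numOb ∧
      z.2 = matrix d.A₂.numOb d.B₂.numAr (entry z.2) ∧
      ∀ a < d.A₂.numOb, ∀ u < d.B₂.numAr, entry z.2 a u < d.B₁.numOb + 1 := by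
    unfold CompInput.sectionCandidates
    obtain ⟨b, rows⟩ := z
    simp only [List.mem_flatMap, List.mem_map, List.mem_range, mem_matricesOf, Prod.mk.injEq]
    constructor
    · rintro ⟨b, hb, rows, h, rfl, rfl⟩
      exact ⟨hb, h⟩
    · rintro ⟨hb, h⟩
      exact ⟨b, hb, rows, h, rfl, rfl⟩
  unfold CompInput.sectionList
  rw [List.mem_filter, Bool.and_eq_true, hval, hcomp, hcand]
  constructor
  · rintro ⟨⟨h1, h2, -⟩, h3, h4⟩
    obtain ⟨b, rows⟩ := z
    dsimp only at h1 h2 h3 h4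
    obtain ⟨b, rfl⟩ := D.B₂.ob_surj b h1
    have hex : ∀ (a : A₂) (u : b ⟶ G₂.obj a), ∃ y : {y // H₁.obj y = F₂.obj a},
        D.B₁.ob y.1 = entry rows (D.A₂.ob a) (D.B₂.ar u) := by
      intro a u
      obtain ⟨h5, h6⟩ := (h3 a _ (D.B₂.ar_lt u)).1 ((D.relevant_iff (D.B₂.ar_lt u)).2 ⟨u, rfl⟩)
      obtain ⟨y, hy⟩ := D.B₁.ob_surj _ h5
      rw [← hy, D.H₁.ob] at h6
      exact ⟨⟨y, D.X.ob_inj h6⟩, hy⟩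
    choose s hs using hex
    have hcompat : CompatFamily G₂ (F₂ ⋙ hH.fibre) b s := by
      intro a a' k u
      apply (D.transport_iff hH k (s a u) (s a' (u ≫ G₂.map k))).1
      have h5 := h4 a a' k _ (D.B₂.ar_lt u) ((D.relevant_iff (D.B₂.ar_lt u)).2 ⟨u, rfl⟩)
      rw [D.B₂.comp_ar, ← hs, ← hs] at h5
      exact h5
    refine ⟨⟨b, s, hcompat⟩, Prod.ext rfl (Eq.trans ?_ h2.symm)⟩
    refine matrix_congr fun a ha u hu => ?_
    obtain ⟨a, rfl⟩ := D.A₂.ob_surj a ha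
    cases h5 : d.relevant (D.B₂.ob b) (D.A₂.ob a) u with
    | true =>
      obtain ⟨u', rfl⟩ := (D.relevant_iff hu).1 h5
      exact (D.sectionValue_eq hH _ a u').trans (hs a u')
    | false => exact (D.sectionValue_of_not hH _ a hu h5).trans ((h3 a u hu).2 h5).symm
  · rintro ⟨⟨b, s⟩, rfl⟩
    have hentry : ∀ (a : A₂), ∀ u < d.B₂.numAr,
        entry (D.sectionCode hH ⟨b, s⟩).2 (D.A₂.ob a) u = D.sectionValue hH s (D.A₂.ob a) u :=
      fun a u hu => entry_matrix (D.A₂.ob_lt a) hu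
    refine ⟨⟨D.B₂.ob_lt b, (matrix_congr fun a ha u hu => entry_matrix ha hu).symm,
      fun a ha u hu => ?_⟩, fun a u hu => ⟨fun h => ?_, fun h => ?_⟩, fun a a' k u hu h => ?_⟩
    · obtain ⟨a, rfl⟩ := D.A₂.ob_surj a ha
      rw [hentry a u hu]
      cases h5 : d.relevant (D.B₂.ob b) (D.A₂.ob a) u with
      | true =>
        obtain ⟨u', rfl⟩ := (D.relevant_iff hu).1 h5
        rw [sectionValue_eq]
        exact Nat.lt_succ_of_lt (D.B₁.ob_lt _)
      | false =>
        rw [D.sectionValue_of_not hH _ a hu h5]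
        exact Nat.succ_pos _
    · obtain ⟨u', rfl⟩ := (D.relevant_iff hu).1 h
      rw [entry_sectionCode, D.H₁.ob]
      exact ⟨D.B₁.ob_lt _, congrArg D.X.ob (s.1 a u').2⟩
    · rw [hentry a u hu]
      exact D.sectionValue_of_not hH _ a hu h
    · obtain ⟨u', rfl⟩ := (D.relevant_iff hu).1 h
      rw [D.B₂.comp_ar]
      have h6 := D.entry_sectionCode hH ⟨b, s⟩ a u'
      have h7 := D.entry_sectionCode hH ⟨b, s⟩ a' (u' ≫ G₂.map k)
      rw [h6, h7]
      exact (D.transport_iff hH k _ _).2 (s.2 k u')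

end CompInput.Describes

end

/-- The entry of a list at the position of one of its members. -/
theorem List.getD_idxOf {α : Type*} [BEq α] [LawfulBEq α] {l : List α} {a : α} (h : a ∈ l) (d : α) :
    l.getD (l.idxOf a) d = a := by
  rw [List.getD_eq_getElem _ _ (List.idxOf_lt_length_iff.2 h), List.getElem_idxOf]

theorem CompInput.nodup_sectionList (d : CompInput) : d.sectionList.Nodup := by
  refine List.Nodup.filter _ (nodup_flatMap_map List.nodup_range (fun _ => ?_) fun a b a' b' h =>
    Prod.mk.inj h)
  exact nodup_listsOf (nodup_listsOf List.nodup_range _) _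

theorem CompInput.mem_sectionArrows {d : CompInput} {r : ArrowCode} : r ∈ d.sectionArrows ↔
    r.1 < d.sectionList.length ∧ r.2.1 < d.sectionList.length ∧ r.2.2.1 < d.B₂.numAr ∧
      d.sectionArrow (sectionAt d.sectionList r.1) (sectionAt d.sectionList r.2.1) r.2.2.1 = true ∧
        r.2.2.2 = 0 := by
  obtain ⟨i, j, u, v⟩ := r
  unfold CompInput.sectionArrows CompInput.sectionArrowsOf
  simp only [List.mem_flatMap, List.mem_map, List.mem_range, List.mem_filter, Prod.mk.injEq]
  constructor
  · rintro ⟨i, hi, j, hj, u, ⟨hu, h⟩, rfl, rfl, rfl, rfl⟩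
    exact ⟨hi, hj, hu, h, rfl⟩
  · rintro ⟨hi, hj, hu, h, rfl⟩
    exact ⟨i, hi, j, hj, u, ⟨hu, h⟩, rfl, rfl, rfl, rfl⟩

theorem CompInput.nodup_sectionArrows (d : CompInput) : d.sectionArrows.Nodup := by
  unfold CompInput.sectionArrows CompInput.sectionArrowsOf
  have h1 : ∀ i, ((List.range d.sectionList.length).flatMap fun j =>
      ((List.range d.B₂.numAr).filter fun u =>
        d.sectionArrow (sectionAt d.sectionList i) (sectionAt d.sectionList j) u).map
          fun u => (i, j, u, 0)).Nodup := fun i =>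
    nodup_flatMap_map List.nodup_range (fun j => List.nodup_range.filter _) fun a b a' b' h => by
      simpa using h
  rw [List.nodup_flatMap]
  refine ⟨fun i _ => h1 i, List.nodup_range.imp fun {i i'} hne => ?_⟩
  intro r hr hr'
  obtain ⟨j, -, h⟩ := List.mem_flatMap.1 hr
  obtain ⟨u, -, rfl⟩ := List.mem_map.1 h
  obtain ⟨j', -, h'⟩ := List.mem_flatMap.1 hr'
  obtain ⟨u', -, h''⟩ := List.mem_map.1 h'
  exact hne (congrArg Prod.fst h'').symm

section

variable {A₁ B₁ X A₂ B₂ : Type} [Category.{0} A₁] [Category.{0} B₁] [Category.{0} X]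
  [Category.{0} A₂] [Category.{0} B₂]

namespace CompInput.Describes

variable {d : CompInput} {G₁ : A₁ ⥤ B₁} {H₁ : B₁ ⥤ X} {F₂ : A₂ ⥤ X} {G₂ : A₂ ⥤ B₂}
  (D : d.Describes G₁ H₁ F₂ G₂) (hH : IsDiscreteOpfibration H₁)

/-- The number of a section. -/
noncomputable def sectionOb (z : El (sections F₂ G₂ hH)) : ℕ :=
  d.sectionList.idxOf (D.sectionCode hH z)

theorem sectionCode_mem (z : El (sections F₂ G₂ hH)) : D.sectionCode hH z ∈ d.sectionList :=
  (D.mem_sectionList hH).2 ⟨z, rfl⟩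

theorem sectionAt_sectionOb (z : El (sections F₂ G₂ hH)) :
    CompInput.sectionAt d.sectionList (D.sectionOb hH z) = D.sectionCode hH z :=
  List.getD_idxOf (D.sectionCode_mem hH z) _

theorem sectionOb_lt (z : El (sections F₂ G₂ hH)) : D.sectionOb hH z < d.sectionList.length :=
  List.idxOf_lt_length_iff.2 (D.sectionCode_mem hH z)

theorem sectionOb_injective : Function.Injective (D.sectionOb hH) := fun _ _ h =>
  D.sectionCode_injective hH ((List.idxOf_inj (D.sectionCode_mem hH _)).1 h)

theorem sectionOb_surjective {i : ℕ} (hi : i < d.sectionList.length) :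
    ∃ z, D.sectionOb hH z = i := by
  obtain ⟨z, hz⟩ := (D.mem_sectionList hH).1 (List.getElem_mem hi)
  refine ⟨z, ?_⟩
  unfold sectionOb
  rw [hz]
  exact d.nodup_sectionList.idxOf_getElem i hi

theorem sectionArrow_iff {z z' : El (sections F₂ G₂ hH)} {u : ℕ} (hu : u < d.B₂.numAr) :
    d.sectionArrow (D.sectionCode hH z) (D.sectionCode hH z') u = true ↔
      ∃ k : z ⟶ z', D.B₂.ar k.hom = u := by
  unfold CompInput.sectionArrow
  have h1 : ∀ g : z.base ⟶ z'.base, (∀ a < d.A₂.numOb, ∀ v < d.B₂.numAr,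
      d.relevant (D.B₂.ob z'.base) a v = true →
        entry (D.sectionCode hH z).2 a (d.B₂.comp (D.B₂.ar g) v) =
          entry (D.sectionCode hH z').2 a v) ↔ (sections F₂ G₂ hH).map g z.elt = z'.elt := by
    intro g
    rw [D.A₂.forall_ob (P := fun a => ∀ v < d.B₂.numAr, _)]
    constructor
    · intro h
      apply Subtype.ext
      funext a v
      apply Subtype.ext
      apply D.B₁.ob_inj
      have h2 := h a _ (D.B₂.ar_lt v) ((D.relevant_iff (D.B₂.ar_lt v)).2 ⟨v, rfl⟩)
      rw [D.B₂.comp_ar, entry_sectionCode, entry_sectionCode] at h2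
      exact h2
    · rintro h a v hv hrel
      obtain ⟨v, rfl⟩ := (D.relevant_iff hv).1 hrel
      rw [D.B₂.comp_ar, entry_sectionCode, entry_sectionCode, ← h]
      rfl
  simp only [Bool.and_eq_true, eqb_iff, List.all_eq_true, List.mem_range, Bool.or_eq_true,
    Bool.not_eq_true', Bool.eq_false_iff, ne_eq, ← imp_iff_not_or]
  constructor
  · rintro ⟨⟨h2, h3⟩, h4⟩
    obtain ⟨g, rfl⟩ := D.B₂.exists_hom hu h2 h3
    exact ⟨⟨g, (h1 g).1 h4⟩, rfl⟩
  · rintro ⟨k, rfl⟩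
    exact ⟨⟨D.B₂.src_ar k.hom, D.B₂.tgt_ar k.hom⟩, (h1 k.hom).2 k.map_elt⟩

theorem mem_sectionArrows {z z' : El (sections F₂ G₂ hH)} {u v : ℕ} :
    (D.sectionOb hH z, D.sectionOb hH z', u, v) ∈ d.sectionArrows ↔
      ∃ k : z ⟶ z', (D.B₂.ar k.hom, 0) = (u, v) := by
  rw [CompInput.mem_sectionArrows]
  dsimp only
  rw [sectionAt_sectionOb, sectionAt_sectionOb]
  constructor
  · rintro ⟨-, -, hu, h, rfl⟩
    obtain ⟨k, rfl⟩ := (D.sectionArrow_iff hH hu).1 h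
    exact ⟨k, rfl⟩
  · rintro ⟨k, h⟩
    obtain ⟨rfl, rfl⟩ := Prod.mk.inj h
    exact ⟨D.sectionOb_lt hH z, D.sectionOb_lt hH z', D.B₂.ar_lt _,
      (D.sectionArrow_iff hH (D.B₂.ar_lt _)).2 ⟨k, rfl⟩, rfl⟩

/-- The table of sections describes the category of sections. -/
noncomputable def sectionPres : Pres d.sectionTable (El (sections F₂ G₂ hH)) :=
  Pres.ofLists (D.sectionOb hH) (D.sectionOb_lt hH) (D.sectionOb_injective hH)
    (fun _ hi => D.sectionOb_surjective hH hi) d.nodup_sectionArrows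
    (fun {z z'} (k : z ⟶ z') => (D.B₂.ar k.hom, 0))
    (fun k l h => El.hom_ext (D.B₂.ar_inj _ _ (congrArg Prod.fst h)))
    (fun k => (D.mem_sectionArrows hH).2 ⟨k, rfl⟩)
    (by
      rintro ⟨i, j, u, v⟩ h
      obtain ⟨hi, hj, -⟩ := CompInput.mem_sectionArrows.1 h
      obtain ⟨z, rfl⟩ := D.sectionOb_surjective hH hi
      obtain ⟨z', rfl⟩ := D.sectionOb_surjective hH hj
      obtain ⟨k, hk⟩ := (D.mem_sectionArrows hH).1 h
      exact ⟨z, z', k, by rw [hk]⟩)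
    (fun z => by
      have h1 : D.sectionOb hH z < (d.sectionList.map fun z => (d.B₂.ident z.1, 0)).length :=
        (D.sectionOb_lt hH z).trans_eq (List.length_map _).symm
      rw [List.getD_eq_getElem _ _ h1, List.getElem_map]
      have h2 := D.sectionAt_sectionOb hH z
      unfold CompInput.sectionAt at h2
      rw [List.getD_eq_getElem _ _ (D.sectionOb_lt hH z)] at h2
      rw [h2]
      exact congrArg (·, 0) (D.B₂.ident_ob z.base))
    (fun {z z' z''} k l => by
      refine (getD_pairTable ((D.mem_sectionArrows hH).2 ⟨k, rfl⟩)
        ((D.mem_sectionArrows hH).2 ⟨l, rfl⟩) _).trans ?_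
      exact congrArg (·, 0) (D.B₂.comp_ar k.hom l.hom))

end CompInput.Describes

end

/-! ### The table of the comma category -/

namespace CompInput

/-- The code of an object of the comma category: an object `a₂` of `A₂`, a section over its
image, an object `a₁` of `A₁`, and an arrow from the value of the section to the image of
`a₁`. -/
abbrev CommaCode : Type := ℕ × ℕ × ℕ × ℕ

/-- The value of the section `z` at the identity arrow of the image of `a`. -/
def evalAt (d : CompInput) (z : SectionCode) (a : ℕ) : ℕ :=
  entry z.2 a (d.B₂.ident (d.G₂.ob a))

/-- The conditions on the objects of the comma category; in the restricted case the arrow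
is an identity. -/
def commaValid (restricted : Bool) (d : CompInput) (O : List SectionCode) (m : CommaCode) : Bool :=
  eqb (sectionAt O m.2.1).1 (d.G₂.ob m.1) &&
    eqb (d.B₁.src m.2.2.2) (d.evalAt (sectionAt O m.2.1) m.1) &&
    eqb (d.B₁.tgt m.2.2.2) (d.G₁.ob m.2.2.1) &&
    (!restricted || eqb m.2.2.2 (d.B₁.ident (d.B₁.src m.2.2.2)))

/-- The objects of the comma category, for a given list of sections. -/
def commaListOf (restricted : Bool) (d : CompInput) (O : List SectionCode) : List CommaCode :=
  ((List.range d.A₂.numOb).flatMap fun a => ((List.range O.length).flatMap fun j =>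
    ((List.range d.A₁.numOb).flatMap fun a' => (List.range d.B₁.numAr).map fun v =>
      (a', v)).map fun m => (j, m)).map fun m => (a, m)).filter (d.commaValid restricted O)

/-- The objects of the comma category. -/
def commaList (restricted : Bool) (d : CompInput) : List CommaCode :=
  d.commaListOf restricted d.sectionList

/-- An object in a list. -/
def commaAt (L : List CommaCode) (i : ℕ) : CommaCode := L.getD i (0, 0, 0, 0)

/-- The pair of an arrow `k` of `A₂` and an arrow `l` of `A₁` is an arrow of the comma category: `k`
is compatible with the sections, for which the arrows `R` of the category of sections are
consulted, and the square over the image `w` of `k` under the evaluation functor commutes. -/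
def commaArrow (d : CompInput) (R : List ArrowCode) (m m' : CommaCode) (k l : ℕ) : Bool :=
  eqb (d.A₂.src k) m.1 && eqb (d.A₂.tgt k) m'.1 && eqb (d.A₁.src l) m.2.2.1 &&
    eqb (d.A₁.tgt l) m'.2.2.1 && R.any (fun r => eqb r (m.2.1, m'.2.1, d.G₂.ar k, 0)) &&
    (List.range d.B₁.numAr).any fun w => eqb (d.B₁.src w) (d.B₁.src m.2.2.2) &&
      eqb (d.B₁.tgt w) (d.B₁.src m'.2.2.2) && eqb (d.H₁.ar w) (d.F₂.ar k) &&
      eqb (d.B₁.comp w m'.2.2.2) (d.B₁.comp m.2.2.2 (d.G₁.ar l))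

/-- The arrows between the objects of a list. -/
def commaArrowsOf (d : CompInput) (R : List ArrowCode) (L : List CommaCode) : List ArrowCode :=
  (List.range L.length).flatMap fun i => ((List.range L.length).flatMap fun j =>
    (((List.range d.A₂.numAr).flatMap fun k => (List.range d.A₁.numAr).map fun l =>
      (k, l)).filter fun kl => d.commaArrow R (commaAt L i) (commaAt L j) kl.1 kl.2).map
        fun kl => (j, kl)).map fun r => (i, r)

/-- The arrows of the comma category. -/
def commaArrows (restricted : Bool) (d : CompInput) : List ArrowCode :=
  d.commaArrowsOf d.sectionArrows (d.commaList restricted)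

/-- The table of the comma category. -/
def commaTable (restricted : Bool) (d : CompInput) : CatTable :=
  tableOfLists (d.commaList restricted).length (d.commaArrows restricted)
    ((d.commaList restricted).map fun m => (d.A₂.ident m.1, d.A₁.ident m.2.2.1))
    (pairTable (d.commaArrows restricted) fun r s =>
      (d.A₂.comp r.2.2.1 s.2.2.1, d.A₁.comp r.2.2.2 s.2.2.2))

end CompInput

/-! ### The table of the comma category describes it -/

theorem mem_flatMap_map_pair {α β : Type*} {L : List α} {K : α → List β} {x : α × β} :
    (x ∈ L.flatMap fun a => (K a).map fun b => (a, b)) ↔ x.1 ∈ L ∧ x.2 ∈ K x.1 := by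
  obtain ⟨a, b⟩ := x
  simp only [List.mem_flatMap, List.mem_map, Prod.mk.injEq]
  constructor
  · rintro ⟨a, ha, b, hb, rfl, rfl⟩
    exact ⟨ha, hb⟩
  · rintro ⟨ha, hb⟩
    exact ⟨a, ha, b, hb, rfl, rfl⟩

theorem CompInput.mem_commaList {restricted : Bool} {d : CompInput} {m : CompInput.CommaCode} :
    m ∈ d.commaList restricted ↔ (m.1 < d.A₂.numOb ∧ m.2.1 < d.sectionList.length ∧
      m.2.2.1 < d.A₁.numOb ∧ m.2.2.2 < d.B₁.numAr) ∧
        d.commaValid restricted d.sectionList m = true := by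
  unfold CompInput.commaList CompInput.commaListOf
  rw [List.mem_filter, mem_flatMap_map_pair, mem_flatMap_map_pair, mem_flatMap_map_pair]
  simp only [List.mem_range]

theorem CompInput.nodup_commaList (restricted : Bool) (d : CompInput) :
    (d.commaList restricted).Nodup := by
  refine List.Nodup.filter _ ?_
  refine nodup_flatMap_map List.nodup_range (fun _ => ?_) fun a b a' b' h => Prod.mk.inj h
  refine nodup_flatMap_map List.nodup_range (fun _ => ?_) fun a b a' b' h => Prod.mk.inj h
  exact nodup_flatMap_map List.nodup_range (fun _ => List.nodup_range)
    fun a b a' b' h => Prod.mk.inj h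

theorem CompInput.mem_commaArrows {restricted : Bool} {d : CompInput} {r : ArrowCode} :
    r ∈ d.commaArrows restricted ↔ r.1 < (d.commaList restricted).length ∧
      r.2.1 < (d.commaList restricted).length ∧ (r.2.2.1 < d.A₂.numAr ∧ r.2.2.2 < d.A₁.numAr) ∧
        d.commaArrow d.sectionArrows (commaAt (d.commaList restricted) r.1)
          (commaAt (d.commaList restricted) r.2.1) r.2.2.1 r.2.2.2 = true := by
  unfold CompInput.commaArrows CompInput.commaArrowsOf
  rw [mem_flatMap_map_pair, mem_flatMap_map_pair, List.mem_filter, mem_flatMap_map_pair]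
  simp only [List.mem_range, and_assoc]

theorem CompInput.nodup_commaArrows (restricted : Bool) (d : CompInput) :
    (d.commaArrows restricted).Nodup := by
  refine nodup_flatMap_map List.nodup_range (fun _ => ?_) fun a b a' b' h => Prod.mk.inj h
  refine nodup_flatMap_map List.nodup_range (fun _ => List.Nodup.filter _ ?_)
    fun a b a' b' h => Prod.mk.inj h
  exact nodup_flatMap_map List.nodup_range (fun _ => List.nodup_range)
    fun a b a' b' h => Prod.mk.inj h

section

variable {A₁ B₁ X A₂ B₂ : Type} [Category.{0} A₁] [Category.{0} B₁] [Category.{0} X]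
  [Category.{0} A₂] [Category.{0} B₂]

/-- The class of arrows of the comma category: all arrows, or, in the restricted case, the
identities. -/
def commaClass (restricted : Bool) (F₂ : A₂ ⥤ X) (G₂ : A₂ ⥤ B₂) {H₁ : B₁ ⥤ X}
    (hH : IsDiscreteOpfibration H₁) (G₁ : A₁ ⥤ B₁) :
    ∀ c a, ((evalFunctor F₂ G₂ hH).obj c ⟶ G₁.obj a) → Prop := fun c a v =>
  restricted = true → CommaOn.IsEqToHom (evalFunctor F₂ G₂ hH) G₁ c a v

theorem Pres.ar_eq_ident_iff {t : CatTable} {C : Type} [Category.{0} C] (p : Pres t C) {x y : C}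
    (k : x ⟶ y) : p.ar k = t.ident (p.ob x) ↔ ∃ h : x = y, k = eqToHom h := by
  constructor
  · intro h
    rw [p.ident_ob] at h
    have h1 : x = y := p.ob_inj ((p.tgt_ar (𝟙 x)).symm.trans (by rw [← h, p.tgt_ar]))
    subst h1
    exact ⟨rfl, p.ar_inj _ _ h⟩
  · rintro ⟨rfl, rfl⟩
    exact (p.ident_ob x).symm

namespace CompInput.Describes

variable {d : CompInput} {G₁ : A₁ ⥤ B₁} {H₁ : B₁ ⥤ X} {F₂ : A₂ ⥤ X} {G₂ : A₂ ⥤ B₂}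
  (D : d.Describes G₁ H₁ F₂ G₂) (hH : IsDiscreteOpfibration H₁) (restricted : Bool)

theorem evalAt_eq (c : El (G₂ ⋙ sections F₂ G₂ hH)) :
    d.evalAt (D.sectionCode hH ((elBaseChange F₂ G₂ hH).obj c)) (D.A₂.ob c.base) =
      D.B₁.ob ((evalFunctor F₂ G₂ hH).obj c) := by
  unfold CompInput.evalAt
  rw [D.G₂.ob, D.B₂.ident_ob]
  exact D.entry_sectionCode hH ((elBaseChange F₂ G₂ hH).obj c) c.base (𝟙 _)

/-- The code of an object of the comma category. -/
noncomputable def commaCode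
    (m : CommaOn (evalFunctor F₂ G₂ hH) G₁ (commaClass restricted F₂ G₂ hH G₁)) :
    CompInput.CommaCode :=
  (D.A₂.ob m.left.base, D.sectionOb hH ((elBaseChange F₂ G₂ hH).obj m.left), D.A₁.ob m.right,
    D.B₁.ar m.hom)

theorem commaCode_injective : Function.Injective (D.commaCode hH restricted) := by
  rintro ⟨⟨a, s⟩, a', v, hv⟩ ⟨⟨b, t⟩, b', v', hv'⟩ h
  obtain ⟨h1, h2⟩ := Prod.mk.inj h
  obtain ⟨h2, h3⟩ := Prod.mk.inj h2
  obtain ⟨h3, h4⟩ := Prod.mk.inj h3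
  obtain rfl : a = b := D.A₂.ob_inj h1
  have h5 : (⟨G₂.obj a, s⟩ : El (sections F₂ G₂ hH)) = ⟨G₂.obj a, t⟩ := D.sectionOb_injective hH h2
  obtain rfl : s = t := eq_of_heq (El.mk.inj h5).2
  obtain rfl : a' = b' := D.A₁.ob_inj h3
  obtain rfl : v = v' := D.B₁.ar_inj _ _ h4
  rfl

/-- The list of objects of the comma category is complete, and it contains nothing else. -/
theorem mem_commaList {m : CompInput.CommaCode} :
    m ∈ d.commaList restricted ↔ ∃ x, D.commaCode hH restricted x = m := by
  rw [CompInput.mem_commaList]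
  unfold CompInput.commaValid
  simp only [Bool.and_eq_true, Bool.or_eq_true, eqb_iff, Bool.not_eq_true', Bool.eq_false_iff,
    ne_eq, ← imp_iff_not_or]
  constructor
  · rintro ⟨⟨h1, h2, h3, h4⟩, ⟨⟨h5, h6⟩, h7⟩, h8⟩
    obtain ⟨i, j, i', r⟩ := m
    dsimp only at h1 h2 h3 h4 h5 h6 h7 h8
    obtain ⟨a, rfl⟩ := D.A₂.ob_surj i h1
    obtain ⟨⟨b, s⟩, rfl⟩ := D.sectionOb_surjective hH h2
    obtain ⟨a', rfl⟩ := D.A₁.ob_surj i' h3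
    rw [sectionAt_sectionOb, D.G₂.ob] at h5
    obtain rfl : b = G₂.obj a := D.B₂.ob_inj h5
    rw [sectionAt_sectionOb] at h6
    rw [D.G₁.ob] at h7
    have h9 := h6.trans (D.evalAt_eq hH ⟨a, s⟩)
    obtain ⟨v, rfl⟩ := D.B₁.exists_hom h4 h9 h7
    refine ⟨⟨⟨a, s⟩, a', v, fun hr => ?_⟩, rfl⟩
    exact (D.B₁.ar_eq_ident_iff v).1 ((h8 hr).trans (by rw [D.B₁.src_ar]))
  · rintro ⟨⟨c, a', v, hv⟩, rfl⟩
    unfold commaCode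
    dsimp only
    rw [sectionAt_sectionOb, evalAt_eq, D.B₁.src_ar, D.B₁.tgt_ar, D.G₂.ob, D.G₁.ob]
    exact ⟨⟨D.A₂.ob_lt _, D.sectionOb_lt hH _, D.A₁.ob_lt _, D.B₁.ar_lt _⟩,
      ⟨⟨rfl, rfl⟩, rfl⟩, fun hr => (D.B₁.ar_eq_ident_iff v).2 (hv hr)⟩

/-- The number of an object of the comma category. -/
noncomputable def commaOb
    (m : CommaOn (evalFunctor F₂ G₂ hH) G₁ (commaClass restricted F₂ G₂ hH G₁)) : ℕ :=
  (d.commaList restricted).idxOf (D.commaCode hH restricted m)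

theorem commaCode_mem (m) : D.commaCode hH restricted m ∈ d.commaList restricted :=
  (D.mem_commaList hH restricted).2 ⟨m, rfl⟩

theorem commaAt_commaOb (m) :
    CompInput.commaAt (d.commaList restricted) (D.commaOb hH restricted m) =
      D.commaCode hH restricted m :=
  List.getD_idxOf (D.commaCode_mem hH restricted m) _

theorem commaOb_lt (m) : D.commaOb hH restricted m < (d.commaList restricted).length :=
  List.idxOf_lt_length_iff.2 (D.commaCode_mem hH restricted m)

theorem commaOb_injective : Function.Injective (D.commaOb hH restricted) := fun _ _ h =>
  D.commaCode_injective hH restricted ((List.idxOf_inj (D.commaCode_mem hH restricted _)).1 h)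

theorem commaOb_surjective {i : ℕ} (hi : i < (d.commaList restricted).length) :
    ∃ m, D.commaOb hH restricted m = i := by
  obtain ⟨m, hm⟩ := (D.mem_commaList hH restricted).1 (List.getElem_mem hi)
  refine ⟨m, ?_⟩
  unfold commaOb
  rw [hm]
  exact (d.nodup_commaList restricted).idxOf_getElem i hi

/-- The image of an arrow under the evaluation functor is the unique arrow over the image under
`F₂`. -/
theorem ar_evalFunctor {c c' : El (G₂ ⋙ sections F₂ G₂ hH)} (κ : c ⟶ c')
    (w : (evalFunctor F₂ G₂ hH).obj c ⟶ (evalFunctor F₂ G₂ hH).obj c') :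
    d.H₁.ar (D.B₁.ar w) = D.X.ar (F₂.map κ.hom) ↔ w = (evalFunctor F₂ G₂ hH).map κ := by
  have h1 : IsDiscreteOpfibration.Over (c.elt.1 c.base (𝟙 _)) (c'.elt.1 c'.base (𝟙 _))
      (F₂.map κ.hom) ((evalFunctor F₂ G₂ hH).map κ) :=
    hH.over_total ((evalSection F₂ G₂ hH).map κ)
  have h2 := D.over_iff (F₂.map κ.hom) (c.elt.1 c.base (𝟙 _)) (c'.elt.1 c'.base (𝟙 _)) w
  constructor
  · intro h
    exact hH.over_unique (h2.2 h) h1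
  · rintro rfl
    exact h2.1 h1

theorem commaArrow_iff
    {m m' : CommaOn (evalFunctor F₂ G₂ hH) G₁ (commaClass restricted F₂ G₂ hH G₁)} {k l : ℕ}
    (hk : k < d.A₂.numAr) (hl : l < d.A₁.numAr) :
    d.commaArrow d.sectionArrows (D.commaCode hH restricted m) (D.commaCode hH restricted m') k l =
      true ↔ ∃ f : m ⟶ m', D.A₂.ar f.left.hom = k ∧ D.A₁.ar f.right = l := by
  unfold CompInput.commaArrow commaCode
  simp only [Bool.and_eq_true, eqb_iff, List.any_eq_true, List.mem_range, D.B₁.src_ar]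
  constructor
  · rintro ⟨⟨⟨⟨⟨h1, h2⟩, h3⟩, h4⟩, ⟨_, h5, rfl⟩⟩, w, hw, ⟨⟨h6, h7⟩, h8⟩, h9⟩
    obtain ⟨k, rfl⟩ := D.A₂.exists_hom hk h1 h2
    obtain ⟨l, rfl⟩ := D.A₁.exists_hom hl h3 h4
    rw [D.G₂.ar] at h5
    obtain ⟨φ, hφ⟩ := (D.mem_sectionArrows hH).1 h5
    have hφ' : El.Hom.hom φ = G₂.map k := D.B₂.ar_inj _ _ (congrArg Prod.fst hφ)
    let κ : m.left ⟶ m'.left := ⟨k, by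
      have h10 := φ.map_elt
      rw [hφ'] at h10
      exact h10⟩
    obtain ⟨w, rfl⟩ := D.B₁.exists_hom hw h6 h7
    rw [D.F₂.ar] at h8
    obtain rfl := (D.ar_evalFunctor hH κ w).1 h8
    rw [D.G₁.ar, D.B₁.comp_ar, D.B₁.comp_ar] at h9
    exact ⟨⟨κ, l, D.B₁.ar_inj _ _ h9⟩, rfl, rfl⟩
  · rintro ⟨f, rfl, rfl⟩
    refine ⟨⟨⟨⟨⟨D.A₂.src_ar _, D.A₂.tgt_ar _⟩, D.A₁.src_ar _⟩, D.A₁.tgt_ar _⟩, _,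
      (D.mem_sectionArrows hH).2 ⟨(elBaseChange F₂ G₂ hH).map f.left, rfl⟩, ?_⟩,
      D.B₁.ar ((evalFunctor F₂ G₂ hH).map f.left), D.B₁.ar_lt _,
      ⟨⟨D.B₁.src_ar _, D.B₁.tgt_ar _⟩, ?_⟩, ?_⟩
    · rw [D.G₂.ar]
      rfl
    · rw [D.F₂.ar]
      exact (D.ar_evalFunctor hH f.left _).2 rfl
    · rw [D.G₁.ar, D.B₁.comp_ar, D.B₁.comp_ar, f.w]

theorem mem_commaArrows
    {m m' : CommaOn (evalFunctor F₂ G₂ hH) G₁ (commaClass restricted F₂ G₂ hH G₁)} {k l : ℕ} :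
    (D.commaOb hH restricted m, D.commaOb hH restricted m', k, l) ∈ d.commaArrows restricted ↔
      ∃ f : m ⟶ m', (D.A₂.ar f.left.hom, D.A₁.ar f.right) = (k, l) := by
  rw [CompInput.mem_commaArrows]
  dsimp only
  rw [commaAt_commaOb, commaAt_commaOb]
  constructor
  · rintro ⟨-, -, ⟨hk, hl⟩, h⟩
    obtain ⟨f, rfl, rfl⟩ := (D.commaArrow_iff hH restricted hk hl).1 h
    exact ⟨f, rfl⟩
  · rintro ⟨f, h⟩
    obtain ⟨rfl, rfl⟩ := Prod.mk.inj h
    exact ⟨D.commaOb_lt hH _ m, D.commaOb_lt hH _ m', ⟨D.A₂.ar_lt _, D.A₁.ar_lt _⟩,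
      (D.commaArrow_iff hH restricted (D.A₂.ar_lt _) (D.A₁.ar_lt _)).2 ⟨f, rfl, rfl⟩⟩

/-- The table of the comma category describes it. -/
noncomputable def commaPres : Pres (d.commaTable restricted)
    (CommaOn (evalFunctor F₂ G₂ hH) G₁ (commaClass restricted F₂ G₂ hH G₁)) :=
  Pres.ofLists (D.commaOb hH restricted) (D.commaOb_lt hH restricted)
    (D.commaOb_injective hH restricted) (fun _ hi => D.commaOb_surjective hH restricted hi)
    (d.nodup_commaArrows restricted)
    (fun {m m'} (f : m ⟶ m') => (D.A₂.ar f.left.hom, D.A₁.ar f.right))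
    (fun f f' h => CommaOn.hom_ext (El.hom_ext (D.A₂.ar_inj _ _ (Prod.mk.inj h).1))
      (D.A₁.ar_inj _ _ (Prod.mk.inj h).2))
    (fun f => (D.mem_commaArrows hH restricted).2 ⟨f, rfl⟩)
    (by
      rintro ⟨i, j, k, l⟩ h
      obtain ⟨hi, hj, -⟩ := CompInput.mem_commaArrows.1 h
      obtain ⟨m, rfl⟩ := D.commaOb_surjective hH restricted hi
      obtain ⟨m', rfl⟩ := D.commaOb_surjective hH restricted hj
      obtain ⟨f, hf⟩ := (D.mem_commaArrows hH restricted).1 h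
      exact ⟨m, m', f, by rw [hf]⟩)
    (fun m => by
      have h1 : D.commaOb hH restricted m < ((d.commaList restricted).map fun m =>
          (d.A₂.ident m.1, d.A₁.ident m.2.2.1)).length :=
        (D.commaOb_lt hH restricted m).trans_eq (List.length_map _).symm
      rw [List.getD_eq_getElem _ _ h1, List.getElem_map]
      have h2 := D.commaAt_commaOb hH restricted m
      unfold CompInput.commaAt at h2
      rw [List.getD_eq_getElem _ _ (D.commaOb_lt hH restricted m)] at h2
      rw [h2]
      exact Prod.ext (D.A₂.ident_ob m.left.base) (D.A₁.ident_ob m.right))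
    (fun {m m' m''} f f' => by
      refine (getD_pairTable ((D.mem_commaArrows hH restricted).2 ⟨f, rfl⟩)
        ((D.mem_commaArrows hH restricted).2 ⟨f', rfl⟩) _).trans ?_
      exact Prod.ext (D.A₂.comp_ar f.left.hom f'.left.hom) (D.A₁.comp_ar f.right f'.right))

end CompInput.Describes

end

/-! ### Attributes of the composite -/

/-- The first number below `n` with a given property, or `0`. -/
def firstBelow (n : ℕ) (p : ℕ → Bool) : ℕ := ((List.range n).filter p).headD 0

theorem firstBelow_eq {n : ℕ} {p : ℕ → Bool} {i : ℕ} (hi : i < n) (h : p i = true)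
    (hu : ∀ j < n, p j = true → j = i) : firstBelow n p = i := by
  have h1 : ∀ j ∈ (List.range n).filter p, j = i := fun j hj =>
    hu j (List.mem_range.1 (List.mem_filter.1 hj).1) (List.mem_filter.1 hj).2
  have h2 : i ∈ (List.range n).filter p := List.mem_filter.2 ⟨List.mem_range.2 hi, h⟩
  unfold firstBelow
  cases h3 : (List.range n).filter p with
  | nil =>
    rw [h3] at h2
    exact (List.not_mem_nil h2).elim
  | cons j l =>
    rw [h3] at h1
    exact h1 j List.mem_cons_self

/-- The nodes of the attributes of `A₁`, `A₂`, `B₂` and the attribute maps of `G₁`, `H₁`, `F₂`,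
`G₂`. -/
abbrev AttrTable : Type :=
  (List ℕ × List ℕ × List ℕ) × (List ℕ × List ℕ × List ℕ × List ℕ)

namespace AttrTable

/-- The nodes of the attributes of `A₁`. -/
def nodeA₁ (t : AttrTable) : List ℕ := t.1.1
/-- The nodes of the attributes of `A₂`. -/
def nodeA₂ (t : AttrTable) : List ℕ := t.1.2.1
/-- The nodes of the attributes of `B₂`. -/
def nodeB₂ (t : AttrTable) : List ℕ := t.1.2.2
/-- The attribute map of `G₁`. -/
def G₁ (t : AttrTable) : List ℕ := t.2.1
/-- The attribute map of `H₁`. -/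
def H₁ (t : AttrTable) : List ℕ := t.2.2.1
/-- The attribute map of `F₂`. -/
def F₂ (t : AttrTable) : List ℕ := t.2.2.2.1
/-- The attribute map of `G₂`. -/
def G₂ (t : AttrTable) : List ℕ := t.2.2.2.2

/-- The attribute of `A₂` over an attribute of `B₂`. -/
def attrA₂ (t : AttrTable) (β : ℕ) : ℕ :=
  firstBelow t.nodeA₂.length fun α => eqb (t.G₂.getD α 0) β

end AttrTable

namespace CompInput

/-- The attributes of the composite: the pairs of an attribute of `B₂` and a section over its
node. -/
def attrList (d : CompInput) (t : AttrTable) : List (ℕ × ℕ) :=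
  (List.range t.nodeB₂.length).flatMap fun β =>
    ((List.range d.sectionList.length).filter fun j =>
      eqb (sectionAt d.sectionList j).1 (t.nodeB₂.getD β 0)).map fun j => (β, j)

/-- The value of the section of an attribute at the node of `A₂` of that attribute. -/
def attrValue (d : CompInput) (t : AttrTable) (p : ℕ × ℕ) : ℕ :=
  d.evalAt (sectionAt d.sectionList p.2) (t.nodeA₂.getD (t.attrA₂ p.1) 0)

/-- The attribute of `A₁` from which an attribute of the composite takes its values. -/
def attrA₁ (d : CompInput) (t : AttrTable) (p : ℕ × ℕ) : ℕ :=
  firstBelow t.nodeA₁.length fun γ => eqb (d.G₁.ob (t.nodeA₁.getD γ 0)) (d.attrValue t p) &&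
    eqb (t.H₁.getD (t.G₁.getD γ 0) 0) (t.F₂.getD (t.attrA₂ p.1) 0)

/-- The object of the comma category to which an attribute of the composite belongs. -/
def attrComma (restricted : Bool) (d : CompInput) (t : AttrTable) (p : ℕ × ℕ) : ℕ :=
  (d.commaList restricted).idxOf (t.nodeA₂.getD (t.attrA₂ p.1) 0, p.2,
    t.nodeA₁.getD (d.attrA₁ t p) 0, d.B₁.ident (d.attrValue t p))

end CompInput

section

variable {τ : Type u} {A₁ B₁ X A₂ B₂ : TypedSignature τ} {G₁ : TypedMorphism A₁ B₁}
  {H₁ : TypedMorphism B₁ X} {F₂ : TypedMorphism A₂ X} {G₂ : TypedMorphism A₂ B₂}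

/-- An attribute of `B₂` with a section over its node. -/
structure SectionAttr (hH : H₁.IsSigmaReady) (F₂ : TypedMorphism A₂ X)
    (G₂ : TypedMorphism A₂ B₂) where
  attr : Fin B₂.numAttrs
  sec : El (sections F₂.functor G₂.functor hH.opfibration)
  base_eq : sec.base = B₂.attrOb attr

namespace SectionAttr

variable {hH : H₁.IsSigmaReady} (s : SectionAttr hH F₂ G₂) (hG₂ : G₂.IsPiReady)
  (hG₁ : G₁.IsPiReady)

/-- The attribute of `A₂` that `G₂` sends to the given attribute of `B₂`. -/
noncomputable def attrA₂ : Fin A₂.numAttrs := TypedMorphism.piAttr hG₂ s.attr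

theorem onAttr_attrA₂ : G₂.onAttr (s.attrA₂ hG₂) = s.attr := TypedMorphism.onAttr_piAttr hG₂ s.attr

theorem base_eq_obj : s.sec.base = G₂.functor.obj (A₂.attrOb (s.attrA₂ hG₂)) :=
  s.base_eq.trans ((G₂.attrOb_comm _).trans (congrArg B₂.attrOb (s.onAttr_attrA₂ hG₂))).symm

/-- The section over the node of the attribute of `A₂`. -/
noncomputable def left : El (G₂.functor ⋙ sections F₂.functor G₂.functor hH.opfibration) :=
  ⟨A₂.attrOb (s.attrA₂ hG₂), (sections F₂.functor G₂.functor hH.opfibration).map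
    (eqToHom (s.base_eq_obj hG₂)) s.sec.elt⟩

theorem elBaseChange_left :
    (elBaseChange F₂.functor G₂.functor hH.opfibration).obj (s.left hG₂) = s.sec := by
  have key : ∀ (z : El (sections F₂.functor G₂.functor hH.opfibration)) {b : B₂.Schema}
      (h : z.base = b), (⟨b, (sections F₂.functor G₂.functor hH.opfibration).map
        (eqToHom h) z.elt⟩ : El (sections F₂.functor G₂.functor hH.opfibration)) = z := by
    rintro ⟨b, x⟩ _ rfl
    exact congrArg (El.mk b) ((sections F₂.functor G₂.functor hH.opfibration).map_id_apply b x)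
  exact key s.sec (s.base_eq_obj hG₂)

/-- The value of the section at the node of the attribute of `A₂`. -/
noncomputable def value : B₁.Schema :=
  (evalFunctor F₂.functor G₂.functor hH.opfibration).obj (s.left hG₂)

theorem obj_value : H₁.functor.obj (s.value hG₂) = X.attrOb (F₂.onAttr (s.attrA₂ hG₂)) :=
  (congrArg (fun t => t.obj (s.left hG₂)) (evalFunctor_comp F₂.functor G₂.functor
    hH.opfibration)).trans (F₂.attrOb_comm _)

/-- The attribute of `B₁`: the one at the value of the section over the attribute of `X`, by the
fiber product property of `H₁`. -/
noncomputable def attrB₁ : Fin B₁.numAttrs := hH.attr _ ⟨s.value hG₂, s.obj_value hG₂⟩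

/-- The attribute of `A₁` that `G₁` sends to the attribute of `B₁`. -/
noncomputable def attrA₁ : Fin A₁.numAttrs := TypedMorphism.piAttr hG₁ (s.attrB₁ hG₂)

theorem onAttr_attrA₁ : G₁.onAttr (s.attrA₁ hG₂ hG₁) = s.attrB₁ hG₂ :=
  TypedMorphism.onAttr_piAttr hG₁ _

theorem onAttr_onAttr_attrA₁ :
    H₁.onAttr (G₁.onAttr (s.attrA₁ hG₂ hG₁)) = F₂.onAttr (s.attrA₂ hG₂) := by
  rw [onAttr_attrA₁]
  exact hH.onAttr_attr _ ⟨s.value hG₂, s.obj_value hG₂⟩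

theorem obj_attrA₁ :
    G₁.functor.obj (A₁.attrOb (s.attrA₁ hG₂ hG₁)) = s.value hG₂ :=
  (G₁.attrOb_comm _).trans ((congrArg B₁.attrOb (s.onAttr_attrA₁ hG₂ hG₁)).trans
    (hH.attrOb_attr _ ⟨s.value hG₂, s.obj_value hG₂⟩))

/-- The attribute of `A₁` is determined by its node and by its attribute of `X`. -/
theorem eq_attrA₁ {γ : Fin A₁.numAttrs} (h : G₁.functor.obj (A₁.attrOb γ) = s.value hG₂)
    (h' : H₁.onAttr (G₁.onAttr γ) = F₂.onAttr (s.attrA₂ hG₂)) : γ = s.attrA₁ hG₂ hG₁ := by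
  apply hG₁.1
  refine (hH.attr_pullback (s.value hG₂) _ (s.obj_value hG₂)).unique
    ⟨(G₁.attrOb_comm _).symm.trans h, h'⟩
    ⟨(G₁.attrOb_comm _).symm.trans (s.obj_attrA₁ hG₂ hG₁), s.onAttr_onAttr_attrA₁ hG₂ hG₁⟩

theorem attrType_attrA₁ : A₁.attrType (s.attrA₁ hG₂ hG₁) = B₂.attrType s.attr := by
  rw [← G₁.attrType_comm, ← H₁.attrType_comm, onAttr_onAttr_attrA₁, F₂.attrType_comm,
    ← G₂.attrType_comm, onAttr_attrA₂]

/-- The object of the comma category to which the attribute belongs. Its arrow is an identity, so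
it exists in the restricted case as well. -/
noncomputable def comma (restricted : Bool) :
    CommaOn (evalFunctor F₂.functor G₂.functor hH.opfibration) G₁.functor
      (commaClass restricted F₂.functor G₂.functor hH.opfibration G₁.functor) :=
  ⟨s.left hG₂, A₁.attrOb (s.attrA₁ hG₂ hG₁), eqToHom (s.obj_attrA₁ hG₂ hG₁).symm,
    fun _ => ⟨_, rfl⟩⟩

end SectionAttr

/-- The table `t` describes the attributes. -/
structure AttrTable.Describes {d : CompInput} (t : AttrTable)
    (D : d.Describes G₁.functor H₁.functor F₂.functor G₂.functor) : Prop where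
  nodeA₁ : t.nodeA₁ = List.ofFn fun a => D.A₁.ob (A₁.attrOb a)
  nodeA₂ : t.nodeA₂ = List.ofFn fun a => D.A₂.ob (A₂.attrOb a)
  nodeB₂ : t.nodeB₂ = List.ofFn fun a => D.B₂.ob (B₂.attrOb a)
  G₁ : t.G₁ = List.ofFn fun a => (G₁.onAttr a).val
  H₁ : t.H₁ = List.ofFn fun a => (H₁.onAttr a).val
  F₂ : t.F₂ = List.ofFn fun a => (F₂.onAttr a).val
  G₂ : t.G₂ = List.ofFn fun a => (G₂.onAttr a).val

namespace AttrTable.Describes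

variable {d : CompInput} {t : AttrTable}
  {D : d.Describes G₁.functor H₁.functor F₂.functor G₂.functor}
  (hH : H₁.IsSigmaReady) (hG₂ : G₂.IsPiReady) (hG₁ : G₁.IsPiReady)

theorem mem_attrList (E : t.Describes D) {p : ℕ × ℕ} : p ∈ d.attrList t ↔
    ∃ s : SectionAttr hH F₂ G₂, (s.attr.val, D.sectionOb hH.opfibration s.sec) = p := by
  unfold CompInput.attrList
  rw [mem_flatMap_map_pair, List.mem_filter, List.mem_range, List.mem_range, eqb_iff, E.nodeB₂,
    List.length_ofFn]
  constructor
  · obtain ⟨β, j⟩ := p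
    rintro ⟨hβ, hj, h⟩
    obtain ⟨z, rfl⟩ := D.sectionOb_surjective hH.opfibration hj
    dsimp only at hβ h
    rw [D.sectionAt_sectionOb] at h
    have h1 := h.trans (List.getD_ofFn _ (⟨β, hβ⟩ : Fin B₂.numAttrs) 0)
    exact ⟨⟨⟨β, hβ⟩, z, D.B₂.ob_inj h1⟩, rfl⟩
  · rintro ⟨s, rfl⟩
    refine ⟨s.attr.2, D.sectionOb_lt hH.opfibration s.sec, ?_⟩
    dsimp only
    rw [D.sectionAt_sectionOb, List.getD_ofFn, ← s.base_eq]
    rfl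

theorem nodup_attrList (d : CompInput) (t : AttrTable) : (d.attrList t).Nodup :=
  nodup_flatMap_map List.nodup_range (fun _ => List.Nodup.filter _ List.nodup_range)
    fun _ _ _ _ h => Prod.mk.inj h

/-- The attribute of the composite of a given number. -/
noncomputable def attrAt (E : t.Describes D) (i : Fin (d.attrList t).length) :
    SectionAttr hH F₂ G₂ :=
  ((E.mem_attrList hH).1 (List.getElem_mem i.2)).choose

theorem attrAt_spec (E : t.Describes D) (i : Fin (d.attrList t).length) :
    ((E.attrAt hH i).attr.val, D.sectionOb hH.opfibration (E.attrAt hH i).sec) =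
      (d.attrList t)[i.val] :=
  ((E.mem_attrList hH).1 (List.getElem_mem i.2)).choose_spec

theorem existsUnique_attrAt (E : t.Describes D) (β : Fin B₂.numAttrs)
    (z : El (sections F₂.functor G₂.functor hH.opfibration)) (h : z.base = B₂.attrOb β) :
    ∃! i, (E.attrAt hH i).sec = z ∧ (E.attrAt hH i).attr = β := by
  obtain ⟨i, hi, h1⟩ := List.getElem_of_mem ((E.mem_attrList hH).2 ⟨⟨β, z, h⟩, rfl⟩)
  refine ⟨⟨i, hi⟩, ?_, ?_⟩
  · have h2 := (E.attrAt_spec hH ⟨i, hi⟩).trans h1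
    exact ⟨D.sectionOb_injective hH.opfibration (Prod.mk.inj h2).2,
      Fin.ext (Prod.mk.inj h2).1⟩
  · rintro ⟨j, hj⟩ ⟨h2, h3⟩
    have h4 := E.attrAt_spec hH ⟨j, hj⟩
    rw [h2, h3] at h4
    exact Fin.ext (((nodup_attrList d t).getElem_inj_iff).1 (h4.symm.trans h1.symm))

variable (s : SectionAttr hH F₂ G₂)

theorem attrA₂_eq (E : t.Describes D) : t.attrA₂ s.attr.val = (s.attrA₂ hG₂).val := by
  unfold AttrTable.attrA₂
  rw [E.nodeA₂, E.G₂, List.length_ofFn]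
  refine firstBelow_eq (s.attrA₂ hG₂).2 (eqb_iff.2 ?_) fun α hα h => ?_
  · rw [List.getD_ofFn, s.onAttr_attrA₂]
  · have h1 := (List.getD_ofFn _ (⟨α, hα⟩ : Fin A₂.numAttrs) 0).symm.trans (eqb_iff.1 h)
    exact congrArg Fin.val (hG₂.1 ((Fin.ext h1).trans (s.onAttr_attrA₂ hG₂).symm))

theorem nodeA₂_eq (E : t.Describes D) : t.nodeA₂.getD (t.attrA₂ s.attr.val) 0 =
    D.A₂.ob (A₂.attrOb (s.attrA₂ hG₂)) := by
  rw [E.attrA₂_eq hH hG₂, E.nodeA₂, List.getD_ofFn]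

theorem attrValue_eq (E : t.Describes D) :
    d.attrValue t (s.attr.val, D.sectionOb hH.opfibration s.sec) =
    D.B₁.ob (s.value hG₂) := by
  unfold CompInput.attrValue
  dsimp only
  rw [E.nodeA₂_eq hH hG₂, D.sectionAt_sectionOb]
  have h1 := D.evalAt_eq hH.opfibration (s.left hG₂)
  rw [s.elBaseChange_left hG₂] at h1
  exact h1

theorem attrA₁_eq (E : t.Describes D) :
    d.attrA₁ t (s.attr.val, D.sectionOb hH.opfibration s.sec) =
    (s.attrA₁ hG₂ hG₁).val := by
  unfold CompInput.attrA₁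
  rw [E.attrValue_eq hH hG₂, E.attrA₂_eq hH hG₂, E.F₂, List.getD_ofFn, E.nodeA₁, E.G₁, E.H₁,
    List.length_ofFn]
  have key : ∀ γ : Fin A₁.numAttrs, (eqb (d.G₁.ob ((List.ofFn fun a =>
      D.A₁.ob (A₁.attrOb a)).getD γ 0)) (D.B₁.ob (s.value hG₂)) &&
      eqb ((List.ofFn fun a => (H₁.onAttr a).val).getD ((List.ofFn fun a =>
        (G₁.onAttr a).val).getD γ 0) 0) (F₂.onAttr (s.attrA₂ hG₂)).val) = true ↔
      G₁.functor.obj (A₁.attrOb γ) = s.value hG₂ ∧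
        H₁.onAttr (G₁.onAttr γ) = F₂.onAttr (s.attrA₂ hG₂) := by
    intro γ
    rw [Bool.and_eq_true, eqb_iff, eqb_iff, List.getD_ofFn, List.getD_ofFn, List.getD_ofFn,
      D.G₁.ob, D.B₁.ob_inj.eq_iff, Fin.val_inj]
  exact firstBelow_eq (s.attrA₁ hG₂ hG₁).2
    ((key _).2 ⟨s.obj_attrA₁ hG₂ hG₁, s.onAttr_onAttr_attrA₁ hG₂ hG₁⟩)
    fun γ hγ h => congrArg Fin.val (s.eq_attrA₁ hG₂ hG₁ ((key ⟨γ, hγ⟩).1 h).1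
      ((key ⟨γ, hγ⟩).1 h).2)

theorem attrComma_eq (E : t.Describes D) (restricted : Bool) :
    d.attrComma restricted t (s.attr.val, D.sectionOb hH.opfibration s.sec) =
      D.commaOb hH.opfibration restricted (s.comma hG₂ hG₁ restricted) := by
  unfold CompInput.attrComma CompInput.Describes.commaOb CompInput.Describes.commaCode
  refine congrArg (List.idxOf · _) (Prod.ext (E.nodeA₂_eq hH hG₂ s) (Prod.ext ?_
    (Prod.ext ?_ ?_)))
  · exact congrArg (D.sectionOb hH.opfibration) (s.elBaseChange_left hG₂).symm
  · dsimp only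
    rw [E.attrA₁_eq hH hG₂ hG₁, E.nodeA₁, List.getD_ofFn]
    rfl
  · dsimp only
    rw [E.attrValue_eq hH hG₂]
    exact ((D.B₁.ar_eq_ident_iff (eqToHom (s.obj_attrA₁ hG₂ hG₁).symm)).2 ⟨_, rfl⟩).symm

end AttrTable.Describes

end

/-! ### The composite query -/

theorem List.filterMap_eq_ofFn {α β : Type*} (l : List α) (g : α → Option β)
    (f : Fin l.length → β) (h : ∀ i : Fin l.length, g l[i.val] = some (f i)) :
    l.filterMap g = List.ofFn f := by
  induction l with
  | nil => rfl
  | cons a l ih =>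
    have h0 : g a = some (f ⟨0, Nat.succ_pos _⟩) := h ⟨0, Nat.succ_pos _⟩
    rw [List.filterMap_cons_some h0, List.ofFn_succ]
    exact congrArg _ (ih (fun i => f i.succ) fun i => h i.succ)

theorem List.map_eq_ofFn {α β : Type*} (l : List α) (g : α → β)
    (f : Fin l.length → β) (h : ∀ i : Fin l.length, g l[i.val] = f i) :
    l.map g = List.ofFn f := by
  refine List.ext_getElem (by simp) fun i h1 h2 => ?_
  rw [List.getElem_map, List.getElem_ofFn]
  exact h ⟨i, _⟩

namespace Pres

variable {τ : Type u} {t : CatTable} {C : Type} [Category.{0} C] (p : Pres t C) {k : ℕ}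
  {c : Fin k → C} {ty : Fin k → τ} {T : TypedSignature τ} {Φ : C ⥤ T.Schema} {W : ℕ → List ℕ}
  (hW : p.IsWords Φ W) (onAttr : Fin k → Fin T.numAttrs)
  (hob : ∀ i, Φ.obj (c i) = T.attrOb (onAttr i)) (hty : ∀ i, T.attrType (onAttr i) = ty i)

/-- The typed signature morphism of a functor, along the given words and with the given map of
attributes. -/
noncomputable def ofTypedFunctor : TypedMorphism (p.typedSig (fun i => p.node (c i)) ty) T where
  toSignatureMorphism := p.ofFunctor hW
  onAttr := onAttr
  attrNode_comm i := congrArg nodeOf ((congrArg Φ.obj (p.obAt_node (c i))).trans (hob i))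
  attrType_comm := hty

theorem code_ofTypedFunctor (N : ℕ → ℕ)
    (hN : ∀ x, N (p.ob x) = FinGraph.nodeVal (nodeOf (Φ.obj x))) :
    (p.ofTypedFunctor hW onAttr hob hty).code =
      ((List.range t.numOb).map N, (List.range t.numAr).map W,
        List.ofFn fun i => (onAttr i).val) := by
  refine Prod.ext ?_ (Prod.ext ?_ rfl)
  · refine List.ofFn_eq_map_range _ _ fun i => ?_
    refine (hN (p.obAt i)).symm.trans (congrArg N (p.ob_obAt i))
  · refine List.ofFn_eq_map_range _ _ fun e => ?_
    let e' : p.srcNode e ⟶ p.tgtNode e := ⟨e, rfl, rfl⟩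
    exact (hW (p.arAt e')).choose_spec.2.trans (congrArg W (p.ar_arAt e'))

end Pres

namespace CompInput

/-- The word of an arrow of the comma category in `A₁`, for given words of the arrows of `A₁`. -/
def leftWord (restricted : Bool) (d : CompInput) (W : List (List ℕ)) (r : ℕ) : List ℕ :=
  W.getD ((d.commaArrows restricted).getD r (0, 0, 0, 0)).2.2.2 []

/-- The word of an arrow of the category of sections in `B₂`, for given words of the arrows of
`B₂`. -/
def rightWord (d : CompInput) (W : List (List ℕ)) (r : ℕ) : List ℕ :=
  W.getD (d.sectionArrows.getD r (0, 0, 0, 0)).2.2.1 []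

/-- The edge of the category of sections below an entry of the list of arrows of the comma
category. -/
def midWordOf (restricted : Bool) (d : CompInput) (r : ArrowCode) : List ℕ :=
  [d.sectionArrows.idxOf ((commaAt (d.commaList restricted) r.1).2.1,
    (commaAt (d.commaList restricted) r.2.1).2.1, d.G₂.ar r.2.2.1, 0)]

/-- The edge of the category of sections below an arrow of the comma category. -/
def midWord (restricted : Bool) (d : CompInput) (r : ℕ) : List ℕ :=
  d.midWordOf restricted ((d.commaArrows restricted).getD r (0, 0, 0, 0))

/-- The code of the projection of the composite to `A₁`. -/
def leftCode (restricted : Bool) (d : CompInput) (t : AttrTable) (W : List (List ℕ)) :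
    MorphismCode :=
  ((List.range (d.commaTable restricted).numOb).map fun i =>
      (commaAt (d.commaList restricted) i).2.2.1,
    (List.range (d.commaTable restricted).numAr).map (d.leftWord restricted W),
    (d.attrList t).map (d.attrA₁ t))

/-- The code of the middle morphism of the composite. -/
def midCode (restricted : Bool) (d : CompInput) (t : AttrTable) : MorphismCode :=
  ((List.range (d.commaTable restricted).numOb).map fun i =>
      (commaAt (d.commaList restricted) i).2.1,
    (List.range (d.commaTable restricted).numAr).map (d.midWord restricted),
    List.range (d.attrList t).length)

/-- The code of the projection of the composite to `B₂`. -/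
def rightCode (d : CompInput) (t : AttrTable) (W : List (List ℕ)) : MorphismCode :=
  ((List.range d.sectionTable.numOb).map fun i => (sectionAt d.sectionList i).1,
    (List.range d.sectionTable.numAr).map (d.rightWord W),
    (d.attrList t).map Prod.fst)

/-- The code of the first middle signature of the composite. -/
def commaSigCode {τ : Type u} (restricted : Bool) (d : CompInput) (t : AttrTable)
    (attrs : List (ℕ × τ)) : SignatureCode τ :=
  (d.commaTable restricted).sigCode ((d.attrList t).filterMap fun p =>
    attrs[p.1]?.map fun a => (d.attrComma restricted t p, a.2))

/-- The code of the second middle signature of the composite. -/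
def sectionSigCode {τ : Type u} (d : CompInput) (t : AttrTable)
    (attrs : List (ℕ × τ)) : SignatureCode τ :=
  d.sectionTable.sigCode ((d.attrList t).filterMap fun p =>
    attrs[p.1]?.map fun a => (p.2, a.2))

end CompInput

section

variable {τ : Type u} {A₁ B₁ X A₂ B₂ : TypedSignature τ} {G₁ : TypedMorphism A₁ B₁}
  {H₁ : TypedMorphism B₁ X} {F₂ : TypedMorphism A₂ X} {G₂ : TypedMorphism A₂ B₂}
  {d : CompInput} {D : d.Describes G₁.functor H₁.functor F₂.functor G₂.functor}

theorem CompInput.Describes.isWords_left {W : List (List ℕ)}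
    (hW : D.A₁.IsWords (𝟭 A₁.Schema) fun r => W.getD r [])
    (hH : IsDiscreteOpfibration H₁.functor) (restricted : Bool) :
    (D.commaPres hH restricted).IsWords (T := A₁.toSignature) (CommaOn.snd _ _ _)
      (d.leftWord restricted W) := by
  intro m m' f
  obtain ⟨q, h1, h2⟩ := hW f.right
  refine ⟨q, h1, h2.trans (congrArg (fun r : ArrowCode => W.getD r.2.2.2 [])
    (List.getD_idxOf ((D.mem_commaArrows hH restricted).2 ⟨f, rfl⟩) _).symm)⟩

theorem CompInput.Describes.isWords_right {W : List (List ℕ)}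
    (hW : D.B₂.IsWords (𝟭 B₂.Schema) fun r => W.getD r [])
    (hH : IsDiscreteOpfibration H₁.functor) :
    (D.sectionPres hH).IsWords (T := B₂.toSignature) (El.proj _)
      (d.rightWord W) := by
  intro z z' f
  obtain ⟨q, h1, h2⟩ := hW f.hom
  refine ⟨q, h1, h2.trans (congrArg (fun r : ArrowCode => W.getD r.2.2.1 [])
    (List.getD_idxOf ((D.mem_sectionArrows hH).2 ⟨f, rfl⟩) _).symm)⟩

theorem CompInput.Describes.isWords_mid (hH : IsDiscreteOpfibration H₁.functor)
    (restricted : Bool) :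
    (D.commaPres hH restricted).IsWords (T := (D.sectionPres hH).sig)
      ((CommaOn.fst _ _ _ ⋙ elBaseChange F₂.functor G₂.functor hH) ⋙ (D.sectionPres hH).toSchema)
      (d.midWord restricted) := by
  intro m m' f
  refine ⟨Quiver.Path.nil.cons ((D.sectionPres hH).edge
    ((elBaseChange F₂.functor G₂.functor hH).map f.left)), rfl, ?_⟩
  have h1 : (d.commaArrows restricted).getD ((D.commaPres hH restricted).ar f) (0, 0, 0, 0) =
      (D.commaOb hH restricted m, D.commaOb hH restricted m', D.A₂.ar f.left.hom,
        D.A₁.ar f.right) :=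
    List.getD_idxOf ((D.mem_commaArrows hH restricted).2 ⟨f, rfl⟩) _
  refine Eq.trans ?_ (congrArg (d.midWordOf restricted) h1).symm
  unfold CompInput.midWordOf
  dsimp only
  rw [D.commaAt_commaOb, D.commaAt_commaOb, D.G₂.ar]
  rfl

namespace AttrTable.Describes

variable {t : AttrTable} (E : t.Describes D) (hH : H₁.IsSigmaReady) (hG₂ : G₂.IsPiReady)
  (hG₁ : G₁.IsPiReady) (restricted : Bool) {W₁ W₂ : List (List ℕ)}
  (hW₁ : D.A₁.IsWords (𝟭 A₁.Schema) fun r => W₁.getD r [])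
  (hW₂ : D.B₂.IsWords (𝟭 B₂.Schema) fun r => W₂.getD r [])

/-- The signature of the comma category. -/
noncomputable def commaSig : TypedSignature τ :=
  (D.commaPres hH.opfibration restricted).typedSig
    (fun i => (D.commaPres hH.opfibration restricted).node
      ((E.attrAt hH i).comma hG₂ hG₁ restricted))
    fun i => B₂.attrType (E.attrAt hH i).attr

/-- The signature of the category of sections. -/
noncomputable def sectionSig : TypedSignature τ :=
  (D.sectionPres hH.opfibration).typedSig
    (fun i => (D.sectionPres hH.opfibration).node (E.attrAt hH i).sec)
    fun i => B₂.attrType (E.attrAt hH i).attr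

/-- The projection of the comma category to `A₁`. -/
noncomputable def leftMorphism : TypedMorphism (E.commaSig hH hG₂ hG₁ restricted) A₁ :=
  (D.commaPres hH.opfibration restricted).ofTypedFunctor (Φ := CommaOn.snd _ _ _)
    (W := d.leftWord restricted W₁)
    (D.isWords_left hW₁ hH.opfibration restricted)
    (fun i => (E.attrAt hH i).attrA₁ hG₂ hG₁) (fun _ => rfl)
    fun i => (E.attrAt hH i).attrType_attrA₁ hG₂ hG₁

/-- The projection of the category of sections to `B₂`. -/
noncomputable def rightMorphism : TypedMorphism (E.sectionSig hH) B₂ :=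
  (D.sectionPres hH.opfibration).ofTypedFunctor (Φ := El.proj _)
    (W := d.rightWord W₂)
    (D.isWords_right hW₂ hH.opfibration)
    (fun i => (E.attrAt hH i).attr) (fun i => (E.attrAt hH i).base_eq) fun _ => rfl

/-- The functor from the comma category to the category of sections. -/
noncomputable def midMorphism :
    TypedMorphism (E.commaSig hH hG₂ hG₁ restricted) (E.sectionSig hH) :=
  (D.commaPres hH.opfibration restricted).ofTypedFunctor (T := E.sectionSig hH)
    (Φ := (CommaOn.fst _ _ _ ⋙ elBaseChange F₂.functor G₂.functor hH.opfibration) ⋙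
      (D.sectionPres hH.opfibration).toSchema) (W := d.midWord restricted)
    (D.isWords_mid hH.opfibration restricted) id
    (fun i => congrArg (D.sectionPres hH.opfibration).toSchema.obj
      ((E.attrAt hH i).elBaseChange_left hG₂)) fun _ => rfl

theorem code_leftMorphism (hN : ∀ x, D.A₁.ob x = FinGraph.nodeVal (Pres.nodeOf x)) :
    (E.leftMorphism hH hG₂ hG₁ restricted hW₁).code = d.leftCode restricted t W₁ := by
  refine ((D.commaPres hH.opfibration restricted).code_ofTypedFunctor
    (D.isWords_left hW₁ hH.opfibration restricted) _ _ _
    (fun i => (CompInput.commaAt (d.commaList restricted) i).2.2.1) fun m => ?_).trans ?_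
  · exact (congrArg (fun c : CompInput.CommaCode => c.2.2.1)
      (D.commaAt_commaOb hH.opfibration restricted m)).trans (hN _)
  · refine Prod.ext rfl (Prod.ext rfl (List.map_eq_ofFn _ _ _ fun i => ?_).symm)
    rw [← E.attrAt_spec hH i]
    exact E.attrA₁_eq hH hG₂ hG₁ _

theorem code_rightMorphism (hN : ∀ x, D.B₂.ob x = FinGraph.nodeVal (Pres.nodeOf x)) :
    (E.rightMorphism hH hW₂).code = d.rightCode t W₂ := by
  refine ((D.sectionPres hH.opfibration).code_ofTypedFunctor
    (D.isWords_right hW₂ hH.opfibration) _ _ _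
    (fun i => (CompInput.sectionAt d.sectionList i).1) fun m => ?_).trans ?_
  · exact (congrArg (fun c : CompInput.SectionCode => c.1)
      (D.sectionAt_sectionOb hH.opfibration m)).trans (hN _)
  · refine Prod.ext rfl (Prod.ext rfl (List.map_eq_ofFn _ _ _ fun i => ?_).symm)
    rw [← E.attrAt_spec hH i]

theorem code_midMorphism : (E.midMorphism hH hG₂ hG₁ restricted).code =
    d.midCode restricted t := by
  refine ((D.commaPres hH.opfibration restricted).code_ofTypedFunctor
    (D.isWords_mid hH.opfibration restricted) _ _ _
    (fun i => (CompInput.commaAt (d.commaList restricted) i).2.1) fun m => ?_).trans ?_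
  · exact congrArg (fun c : CompInput.CommaCode => c.2.1)
      (D.commaAt_commaOb hH.opfibration restricted m)
  · refine Prod.ext rfl (Prod.ext rfl ?_)
    exact (List.ofFn_eq_map_range _ id fun _ => rfl).trans (List.map_id _)

theorem code_commaSig : (E.commaSig hH hG₂ hG₁ restricted).code =
    d.commaSigCode restricted t (List.ofFn fun a => (D.B₂.ob (B₂.attrOb a), B₂.attrType a)) := by
  refine (Pres.code_typedSig _ _ _).trans ?_
  refine congrArg _ (List.filterMap_eq_ofFn _ _ _ fun i => ?_).symm
  rw [← E.attrAt_spec hH i]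
  dsimp only
  rw [List.getElem?_ofFn, dif_pos (E.attrAt hH i).attr.2, E.attrComma_eq hH hG₂ hG₁]
  rfl

theorem code_sectionSig : (E.sectionSig hH).code =
    d.sectionSigCode t (List.ofFn fun a => (D.B₂.ob (B₂.attrOb a), B₂.attrType a)) := by
  refine (Pres.code_typedSig _ _ _).trans ?_
  refine congrArg _ (List.filterMap_eq_ofFn _ _ _ fun i => ?_).symm
  rw [← E.attrAt_spec hH i]
  dsimp only
  rw [List.getElem?_ofFn, dif_pos (E.attrAt hH i).attr.2]
  rfl

/-- Both classes of arrows have an exact comma square; for the identities this needs that `F₂` is a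
discrete op-fibration. -/
theorem exact_commaClass (hr : restricted = true → IsDiscreteOpfibration F₂.functor) :
    IsExactSquare (CommaOn.fst _ G₁.functor
        (commaClass restricted F₂.functor G₂.functor hH.opfibration G₁.functor))
      (CommaOn.snd _ G₁.functor _) (evalFunctor F₂.functor G₂.functor hH.opfibration)
      G₁.functor (CommaOn.square _ G₁.functor _) := by
  cases restricted with
  | false =>
    exact CommaOn.isExactSquare_of_forall _ _ _ fun _ _ _ h => absurd h Bool.false_ne_true
  | true =>
    have h1 : commaClass true F₂.functor G₂.functor hH.opfibration G₁.functor =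
        CommaOn.IsEqToHom (evalFunctor F₂.functor G₂.functor hH.opfibration) G₁.functor := by
      funext c a v
      exact propext ⟨fun h => h rfl, fun h _ => h⟩
    rw [h1]
    exact CommaOn.isExactSquare_of_isEqToHom _ _
      (isDiscreteOpfibration_evalFunctor F₂.functor G₂.functor hH.opfibration (hr rfl))

theorem isDiscreteOpfibration_snd_commaClass (hr : restricted = true)
    (hF : IsDiscreteOpfibration F₂.functor) :
    IsDiscreteOpfibration (CommaOn.snd (evalFunctor F₂.functor G₂.functor hH.opfibration)
      G₁.functor (commaClass restricted F₂.functor G₂.functor hH.opfibration G₁.functor)) := by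
  have h1 : commaClass restricted F₂.functor G₂.functor hH.opfibration G₁.functor =
      CommaOn.IsEqToHom (evalFunctor F₂.functor G₂.functor hH.opfibration) G₁.functor := by
    funext c a v
    exact propext ⟨fun h => h hr, fun h _ => h⟩
  rw [h1]
  exact CommaOn.isDiscreteOpfibration_snd _ _
    (isDiscreteOpfibration_evalFunctor F₂.functor G₂.functor hH.opfibration hF)

theorem functor_leftMorphism : (E.leftMorphism hH hG₂ hG₁ restricted hW₁).functor =
    (D.commaPres hH.opfibration restricted).ofSchema ⋙ CommaOn.snd _ _ _ :=
  Pres.functor_ofFunctor _ (D.isWords_left hW₁ hH.opfibration restricted)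

theorem functor_rightMorphism : (E.rightMorphism hH hW₂).functor =
    (D.sectionPres hH.opfibration).ofSchema ⋙ El.proj _ :=
  Pres.functor_ofFunctor _ (D.isWords_right hW₂ hH.opfibration)

theorem functor_midMorphism : (E.midMorphism hH hG₂ hG₁ restricted).functor =
    (D.commaPres hH.opfibration restricted).ofSchema ⋙
      (CommaOn.fst _ _ _ ⋙ elBaseChange F₂.functor G₂.functor hH.opfibration) ⋙
        (D.sectionPres hH.opfibration).toSchema :=
  Pres.functor_ofFunctor _ (D.isWords_mid hH.opfibration restricted)

/-- The composition data of the schemas. -/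
noncomputable def compositionData (hr : restricted = true → IsDiscreteOpfibration F₂.functor) :
    CompositionData F₂.functor G₂.functor hH.opfibration G₁.functor
      (E.midMorphism hH hG₂ hG₁ restricted).functor (E.rightMorphism hH hW₂).functor where
  Q := commaClass restricted F₂.functor G₂.functor hH.opfibration G₁.functor
  exact := exact_commaClass hH restricted hr
  E₁ := (D.commaPres hH.opfibration restricted).ofSchema
  E₂ := (D.sectionPres hH.opfibration).ofSchema
  equiv₁ := inferInstanceAs (D.commaPres hH.opfibration restricted).ofSchema.IsEquivalence
  equiv₂ := inferInstanceAs (D.sectionPres hH.opfibration).ofSchema.IsEquivalence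
  bijective₂ := (D.sectionPres hH.opfibration).bijective_ofSchema
  comm := by
    refine (congrArg (· ⋙ (D.sectionPres hH.opfibration).ofSchema)
      (E.functor_midMorphism hH hG₂ hG₁ restricted)).trans ?_
    exact congrArg (fun t => (D.commaPres hH.opfibration restricted).ofSchema ⋙
      (CommaOn.fst _ _ _ ⋙ elBaseChange F₂.functor G₂.functor hH.opfibration) ⋙ t)
        (D.sectionPres hH.opfibration).toSchema_ofSchema
  proj_comm := E.functor_rightMorphism hH hW₂

theorem ofSchema_commaSig (i : Fin (d.attrList t).length) :
    (D.commaPres hH.opfibration restricted).ofSchema.obj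
      ((E.commaSig hH hG₂ hG₁ restricted).attrOb i) =
        (E.attrAt hH i).comma hG₂ hG₁ restricted :=
  (D.commaPres hH.opfibration restricted).obAt_node _

theorem ofSchema_sectionSig (i : Fin (d.attrList t).length) :
    (D.sectionPres hH.opfibration).ofSchema.obj ((E.sectionSig hH).attrOb i) =
      (E.attrAt hH i).sec :=
  (D.sectionPres hH.opfibration).obAt_node _

/-- The composition data of the typed signatures. -/
noncomputable def typedCompositionData
    (hr : restricted = true → IsDiscreteOpfibration F₂.functor) :
    TypedCompositionData G₁ H₁ hH F₂ G₂ (E.leftMorphism hH hG₂ hG₁ restricted hW₁)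
      (E.midMorphism hH hG₂ hG₁ restricted) (E.rightMorphism hH hW₂) where
  data := E.compositionData hH hG₂ hG₁ restricted hW₂ hr
  left_comm := E.functor_leftMorphism hH hG₂ hG₁ restricted hW₁
  attr i := (E.attrAt hH i).attrA₂ hG₂
  base_attr i := congrArg (fun m => m.left.base) (E.ofSchema_commaSig hH hG₂ hG₁ restricted i)
  hom_attr i := by
    have key : ∀ m, m = (E.attrAt hH i).comma hG₂ hG₁ restricted → ∃ h, m.hom = eqToHom h := by
      rintro _ rfl
      exact ⟨((E.attrAt hH i).obj_attrA₁ hG₂ hG₁).symm, rfl⟩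
    exact key _ (E.ofSchema_commaSig hH hG₂ hG₁ restricted i)
  onAttr_right i := ((E.attrAt hH i).onAttr_attrA₂ hG₂).symm
  onAttr_left i := (E.attrAt hH i).onAttr_onAttr_attrA₁ hG₂ hG₁

theorem isPiReady_midMorphism : (E.midMorphism hH hG₂ hG₁ restricted).IsPiReady :=
  Function.bijective_id

theorem isSigmaReady_rightMorphism : (E.rightMorphism hH hW₂).IsSigmaReady where
  opfibration := by
    rw [functor_rightMorphism]
    exact (IsDiscreteOpfibration.of_fullyFaithful
      (D.sectionPres hH.opfibration).bijective_ofSchema).comp (El.isDiscreteOpfibration_proj _)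
  attr_pullback x b h := by
    rw [functor_rightMorphism] at h
    obtain ⟨i, ⟨h1, h2⟩, hu⟩ := E.existsUnique_attrAt hH b
      ((D.sectionPres hH.opfibration).ofSchema.obj x) h
    refine ⟨i, ⟨(D.sectionPres hH.opfibration).bijective_ofSchema.1
      ((E.ofSchema_sectionSig hH i).trans h1), h2⟩, ?_⟩
    rintro j ⟨rfl, h4⟩
    exact hu j ⟨(E.ofSchema_sectionSig hH j).symm, h4⟩

end AttrTable.Describes

end

section

variable {τ : Type u} {S X T : TypedSignature τ} (f : FQLQuery S X) (g : FQLQuery X T)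
  {d : CompInput} {D : d.Describes f.G.functor f.H.functor g.F.functor g.G.functor}
  {t : AttrTable} (E : t.Describes D) (restricted : Bool) {W₁ W₂ : List (List ℕ)}
  (hW₁ : D.A₁.IsWords (𝟭 f.mid₁.Schema) fun r => W₁.getD r [])
  (hW₂ : D.B₂.IsWords (𝟭 g.mid₂.Schema) fun r => W₂.getD r [])

/-- The composite of two queries whose schemas and functors are described by the tables `d` and
`t`, with words `W₁` and `W₂` for the arrows of `A₁` and `B₂`. -/
noncomputable def FQLQuery.composite : FQLQuery S T where
  mid₁ := E.commaSig f.sigmaReady g.piReady f.piReady restricted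
  mid₂ := E.sectionSig f.sigmaReady
  F := (E.leftMorphism f.sigmaReady g.piReady f.piReady restricted hW₁).comp f.F
  G := E.midMorphism f.sigmaReady g.piReady f.piReady restricted
  H := (E.rightMorphism f.sigmaReady hW₂).comp g.H
  finite_source := f.finite_source
  finite_mid₁ := (D.commaPres f.sigmaReady.opfibration restricted).isFinite
  finite_mid₂ := (D.sectionPres f.sigmaReady.opfibration).isFinite
  finite_target := g.finite_target
  piReady := E.isPiReady_midMorphism f.sigmaReady g.piReady f.piReady restricted
  sigmaReady := (E.isSigmaReady_rightMorphism f.sigmaReady hW₂).comp g.sigmaReady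

theorem FQLQuery.nonempty_denote_composite_iso
    (hr : restricted = true → g.IsDeltaRestricted) (dom : τ → Type w) :
    Nonempty ((f.composite g E restricted hW₁ hW₂).denote dom ≅ f.denote dom ⋙ g.denote dom) :=
  nonempty_denote_iso f g
    (E.typedCompositionData f.sigmaReady g.piReady f.piReady restricted hW₁ hW₂ hr)
    (E.isPiReady_midMorphism f.sigmaReady g.piReady f.piReady restricted)
    (E.isSigmaReady_rightMorphism f.sigmaReady hW₂)

theorem FQLQuery.isDeltaRestricted_composite (hr : restricted = true)
    (hf : f.IsDeltaRestricted) (hg : g.IsDeltaRestricted) :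
    (f.composite g E restricted hW₁ hW₂).IsDeltaRestricted := by
  have h1 : (f.composite g E restricted hW₁ hW₂).F.functor =
      ((D.commaPres f.sigmaReady.opfibration restricted).ofSchema ⋙ CommaOn.snd _ _ _) ⋙
        f.F.functor :=
    (TypedMorphism.comp_functor _ _).trans (congrArg (· ⋙ f.F.functor)
      (E.functor_leftMorphism f.sigmaReady g.piReady f.piReady restricted hW₁))
  unfold FQLQuery.IsDeltaRestricted
  rw [h1]
  exact ((IsDiscreteOpfibration.of_fullyFaithful
    (D.commaPres f.sigmaReady.opfibration restricted).bijective_ofSchema).comp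
      (AttrTable.Describes.isDiscreteOpfibration_snd_commaClass f.sigmaReady restricted hr hg)).comp
        hf

/-- The code of the composite is computed from the tables, the words and the codes of
the queries. -/
theorem FQLQuery.code_composite (hN₁ : ∀ x, D.A₁.ob x = FinGraph.nodeVal (Pres.nodeOf x))
    (hN₂ : ∀ x, D.B₂.ob x = FinGraph.nodeVal (Pres.nodeOf x)) :
    (f.composite g E restricted hW₁ hW₂).code =
      ((S.code, d.commaSigCode restricted t g.mid₂.code.2.2.2,
          d.sectionSigCode t g.mid₂.code.2.2.2, T.code),
        (compCode (d.leftCode restricted t W₁) f.F.code, d.midCode restricted t,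
          compCode (d.rightCode t W₂) g.H.code)) := by
  have h1 : g.mid₂.code.2.2.2 =
      List.ofFn fun a => (D.B₂.ob (g.mid₂.attrOb a), g.mid₂.attrType a) :=
    congrArg List.ofFn (funext fun a => Prod.ext (hN₂ _).symm rfl)
  rw [h1, ← E.code_commaSig f.sigmaReady g.piReady f.piReady restricted,
    ← E.code_sectionSig f.sigmaReady,
    ← E.code_leftMorphism f.sigmaReady g.piReady f.piReady restricted hW₁ hN₁,
    ← E.code_rightMorphism f.sigmaReady hW₂ hN₂,
    ← E.code_midMorphism f.sigmaReady g.piReady f.piReady restricted,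
    ← TypedMorphism.code_comp, ← TypedMorphism.code_comp]
  rfl

end

/-! ### The tables of two queries -/

/-- The table of a signature morphism, for given certificates of its source and target: the image
of an arrow is the image of the word of its normal form, acting on an identity. -/
def funTable (c c' : SchemaCert) (M : MorphismCode) : FunTable :=
  (M.1, (List.range c.1.length).map fun r =>
    c'.actWord (c'.idt (M.1.getD (c.rep r).1 0)) (wordMap M (c.rep r).2.2))

theorem isFun_funTable {τ : Type u} {S T : TypedSignature τ} (F : TypedMorphism S T)
    {c c' : SchemaCert} (h : SchemaCert.Valid S.toSignature c)
    (h' : SchemaCert.Valid T.toSignature c') :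
    IsFun h.pres h'.pres F.functor (funTable c c' F.code) where
  ob x := F.code_node (Pres.nodeOf x)
  ar {x y} k := by
    obtain ⟨q, rfl⟩ := Pres.exists_pathHom _ k
    obtain ⟨h1, q', h2, h3⟩ := h.exists_normalForm q
    refine (List.getD_map_range _ (h.entry (S.pathHom q)).2.1 0).trans ?_
    rw [h1, ← h2, ← F.pathCode_onPath]
    refine Eq.trans ?_ (congrArg (fun k => (h'.entry (F.functor.map k)).1) h3)
    refine Eq.trans ?_ (h'.entry_pathHom (F.onPath.map (X := (Pres.nodeOf x : Paths S.Node))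
      (Y := (Pres.nodeOf y : Paths S.Node)) q')).symm
    exact congrArg (fun n => c'.actWord (c'.idt n) _) (F.code_node (Pres.nodeOf x))

/-- Certificates of the five schemas `A₁`, `B₁`, `X`, `A₂`, `B₂` of two composable queries. -/
abbrev QueryCerts : Type := SchemaCert × SchemaCert × SchemaCert × SchemaCert × SchemaCert

/-- The part of the code of a typed signature without attributes. -/
def rawOfCode {τ : Type u} (s : SignatureCode τ) : RawSignature := (s.1, s.2.1, s.2.2.1)

namespace QueryCerts

variable {τ : Type u}

/-- All five certificates are valid. -/
def check (z : QueryCode τ × QueryCode τ) (c : QueryCerts) : Bool :=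
  SchemaCert.check (rawOfCode z.1.1.2.1) c.1 && SchemaCert.check (rawOfCode z.1.1.2.2.1) c.2.1 &&
    SchemaCert.check (rawOfCode z.1.1.2.2.2) c.2.2.1 &&
    SchemaCert.check (rawOfCode z.2.1.2.1) c.2.2.2.1 &&
    SchemaCert.check (rawOfCode z.2.1.2.2.1) c.2.2.2.2

/-- The tables of the categories and of the functors of two queries. -/
def input (z : QueryCode τ × QueryCode τ) (c : QueryCerts) : CompInput :=
  ((SchemaCert.table z.1.1.2.1.1 c.1, SchemaCert.table z.1.1.2.2.1.1 c.2.1,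
      SchemaCert.table z.2.1.2.1.1 c.2.2.2.1, SchemaCert.table z.2.1.2.2.1.1 c.2.2.2.2),
    (funTable c.1 c.2.1 z.1.2.2.1, funTable c.2.1 c.2.2.1 z.1.2.2.2,
      funTable c.2.2.2.1 c.2.2.1 z.2.2.1, funTable c.2.2.2.1 c.2.2.2.2 z.2.2.2.1))

/-- The attribute table of two queries. -/
def attrTable (z : QueryCode τ × QueryCode τ) : AttrTable :=
  ((z.1.1.2.1.2.2.2.map Prod.fst, z.2.1.2.1.2.2.2.map Prod.fst, z.2.1.2.2.1.2.2.2.map Prod.fst),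
    (z.1.2.2.1.2.2, z.1.2.2.2.2.2, z.2.2.1.2.2, z.2.2.2.1.2.2))

/-- The normal forms of the arrows. -/
def words (c : SchemaCert) : List (List ℕ) := c.1.map fun r => r.2.2

/-- The code of the composite of two queries, for given certificates. -/
def output (restricted : Bool) (z : QueryCode τ × QueryCode τ) (c : QueryCerts) : QueryCode τ :=
  ((z.1.1.1, (input z c).commaSigCode restricted (attrTable z) z.2.1.2.2.1.2.2.2,
      (input z c).sectionSigCode (attrTable z) z.2.1.2.2.1.2.2.2, z.2.1.2.2.2),
    (compCode ((input z c).leftCode restricted (attrTable z) (words c.1)) z.1.2.1,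
      (input z c).midCode restricted (attrTable z),
      compCode ((input z c).rightCode (attrTable z) (words c.2.2.2.2)) z.2.2.2.2))

theorem words_getD (c : SchemaCert) (r : ℕ) : (words c).getD r [] = (c.rep r).2.2 := by
  unfold words SchemaCert.rep
  rw [List.getD_eq_getElem?_getD, List.getD_eq_getElem?_getD, List.getElem?_map]
  cases c.1[r]? <;> rfl

variable {S X T : TypedSignature τ} (f : FQLQuery S X) (g : FQLQuery X T) {c : QueryCerts}

theorem check_iff : check (f.code, g.code) c = true ↔
    SchemaCert.Valid f.mid₁.toSignature c.1 ∧ SchemaCert.Valid f.mid₂.toSignature c.2.1 ∧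
      SchemaCert.Valid X.toSignature c.2.2.1 ∧ SchemaCert.Valid g.mid₁.toSignature c.2.2.2.1 ∧
        SchemaCert.Valid g.mid₂.toSignature c.2.2.2.2 := by
  unfold check
  rw [Bool.and_eq_true, Bool.and_eq_true, Bool.and_eq_true, Bool.and_eq_true, and_assoc, and_assoc,
    and_assoc]
  exact and_congr SchemaCert.check_iff (and_congr SchemaCert.check_iff
    (and_congr SchemaCert.check_iff (and_congr SchemaCert.check_iff SchemaCert.check_iff)))

/-- Valid certificates yield the code of a composite. -/
theorem exists_composite (restricted : Bool) (hr : restricted = true → g.IsDeltaRestricted)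
    (hc : check (f.code, g.code) c = true) : ∃ h : FQLQuery S T,
      h.code = output restricted (f.code, g.code) c ∧
      (restricted = true → f.IsDeltaRestricted → h.IsDeltaRestricted) ∧
      ∀ dom : τ → Type w, Nonempty (h.denote dom ≅ f.denote dom ⋙ g.denote dom) := by
  obtain ⟨hA₁, hB₁, hX, hA₂, hB₂⟩ := (check_iff f g).1 hc
  let D : (input (f.code, g.code) c).Describes f.G.functor f.H.functor g.F.functor g.G.functor :=
    { A₁ := hA₁.pres
      B₁ := hB₁.pres
      A₂ := hA₂.pres
      B₂ := hB₂.pres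
      tableX := _
      X := hX.pres
      G₁ := isFun_funTable f.G hA₁ hB₁
      H₁ := isFun_funTable f.H hB₁ hX
      F₂ := isFun_funTable g.F hA₂ hX
      G₂ := isFun_funTable g.G hA₂ hB₂ }
  have E : (attrTable (f.code, g.code)).Describes D :=
    ⟨List.map_ofFn, List.map_ofFn, List.map_ofFn, rfl, rfl, rfl, rfl⟩
  have hW : ∀ {S : Signature} {c : SchemaCert} (h : SchemaCert.Valid S c),
      h.pres.IsWords (𝟭 S.Schema) fun r => (words c).getD r [] := by
    intro S c h x y k
    obtain ⟨q, h1, h2⟩ := h.isWords k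
    exact ⟨q, h1, h2.trans (words_getD c _).symm⟩
  refine ⟨f.composite g E restricted (hW hA₁) (hW hB₂), ?_, ?_, ?_⟩
  · exact f.code_composite g E restricted (hW hA₁) (hW hB₂) (fun _ => rfl) fun _ => rfl
  · exact fun h hf => f.isDeltaRestricted_composite g E restricted (hW hA₁) (hW hB₂) h hf (hr h)
  · exact f.nonempty_denote_composite_iso g E restricted (hW hA₁) (hW hB₂) hr

/-- Two queries have valid certificates, as their schemas are finite. -/
theorem exists_check : ∃ c, check (f.code, g.code) c = true := by
  obtain ⟨c₁, h₁⟩ := SchemaCert.exists_valid f.mid₁.toSignature f.finite_mid₁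
  obtain ⟨c₂, h₂⟩ := SchemaCert.exists_valid f.mid₂.toSignature f.finite_mid₂
  obtain ⟨c₃, h₃⟩ := SchemaCert.exists_valid X.toSignature f.finite_target
  obtain ⟨c₄, h₄⟩ := SchemaCert.exists_valid g.mid₁.toSignature g.finite_mid₁
  obtain ⟨c₅, h₅⟩ := SchemaCert.exists_valid g.mid₂.toSignature g.finite_mid₂
  exact ⟨(c₁, c₂, c₃, c₄, c₅), (check_iff f g).2 ⟨h₁, h₂, h₃, h₄, h₅⟩⟩

end QueryCerts

/-! ### The search for certificates -/

section

variable {τ : Type u}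

/-- The composite determined by the certificates that `n` encodes, or `none` if these are not
valid. -/
def searchStep (restricted : Bool) (z : QueryCode τ × QueryCode τ) (n : ℕ) :
    Option (QueryCode τ) :=
  (Encodable.decode n : Option QueryCerts).bind fun c =>
    bif QueryCerts.check z c then some (QueryCerts.output restricted z c) else none

/-- The composition of queries: a search for certificates, and the output of the first that
are valid. -/
def composeQueries (restricted : Bool) (z : QueryCode τ × QueryCode τ) : Part (QueryCode τ) :=
  Nat.rfindOpt (searchStep restricted z)

theorem searchStep_eq_some {restricted : Bool} {z : QueryCode τ × QueryCode τ} {n : ℕ}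
    {y : QueryCode τ} (h : searchStep restricted z n = some y) :
    ∃ c, QueryCerts.check z c = true ∧ QueryCerts.output restricted z c = y := by
  obtain ⟨c, -, h1⟩ := Option.bind_eq_some_iff.1 h
  cases h2 : QueryCerts.check z c with
  | true =>
    rw [h2] at h1
    exact ⟨c, h2, Option.some.inj h1⟩
  | false =>
    rw [h2] at h1
    exact (Option.some_ne_none y h1.symm).elim

/-- The search halts on two queries, and its output is the code of a composite. -/
theorem exists_mem_composeQueries {S X T : TypedSignature τ} (f : FQLQuery S X)
    (g : FQLQuery X T) (restricted : Bool) (hr : restricted = true → g.IsDeltaRestricted) :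
    ∃ h : FQLQuery S T, h.code ∈ composeQueries restricted (f.code, g.code) ∧
      (restricted = true → f.IsDeltaRestricted → h.IsDeltaRestricted) ∧
      ∀ dom : τ → Type w, Nonempty (h.denote dom ≅ f.denote dom ⋙ g.denote dom) := by
  have hdom : (composeQueries restricted (f.code, g.code)).Dom := by
    obtain ⟨c, hc⟩ := QueryCerts.exists_check f g
    refine Nat.rfindOpt_dom.2
      ⟨Encodable.encode c, QueryCerts.output restricted (f.code, g.code) c, ?_⟩
    unfold searchStep
    rw [Encodable.encodek, Option.bind_some, hc]
    rfl
  obtain ⟨y, hy⟩ := Part.dom_iff_mem.1 hdom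
  obtain ⟨n, hn⟩ := Nat.rfindOpt_spec hy
  obtain ⟨c, hc, rfl⟩ := searchStep_eq_some hn
  obtain ⟨h, h1, h2, h3⟩ := QueryCerts.exists_composite f g restricted hr hc
  exact ⟨h, h1.symm ▸ hy, h2, h3⟩

end

/-! ### Primitive recursive functions -/

-- The closure properties of primitive recursive functions are stated in composed form, so that
-- `fun_prop` proves that a function is primitive recursive from the shape of its definition.

attribute [fun_prop] Primrec
attribute [fun_prop] Primrec.id Primrec.const Primrec.comp Primrec.pair

namespace Primrec

variable {α β γ σ : Type*} [Primcodable α] [Primcodable β] [Primcodable γ] [Primcodable σ]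

@[fun_prop]
theorem fst' {f : α → β × γ} (hf : Primrec f) : Primrec fun a => (f a).1 := fst.comp hf

@[fun_prop]
theorem snd' {f : α → β × γ} (hf : Primrec f) : Primrec fun a => (f a).2 := snd.comp hf

@[fun_prop]
theorem add' {f g : α → ℕ} (hf : Primrec f) (hg : Primrec g) : Primrec fun a => f a + g a :=
  nat_add.comp hf hg

@[fun_prop]
theorem and' {f g : α → Bool} (hf : Primrec f) (hg : Primrec g) : Primrec fun a => f a && g a :=
  Primrec.and.comp hf hg

@[fun_prop]
theorem or' {f g : α → Bool} (hf : Primrec f) (hg : Primrec g) : Primrec fun a => f a || g a :=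
  Primrec.or.comp hf hg

@[fun_prop]
theorem not' {f : α → Bool} (hf : Primrec f) : Primrec fun a => !f a := Primrec.not.comp hf

@[fun_prop]
theorem cond' {c : α → Bool} {f g : α → β} (hc : Primrec c) (hf : Primrec f) (hg : Primrec g) :
    Primrec fun a => bif c a then f a else g a := cond hc hf hg

@[fun_prop]
theorem eqb [DecidableEq β] {f g : α → β} (hf : Primrec f) (hg : Primrec g) :
    Primrec fun a => _root_.eqb (f a) (g a) := (Primrec.eq.comp hf hg).decide

@[fun_prop]
theorem decide_lt {f g : α → ℕ} (hf : Primrec f) (hg : Primrec g) :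
    Primrec fun a => decide (f a < g a) := (nat_lt.comp hf hg).decide

@[fun_prop]
theorem some' {f : α → β} (hf : Primrec f) : Primrec fun a => some (f a) := option_some.comp hf

@[fun_prop]
theorem optionBind' {f : α → Option β} {g : α → β → Option γ} (hf : Primrec f)
    (hg : Primrec fun p : α × β => g p.1 p.2) : Primrec fun a => (f a).bind (g a) :=
  option_bind hf hg

@[fun_prop]
theorem optionMap' {f : α → Option β} {g : α → β → γ} (hf : Primrec f)
    (hg : Primrec fun p : α × β => g p.1 p.2) : Primrec fun a => (f a).map (g a) :=
  option_map hf hg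

@[fun_prop]
theorem decode' {f : α → ℕ} (hf : Primrec f) :
    Primrec fun a => (Encodable.decode (f a) : Option β) := Primrec.decode.comp hf

@[fun_prop]
theorem cons' {f : α → β} {g : α → List β} (hf : Primrec f) (hg : Primrec g) :
    Primrec fun a => f a :: g a := list_cons.comp hf hg

@[fun_prop]
theorem append' {f g : α → List β} (hf : Primrec f) (hg : Primrec g) :
    Primrec fun a => f a ++ g a := list_append.comp hf hg

@[fun_prop]
theorem length' {f : α → List β} (hf : Primrec f) : Primrec fun a => (f a).length :=
  list_length.comp hf

@[fun_prop]
theorem range' {f : α → ℕ} (hf : Primrec f) : Primrec fun a => List.range (f a) :=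
  list_range.comp hf

@[fun_prop]
theorem map' {f : α → List β} {g : α → β → γ} (hf : Primrec f)
    (hg : Primrec fun p : α × β => g p.1 p.2) : Primrec fun a => (f a).map (g a) :=
  list_map hf hg

@[fun_prop]
theorem flatMap' {f : α → List β} {g : α → β → List γ} (hf : Primrec f)
    (hg : Primrec fun p : α × β => g p.1 p.2) : Primrec fun a => (f a).flatMap (g a) :=
  list_flatMap hf hg

@[fun_prop]
theorem foldl' {f : α → List β} {g : α → σ} {h : α → σ → β → σ} (hf : Primrec f)
    (hg : Primrec g) (hh : Primrec fun p : α × (σ × β) => h p.1 p.2.1 p.2.2) :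
    Primrec fun a => (f a).foldl (h a) (g a) :=
  list_foldl (h := fun a p => h a p.1 p.2) hf hg hh

@[fun_prop]
theorem filter' {f : α → List β} {p : α → β → Bool} (hf : Primrec f)
    (hp : Primrec fun q : α × β => p q.1 q.2) : Primrec fun a => (f a).filter (p a) := by
  have h : ∀ (l : List β) (p : β → Bool),
      l.flatMap (fun x => bif p x then [x] else []) = l.filter p := by
    intro l p
    induction l with
    | nil => rfl
    | cons x l ih =>
      rw [List.flatMap_cons, ih, List.filter_cons]
      cases p x <;> rfl
  have h1 : Primrec fun a => (f a).flatMap fun x => bif p a x then [x] else [] := by fun_prop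
  exact h1.of_eq fun a => h (f a) (p a)

@[fun_prop]
theorem filterMap' {f : α → List β} {g : α → β → Option γ} (hf : Primrec f)
    (hg : Primrec fun p : α × β => g p.1 p.2) : Primrec fun a => (f a).filterMap (g a) :=
  listFilterMap hf hg

@[fun_prop]
theorem any' {f : α → List β} {p : α → β → Bool} (hf : Primrec f)
    (hp : Primrec fun q : α × β => p q.1 q.2) : Primrec fun a => (f a).any (p a) := by
  have h1 : Primrec fun a => decide (0 < ((f a).filter (p a)).length) := by fun_prop
  refine h1.of_eq fun a => ?_
  rw [Bool.eq_iff_iff, decide_eq_true_iff, List.length_pos_iff_exists_mem, List.any_eq_true]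
  exact exists_congr fun x => List.mem_filter

@[fun_prop]
theorem all' {f : α → List β} {p : α → β → Bool} (hf : Primrec f)
    (hp : Primrec fun q : α × β => p q.1 q.2) : Primrec fun a => (f a).all (p a) := by
  have h1 : Primrec fun a => !(f a).any fun x => !p a x := by fun_prop
  exact h1.of_eq fun a => List.all_eq_not_any_not.symm

@[fun_prop]
theorem getElem?' {f : α → List β} {g : α → ℕ} (hf : Primrec f) (hg : Primrec g) :
    Primrec fun a => (f a)[g a]? := list_getElem?.comp hf hg

@[fun_prop]
theorem getD' {f : α → List β} {g : α → ℕ} (d : β) (hf : Primrec f) (hg : Primrec g) :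
    Primrec fun a => (f a).getD (g a) d := (list_getD d).comp hf hg

@[fun_prop]
theorem headD' {f : α → List β} (d : β) (hf : Primrec f) : Primrec fun a => (f a).headD d := by
  have h1 : Primrec fun a => (f a).getD 0 d := by fun_prop
  refine h1.of_eq fun a => ?_
  cases f a <;> rfl

@[fun_prop]
theorem idxOf' [BEq β] [LawfulBEq β] {f : α → List β} {g : α → β} (hf : Primrec f)
    (hg : Primrec g) : Primrec fun a => (f a).idxOf (g a) := by
  let := Encodable.decidableEqOfEncodable β
  obtain rfl : ‹BEq β› = instBEqOfDecidableEq := lawful_beq_subsingleton _ _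
  exact list_idxOf.comp hg hf

@[fun_prop]
theorem natRec' {f : α → ℕ} {g : α → β} {h : α → ℕ → β → β} (hf : Primrec f) (hg : Primrec g)
    (hh : Primrec fun p : α × (ℕ × β) => h p.1 p.2.1 p.2.2) :
    Primrec fun a => Nat.rec (motive := fun _ => β) (g a) (h a) (f a) :=
  nat_rec' (h := fun a p => h a p.1 p.2) hf hg hh

end Primrec

/-! ### The composition of queries is computable -/

section

variable {α : Type*} [Primcodable α]

@[fun_prop]
theorem CatTable.primrec_numOb {f : α → CatTable} (hf : Primrec f) :
    Primrec fun a => CatTable.numOb (f a) := by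
  unfold CatTable.numOb
  fun_prop

@[fun_prop]
theorem CatTable.primrec_numAr {f : α → CatTable} (hf : Primrec f) :
    Primrec fun a => CatTable.numAr (f a) := by
  unfold CatTable.numAr
  fun_prop

@[fun_prop]
theorem CatTable.primrec_src {f : α → CatTable} {g : α → ℕ} (hf : Primrec f) (hg : Primrec g) :
    Primrec fun a => CatTable.src (f a) (g a) := by
  unfold CatTable.src
  fun_prop

@[fun_prop]
theorem CatTable.primrec_tgt {f : α → CatTable} {g : α → ℕ} (hf : Primrec f) (hg : Primrec g) :
    Primrec fun a => CatTable.tgt (f a) (g a) := by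
  unfold CatTable.tgt
  fun_prop

@[fun_prop]
theorem CatTable.primrec_ident {f : α → CatTable} {g : α → ℕ} (hf : Primrec f) (hg : Primrec g) :
    Primrec fun a => CatTable.ident (f a) (g a) := by
  unfold CatTable.ident
  fun_prop

@[fun_prop]
theorem CatTable.primrec_comp {f : α → CatTable} {g h : α → ℕ} (hf : Primrec f) (hg : Primrec g)
    (hh : Primrec h) : Primrec fun a => CatTable.comp (f a) (g a) (h a) := by
  unfold CatTable.comp
  fun_prop

@[fun_prop]
theorem CatTable.primrec_eqnsCode {f : α → CatTable} (hf : Primrec f) :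
    Primrec fun a => CatTable.eqnsCode (f a) := by
  unfold CatTable.eqnsCode
  fun_prop

@[fun_prop]
theorem CatTable.primrec_sigCode {τ : Type*} [Primcodable τ] {f : α → CatTable}
    {g : α → List (ℕ × τ)} (hf : Primrec f) (hg : Primrec g) :
    Primrec fun a => CatTable.sigCode (f a) (g a) := by
  unfold CatTable.sigCode
  fun_prop

@[fun_prop]
theorem primrec_compCode {f g : α → MorphismCode} (hf : Primrec f) (hg : Primrec g) :
    Primrec fun a => compCode (f a) (g a) := by
  unfold compCode
  fun_prop

@[fun_prop]
theorem primrec_wordMap {f : α → MorphismCode} {g : α → List ℕ} (hf : Primrec f)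
    (hg : Primrec g) : Primrec fun a => wordMap (f a) (g a) := by
  unfold wordMap
  fun_prop

@[fun_prop]
theorem primrec_walk {f : α → List (ℕ × ℕ)} {g : α → ℕ} {h : α → List ℕ} (hf : Primrec f)
    (hg : Primrec g) (hh : Primrec h) : Primrec fun a => walk (f a) (g a) (h a) := by
  unfold walk
  fun_prop

@[fun_prop]
theorem primrec_stepValid {f : α → List (ℕ × ℕ)} {g : α → List (ℕ × List ℕ × List ℕ)} {h : α → ℕ}
    {k : α → List ℕ} {l : α → DerivationStep} (hf : Primrec f) (hg : Primrec g) (hh : Primrec h)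
    (hk : Primrec k) (hl : Primrec l) :
    Primrec fun a => stepValid (f a) (g a) (h a) (k a) (l a) := by
  unfold stepValid
  fun_prop

@[fun_prop]
theorem primrec_derive {f : α → List (ℕ × ℕ)} {g : α → List (ℕ × List ℕ × List ℕ)} {h : α → ℕ}
    {k : α → List ℕ} {l : α → List DerivationStep} (hf : Primrec f) (hg : Primrec g)
    (hh : Primrec h) (hk : Primrec k) (hl : Primrec l) :
    Primrec fun a => derive (f a) (g a) (h a) (k a) (l a) := by
  unfold derive
  fun_prop

@[fun_prop]
theorem SchemaCert.primrec_rep {f : α → SchemaCert} {g : α → ℕ} (hf : Primrec f)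
    (hg : Primrec g) : Primrec fun a => SchemaCert.rep (f a) (g a) := by
  unfold SchemaCert.rep
  fun_prop

@[fun_prop]
theorem SchemaCert.primrec_act {f : α → SchemaCert} {g h : α → ℕ} (hf : Primrec f)
    (hg : Primrec g) (hh : Primrec h) : Primrec fun a => SchemaCert.act (f a) (g a) (h a) := by
  unfold SchemaCert.act
  fun_prop

@[fun_prop]
theorem SchemaCert.primrec_actWord {f : α → SchemaCert} {g : α → ℕ} {h : α → List ℕ}
    (hf : Primrec f) (hg : Primrec g) (hh : Primrec h) :
    Primrec fun a => SchemaCert.actWord (f a) (g a) (h a) := by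
  unfold SchemaCert.actWord
  fun_prop

@[fun_prop]
theorem SchemaCert.primrec_idt {f : α → SchemaCert} {g : α → ℕ} (hf : Primrec f)
    (hg : Primrec g) : Primrec fun a => SchemaCert.idt (f a) (g a) := by
  unfold SchemaCert.idt
  fun_prop

@[fun_prop]
theorem SchemaCert.primrec_der {f : α → SchemaCert} {g h : α → ℕ} (hf : Primrec f)
    (hg : Primrec g) (hh : Primrec h) : Primrec fun a => SchemaCert.der (f a) (g a) (h a) := by
  unfold SchemaCert.der
  fun_prop

@[fun_prop]
theorem SchemaCert.primrec_checkIdt {f : α → RawSignature} {g : α → SchemaCert} (hf : Primrec f)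
    (hg : Primrec g) : Primrec fun a => SchemaCert.checkIdt (f a) (g a) := by
  unfold SchemaCert.checkIdt
  fun_prop

@[fun_prop]
theorem SchemaCert.primrec_checkRep {f : α → RawSignature} {g : α → SchemaCert} (hf : Primrec f)
    (hg : Primrec g) : Primrec fun a => SchemaCert.checkRep (f a) (g a) := by
  unfold SchemaCert.checkRep
  fun_prop

@[fun_prop]
theorem SchemaCert.primrec_checkAct {f : α → RawSignature} {g : α → SchemaCert} (hf : Primrec f)
    (hg : Primrec g) : Primrec fun a => SchemaCert.checkAct (f a) (g a) := by
  unfold SchemaCert.checkAct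
  fun_prop

@[fun_prop]
theorem SchemaCert.primrec_checkEqns {f : α → RawSignature} {g : α → SchemaCert} (hf : Primrec f)
    (hg : Primrec g) : Primrec fun a => SchemaCert.checkEqns (f a) (g a) := by
  unfold SchemaCert.checkEqns
  fun_prop

@[fun_prop]
theorem SchemaCert.primrec_check {f : α → RawSignature} {g : α → SchemaCert} (hf : Primrec f)
    (hg : Primrec g) : Primrec fun a => SchemaCert.check (f a) (g a) := by
  unfold SchemaCert.check
  fun_prop

@[fun_prop]
theorem SchemaCert.primrec_table {f : α → ℕ} {g : α → SchemaCert} (hf : Primrec f)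
    (hg : Primrec g) : Primrec fun a => SchemaCert.table (f a) (g a) := by
  unfold SchemaCert.table
  fun_prop

@[fun_prop]
theorem primrec_tableOfLists {f : α → ℕ} {g : α → List ArrowCode} {h : α → List (ℕ × ℕ)}
    {k : α → List (List (ℕ × ℕ))} (hf : Primrec f) (hg : Primrec g) (hh : Primrec h)
    (hk : Primrec k) : Primrec fun a => tableOfLists (f a) (g a) (h a) (k a) := by
  unfold tableOfLists
  fun_prop

@[fun_prop]
theorem FunTable.primrec_ob {f : α → FunTable} {g : α → ℕ} (hf : Primrec f) (hg : Primrec g) :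
    Primrec fun a => FunTable.ob (f a) (g a) := by
  unfold FunTable.ob
  fun_prop

@[fun_prop]
theorem FunTable.primrec_ar {f : α → FunTable} {g : α → ℕ} (hf : Primrec f) (hg : Primrec g) :
    Primrec fun a => FunTable.ar (f a) (g a) := by
  unfold FunTable.ar
  fun_prop

@[fun_prop]
theorem primrec_listsOf {β : Type*} [Primcodable β] {f : α → List β} {g : α → ℕ} (hf : Primrec f)
    (hg : Primrec g) : Primrec fun a => listsOf (f a) (g a) := by
  unfold listsOf
  fun_prop

@[fun_prop]
theorem primrec_matricesOf {f : α → List ℕ} {g h : α → ℕ} (hf : Primrec f) (hg : Primrec g)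
    (hh : Primrec h) : Primrec fun a => matricesOf (f a) (g a) (h a) := by
  unfold matricesOf
  fun_prop

@[fun_prop]
theorem primrec_entry {f : α → List (List ℕ)} {g h : α → ℕ} (hf : Primrec f) (hg : Primrec g)
    (hh : Primrec h) : Primrec fun a => entry (f a) (g a) (h a) := by
  unfold entry
  fun_prop

@[fun_prop]
theorem CompInput.primrec_A₁ {f : α → CompInput} (hf : Primrec f) :
    Primrec fun a => CompInput.A₁ (f a) := by
  unfold CompInput.A₁
  fun_prop

@[fun_prop]
theorem CompInput.primrec_B₁ {f : α → CompInput} (hf : Primrec f) :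
    Primrec fun a => CompInput.B₁ (f a) := by
  unfold CompInput.B₁
  fun_prop

@[fun_prop]
theorem CompInput.primrec_A₂ {f : α → CompInput} (hf : Primrec f) :
    Primrec fun a => CompInput.A₂ (f a) := by
  unfold CompInput.A₂
  fun_prop

@[fun_prop]
theorem CompInput.primrec_B₂ {f : α → CompInput} (hf : Primrec f) :
    Primrec fun a => CompInput.B₂ (f a) := by
  unfold CompInput.B₂
  fun_prop

@[fun_prop]
theorem CompInput.primrec_G₁ {f : α → CompInput} (hf : Primrec f) :
    Primrec fun a => CompInput.G₁ (f a) := by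
  unfold CompInput.G₁
  fun_prop

@[fun_prop]
theorem CompInput.primrec_H₁ {f : α → CompInput} (hf : Primrec f) :
    Primrec fun a => CompInput.H₁ (f a) := by
  unfold CompInput.H₁
  fun_prop

@[fun_prop]
theorem CompInput.primrec_F₂ {f : α → CompInput} (hf : Primrec f) :
    Primrec fun a => CompInput.F₂ (f a) := by
  unfold CompInput.F₂
  fun_prop

@[fun_prop]
theorem CompInput.primrec_G₂ {f : α → CompInput} (hf : Primrec f) :
    Primrec fun a => CompInput.G₂ (f a) := by
  unfold CompInput.G₂
  fun_prop

@[fun_prop]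
theorem CompInput.primrec_relevant {f : α → CompInput} {g h k : α → ℕ} (hf : Primrec f)
    (hg : Primrec g) (hh : Primrec h) (hk : Primrec k) :
    Primrec fun a => CompInput.relevant (f a) (g a) (h a) (k a) := by
  unfold CompInput.relevant
  fun_prop

@[fun_prop]
theorem CompInput.primrec_sectionCandidates {f : α → CompInput} (hf : Primrec f) :
    Primrec fun a => CompInput.sectionCandidates (f a) := by
  unfold CompInput.sectionCandidates
  fun_prop

@[fun_prop]
theorem CompInput.primrec_valuesValid {f : α → CompInput} {g : α → CompInput.SectionCode}
    (hf : Primrec f) (hg : Primrec g) : Primrec fun a => CompInput.valuesValid (f a) (g a) := by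
  unfold CompInput.valuesValid
  fun_prop

@[fun_prop]
theorem CompInput.primrec_transport {f : α → CompInput} {g h k : α → ℕ} (hf : Primrec f)
    (hg : Primrec g) (hh : Primrec h) (hk : Primrec k) :
    Primrec fun a => CompInput.transport (f a) (g a) (h a) (k a) := by
  unfold CompInput.transport
  fun_prop

@[fun_prop]
theorem CompInput.primrec_valuesCompatible {f : α → CompInput} {g : α → CompInput.SectionCode}
    (hf : Primrec f) (hg : Primrec g) :
    Primrec fun a => CompInput.valuesCompatible (f a) (g a) := by
  unfold CompInput.valuesCompatible
  fun_prop

@[fun_prop]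
theorem CompInput.primrec_sectionList {f : α → CompInput} (hf : Primrec f) :
    Primrec fun a => CompInput.sectionList (f a) := by
  unfold CompInput.sectionList
  fun_prop

@[fun_prop]
theorem CompInput.primrec_sectionAt {f : α → List CompInput.SectionCode} {g : α → ℕ}
    (hf : Primrec f) (hg : Primrec g) : Primrec fun a => CompInput.sectionAt (f a) (g a) := by
  unfold CompInput.sectionAt
  fun_prop

@[fun_prop]
theorem CompInput.primrec_sectionArrow {f : α → CompInput} {g h : α → CompInput.SectionCode}
    {k : α → ℕ} (hf : Primrec f) (hg : Primrec g) (hh : Primrec h) (hk : Primrec k) :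
    Primrec fun a => CompInput.sectionArrow (f a) (g a) (h a) (k a) := by
  unfold CompInput.sectionArrow
  fun_prop

@[fun_prop]
theorem CompInput.primrec_sectionArrowsOf {f : α → CompInput} {g : α → List CompInput.SectionCode}
    (hf : Primrec f) (hg : Primrec g) :
    Primrec fun a => CompInput.sectionArrowsOf (f a) (g a) := by
  unfold CompInput.sectionArrowsOf
  fun_prop

@[fun_prop]
theorem CompInput.primrec_sectionArrows {f : α → CompInput} (hf : Primrec f) :
    Primrec fun a => CompInput.sectionArrows (f a) := by
  unfold CompInput.sectionArrows
  fun_prop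

@[fun_prop]
theorem primrec_pairTable {β : Type*} [Primcodable β] {f : α → List ArrowCode}
    {g : α → ArrowCode → ArrowCode → β} (hf : Primrec f)
    (hg : Primrec fun p : α × (ArrowCode × ArrowCode) => g p.1 p.2.1 p.2.2) :
    Primrec fun a => pairTable (f a) (g a) := by
  have h : ∀ {δ : Type} [Primcodable δ] {a : δ → α} {r s : δ → ArrowCode}, Primrec a →
      Primrec r → Primrec s → Primrec fun x => g (a x) (r x) (s x) := fun ha hr hs =>
    hg.comp (ha.pair (hr.pair hs))
  unfold pairTable
  fun_prop

@[fun_prop]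
theorem CompInput.primrec_sectionTable {f : α → CompInput} (hf : Primrec f) :
    Primrec fun a => CompInput.sectionTable (f a) := by
  unfold CompInput.sectionTable
  fun_prop

@[fun_prop]
theorem CompInput.primrec_evalAt {f : α → CompInput} {g : α → CompInput.SectionCode} {h : α → ℕ}
    (hf : Primrec f) (hg : Primrec g) (hh : Primrec h) :
    Primrec fun a => CompInput.evalAt (f a) (g a) (h a) := by
  unfold CompInput.evalAt
  fun_prop

@[fun_prop]
theorem CompInput.primrec_commaValid (restricted : Bool) {f : α → CompInput}
    {g : α → List CompInput.SectionCode} {h : α → CompInput.CommaCode} (hf : Primrec f)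
    (hg : Primrec g) (hh : Primrec h) :
    Primrec fun a => CompInput.commaValid restricted (f a) (g a) (h a) := by
  unfold CompInput.commaValid
  fun_prop

@[fun_prop]
theorem CompInput.primrec_commaListOf (restricted : Bool) {f : α → CompInput}
    {g : α → List CompInput.SectionCode} (hf : Primrec f) (hg : Primrec g) :
    Primrec fun a => CompInput.commaListOf restricted (f a) (g a) := by
  unfold CompInput.commaListOf
  fun_prop

@[fun_prop]
theorem CompInput.primrec_commaList (restricted : Bool) {f : α → CompInput} (hf : Primrec f) :
    Primrec fun a => CompInput.commaList restricted (f a) := by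
  unfold CompInput.commaList
  fun_prop

@[fun_prop]
theorem CompInput.primrec_commaAt {f : α → List CompInput.CommaCode} {g : α → ℕ} (hf : Primrec f)
    (hg : Primrec g) : Primrec fun a => CompInput.commaAt (f a) (g a) := by
  unfold CompInput.commaAt
  fun_prop

@[fun_prop]
theorem CompInput.primrec_commaArrow {f : α → CompInput} {g : α → List ArrowCode}
    {h k : α → CompInput.CommaCode} {l m : α → ℕ} (hf : Primrec f) (hg : Primrec g)
    (hh : Primrec h) (hk : Primrec k) (hl : Primrec l) (hm : Primrec m) :
    Primrec fun a => CompInput.commaArrow (f a) (g a) (h a) (k a) (l a) (m a) := by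
  unfold CompInput.commaArrow
  fun_prop

@[fun_prop]
theorem CompInput.primrec_commaArrowsOf {f : α → CompInput} {g : α → List ArrowCode}
    {h : α → List CompInput.CommaCode} (hf : Primrec f) (hg : Primrec g) (hh : Primrec h) :
    Primrec fun a => CompInput.commaArrowsOf (f a) (g a) (h a) := by
  unfold CompInput.commaArrowsOf
  fun_prop

@[fun_prop]
theorem CompInput.primrec_commaArrows (restricted : Bool) {f : α → CompInput} (hf : Primrec f) :
    Primrec fun a => CompInput.commaArrows restricted (f a) := by
  unfold CompInput.commaArrows
  fun_prop

@[fun_prop]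
theorem CompInput.primrec_commaTable (restricted : Bool) {f : α → CompInput} (hf : Primrec f) :
    Primrec fun a => CompInput.commaTable restricted (f a) := by
  unfold CompInput.commaTable
  fun_prop

@[fun_prop]
theorem primrec_firstBelow {f : α → ℕ} {p : α → ℕ → Bool} (hf : Primrec f)
    (hp : Primrec fun q : α × ℕ => p q.1 q.2) : Primrec fun a => firstBelow (f a) (p a) := by
  unfold firstBelow
  fun_prop

@[fun_prop]
theorem AttrTable.primrec_nodeA₁ {f : α → AttrTable} (hf : Primrec f) :
    Primrec fun a => AttrTable.nodeA₁ (f a) := by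
  unfold AttrTable.nodeA₁
  fun_prop

@[fun_prop]
theorem AttrTable.primrec_nodeA₂ {f : α → AttrTable} (hf : Primrec f) :
    Primrec fun a => AttrTable.nodeA₂ (f a) := by
  unfold AttrTable.nodeA₂
  fun_prop

@[fun_prop]
theorem AttrTable.primrec_nodeB₂ {f : α → AttrTable} (hf : Primrec f) :
    Primrec fun a => AttrTable.nodeB₂ (f a) := by
  unfold AttrTable.nodeB₂
  fun_prop

@[fun_prop]
theorem AttrTable.primrec_G₁ {f : α → AttrTable} (hf : Primrec f) :
    Primrec fun a => AttrTable.G₁ (f a) := by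
  unfold AttrTable.G₁
  fun_prop

@[fun_prop]
theorem AttrTable.primrec_H₁ {f : α → AttrTable} (hf : Primrec f) :
    Primrec fun a => AttrTable.H₁ (f a) := by
  unfold AttrTable.H₁
  fun_prop

@[fun_prop]
theorem AttrTable.primrec_F₂ {f : α → AttrTable} (hf : Primrec f) :
    Primrec fun a => AttrTable.F₂ (f a) := by
  unfold AttrTable.F₂
  fun_prop

@[fun_prop]
theorem AttrTable.primrec_G₂ {f : α → AttrTable} (hf : Primrec f) :
    Primrec fun a => AttrTable.G₂ (f a) := by
  unfold AttrTable.G₂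
  fun_prop

@[fun_prop]
theorem AttrTable.primrec_attrA₂ {f : α → AttrTable} {g : α → ℕ} (hf : Primrec f)
    (hg : Primrec g) : Primrec fun a => AttrTable.attrA₂ (f a) (g a) := by
  unfold AttrTable.attrA₂
  fun_prop

@[fun_prop]
theorem CompInput.primrec_attrList {f : α → CompInput} {g : α → AttrTable} (hf : Primrec f)
    (hg : Primrec g) : Primrec fun a => CompInput.attrList (f a) (g a) := by
  unfold CompInput.attrList
  fun_prop

@[fun_prop]
theorem CompInput.primrec_attrValue {f : α → CompInput} {g : α → AttrTable} {h : α → ℕ × ℕ}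
    (hf : Primrec f) (hg : Primrec g) (hh : Primrec h) :
    Primrec fun a => CompInput.attrValue (f a) (g a) (h a) := by
  unfold CompInput.attrValue
  fun_prop

@[fun_prop]
theorem CompInput.primrec_attrA₁ {f : α → CompInput} {g : α → AttrTable} {h : α → ℕ × ℕ}
    (hf : Primrec f) (hg : Primrec g) (hh : Primrec h) :
    Primrec fun a => CompInput.attrA₁ (f a) (g a) (h a) := by
  unfold CompInput.attrA₁
  fun_prop

@[fun_prop]
theorem CompInput.primrec_attrComma (restricted : Bool) {f : α → CompInput} {g : α → AttrTable}
    {h : α → ℕ × ℕ} (hf : Primrec f) (hg : Primrec g) (hh : Primrec h) :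
    Primrec fun a => CompInput.attrComma restricted (f a) (g a) (h a) := by
  unfold CompInput.attrComma
  fun_prop

@[fun_prop]
theorem CompInput.primrec_leftWord (restricted : Bool) {f : α → CompInput} {g : α → List (List ℕ)}
    {h : α → ℕ} (hf : Primrec f) (hg : Primrec g) (hh : Primrec h) :
    Primrec fun a => CompInput.leftWord restricted (f a) (g a) (h a) := by
  unfold CompInput.leftWord
  fun_prop

@[fun_prop]
theorem CompInput.primrec_rightWord {f : α → CompInput} {g : α → List (List ℕ)} {h : α → ℕ}
    (hf : Primrec f) (hg : Primrec g) (hh : Primrec h) :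
    Primrec fun a => CompInput.rightWord (f a) (g a) (h a) := by
  unfold CompInput.rightWord
  fun_prop

@[fun_prop]
theorem CompInput.primrec_midWordOf (restricted : Bool) {f : α → CompInput} {g : α → ArrowCode}
    (hf : Primrec f) (hg : Primrec g) :
    Primrec fun a => CompInput.midWordOf restricted (f a) (g a) := by
  unfold CompInput.midWordOf
  fun_prop

@[fun_prop]
theorem CompInput.primrec_midWord (restricted : Bool) {f : α → CompInput} {g : α → ℕ}
    (hf : Primrec f) (hg : Primrec g) :
    Primrec fun a => CompInput.midWord restricted (f a) (g a) := by
  unfold CompInput.midWord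
  fun_prop

@[fun_prop]
theorem CompInput.primrec_leftCode (restricted : Bool) {f : α → CompInput} {g : α → AttrTable}
    {h : α → List (List ℕ)} (hf : Primrec f) (hg : Primrec g) (hh : Primrec h) :
    Primrec fun a => CompInput.leftCode restricted (f a) (g a) (h a) := by
  unfold CompInput.leftCode
  fun_prop

@[fun_prop]
theorem CompInput.primrec_midCode (restricted : Bool) {f : α → CompInput} {g : α → AttrTable}
    (hf : Primrec f) (hg : Primrec g) :
    Primrec fun a => CompInput.midCode restricted (f a) (g a) := by
  unfold CompInput.midCode
  fun_prop

@[fun_prop]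
theorem CompInput.primrec_rightCode {f : α → CompInput} {g : α → AttrTable}
    {h : α → List (List ℕ)} (hf : Primrec f) (hg : Primrec g) (hh : Primrec h) :
    Primrec fun a => CompInput.rightCode (f a) (g a) (h a) := by
  unfold CompInput.rightCode
  fun_prop

@[fun_prop]
theorem CompInput.primrec_commaSigCode {τ : Type*} [Primcodable τ] (restricted : Bool)
    {f : α → CompInput} {g : α → AttrTable} {h : α → List (ℕ × τ)} (hf : Primrec f)
    (hg : Primrec g) (hh : Primrec h) :
    Primrec fun a => CompInput.commaSigCode restricted (f a) (g a) (h a) := by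
  unfold CompInput.commaSigCode
  fun_prop

@[fun_prop]
theorem CompInput.primrec_sectionSigCode {τ : Type*} [Primcodable τ] {f : α → CompInput}
    {g : α → AttrTable} {h : α → List (ℕ × τ)} (hf : Primrec f) (hg : Primrec g)
    (hh : Primrec h) : Primrec fun a => CompInput.sectionSigCode (f a) (g a) (h a) := by
  unfold CompInput.sectionSigCode
  fun_prop

@[fun_prop]
theorem primrec_funTable {f g : α → SchemaCert} {h : α → MorphismCode} (hf : Primrec f)
    (hg : Primrec g) (hh : Primrec h) : Primrec fun a => funTable (f a) (g a) (h a) := by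
  unfold funTable
  fun_prop

@[fun_prop]
theorem primrec_rawOfCode {τ : Type*} [Primcodable τ] {f : α → SignatureCode τ} (hf : Primrec f) :
    Primrec fun a => rawOfCode (f a) := by
  unfold rawOfCode
  fun_prop

@[fun_prop]
theorem QueryCerts.primrec_check {τ : Type*} [Primcodable τ] {f : α → QueryCode τ × QueryCode τ}
    {g : α → QueryCerts} (hf : Primrec f) (hg : Primrec g) :
    Primrec fun a => QueryCerts.check (f a) (g a) := by
  unfold QueryCerts.check
  fun_prop

@[fun_prop]
theorem QueryCerts.primrec_input {τ : Type*} [Primcodable τ] {f : α → QueryCode τ × QueryCode τ}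
    {g : α → QueryCerts} (hf : Primrec f) (hg : Primrec g) :
    Primrec fun a => QueryCerts.input (f a) (g a) := by
  unfold QueryCerts.input
  fun_prop

@[fun_prop]
theorem QueryCerts.primrec_attrTable {τ : Type*} [Primcodable τ]
    {f : α → QueryCode τ × QueryCode τ} (hf : Primrec f) :
    Primrec fun a => QueryCerts.attrTable (f a) := by
  unfold QueryCerts.attrTable
  fun_prop

@[fun_prop]
theorem QueryCerts.primrec_words {f : α → SchemaCert} (hf : Primrec f) :
    Primrec fun a => QueryCerts.words (f a) := by
  unfold QueryCerts.words
  fun_prop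

@[fun_prop]
theorem QueryCerts.primrec_output {τ : Type*} [Primcodable τ] (restricted : Bool)
    {f : α → QueryCode τ × QueryCode τ} {g : α → QueryCerts} (hf : Primrec f) (hg : Primrec g) :
    Primrec fun a => QueryCerts.output restricted (f a) (g a) := by
  unfold QueryCerts.output
  fun_prop

@[fun_prop]
theorem primrec_searchStep {τ : Type*} [Primcodable τ] (restricted : Bool)
    {f : α → QueryCode τ × QueryCode τ} {g : α → ℕ} (hf : Primrec f) (hg : Primrec g) :
    Primrec fun a => searchStep restricted (f a) (g a) := by
  unfold searchStep
  fun_prop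

end

/-- The search is partial recursive, as each of its steps is primitive recursive. -/
theorem partrec_composeQueries {τ : Type u} [Primcodable τ] (restricted : Bool) :
    Partrec (composeQueries (τ := τ) restricted) := by
  have h : Primrec fun p : (QueryCode τ × QueryCode τ) × ℕ => searchStep restricted p.1 p.2 := by
    fun_prop
  exact Partrec.rfindOpt h.to_comp

/-- Closure of FQL queries under composition, by an algorithm that depends only on the
set of (names of) base types; and the same for `Δ`-restricted queries. -/
theorem mainTheorem1 {τ : Type u} [Primcodable τ] :
    (∃ compose : QueryCode τ × QueryCode τ →. QueryCode τ, Partrec compose ∧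
      ∀ {S X T : TypedSignature τ} (f : FQLQuery S X) (g : FQLQuery X T),
        ∃ h : FQLQuery S T, h.code ∈ compose (f.code, g.code) ∧
          ∀ dom : τ → Type w, Nonempty (h.denote dom ≅ f.denote dom ⋙ g.denote dom)) ∧
    (∃ compose : QueryCode τ × QueryCode τ →. QueryCode τ, Partrec compose ∧
      ∀ {S X T : TypedSignature τ} (f : FQLQuery S X) (g : FQLQuery X T),
        f.IsDeltaRestricted → g.IsDeltaRestricted →
        ∃ h : FQLQuery S T, h.IsDeltaRestricted ∧ h.code ∈ compose (f.code, g.code) ∧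
          ∀ dom : τ → Type w, Nonempty (h.denote dom ≅ f.denote dom ⋙ g.denote dom)) := by
  refine ⟨⟨composeQueries false, partrec_composeQueries false, fun f g => ?_⟩,
    ⟨composeQueries true, partrec_composeQueries true, fun f g hf hg => ?_⟩⟩
  · obtain ⟨h, h1, -, h2⟩ := exists_mem_composeQueries f g false
      fun h => absurd h Bool.false_ne_true
    exact ⟨h, h1, h2⟩
  · obtain ⟨h, h1, h2, h3⟩ := exists_mem_composeQueries f g true fun _ => hg
    exact ⟨h, h2 rfl hf, h1, h3⟩
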